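/- Let $T>0$, let $(\Omega,\mathcal F,\mathbb P)$ be a probability space with a filtration $\mathbb F=(\mathcal F_t)_{t\in[0,T]}$ satisfying the usual conditions, and let $L$ be a real random variable. Put $\mathcal G_t=\bigcap_{T\ge s>t}(\mathcal F_s\vee\sigma(L))$ for $t<T$, $\mathcal G_T=\mathcal F_T\vee\sigma(L)$, and $\mathbb G=(\mathcal G_t)_{t\in[0,T]}$. Let $Q_t(\omega,\mathrm dx)$ be a regular version of the conditional law of $L$ given $\mathcal F_t$, chosen such that $t\mapsto Q_t(\omega,\cdot)$ is almost surely càdlàg for the weak topology, with left limits $Q_{t-}(\omega,\mathrm dx)$. (No domination of the random measures $Q_t$ by a deterministic measure is assumed.) Let $M=(M_t)_{t\in[0,T]}$ be a càdlàg $\mathbb F$-local martingale whose predictable quadratic variation $\langle M,M\rangle$ exists (for instance $M$ continuous or locally bounded); here $\langle X,Y\rangle$ denotes the predictable càdlàg process of finite variation, null at $0$, such that $XY-\langle X,Y\rangle$ is an $\mathbb F$-local martingale, and $\langle M,M\rangle$ is nondecreasing. Let $(t,\omega,x)\mapsto\alpha_t^x(\omega)$ be real-valued and measurable for the product of the $\mathbb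 F$-predictable and the Borel $\sigma$-algebras. Assume that for every $a\in\mathbb R$, almost surely, $$\int_0^T\int_{(a,\infty)}|\alpha_s^x|\,Q_{s-}(\cdot,\mathrm dx)\,\mathrm d\langle M,M\rangle_s<\infty ,$$ and that for every $a\in\mathbb R$ the predictable covariation of $\left(Q_t(\cdot,(a,\infty))\right)_t$ and $M$ exists and satisfies, up to indistinguishability, $$\Big\langle \int_{(a,\infty)}Q_{\cdot}(\cdot,\mathrm dx),M\Big\rangle_t=\int_0^t\int_{(a,\infty)}\alpha_s^x\,Q_{s-}(\cdot,\mathrm dx)\,\mathrm d\langle M,M\rangle_s ,\qquad t\in[0,T].$$ Then $\int_0^T|\alpha_s^L|\,\mathrm d\langle M,M\rangle_s<\infty$ almost surely, and $$M_{\cdot}-\int_0^{\cdot}\alpha_s^L\,\mathrm d\langle M,M\rangle_s$$ is a $\mathbb G$-local martingale. If moreover $M$ is an $\mathbb F$-martingale and $\mathbb E\int_0^T|\alpha_s^L|\,\mathrm d\langle M,M\rangle_s<\infty$, then it is a $\mathbb G$-martingale. -/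

import Mathlib

open MeasureTheory ProbabilityTheory Filter Set Topology
open scoped NNReal ENNReal

noncomputable section

namespace Enlargement

/-- The time interval `[0, T]`. -/
abbrev Time (T : ℝ≥0) : Type := Set.Iic T

variable {Ω : Type*} {m : MeasurableSpace Ω} {T : ℝ≥0}

/-- Right-continuity with left limits. -/
def IsCadlag {E : Type*} [TopologicalSpace E] (f : Time T → E) : Prop :=
  ∀ t, ContinuousWithinAt f (Ici t) t ∧ ∃ l, Tendsto f (𝓝[<] t) (𝓝 l)

/-- The usual conditions: right-continuity, and every (outer) null set, measurable or not,
belongs to the initial σ-algebra. -/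
structure UsualConditions (𝓕 : Filtration (Time T) m) (P : Measure Ω) : Prop where
  rightCont : 𝓕.IsRightContinuous
  null : ∀ s : Set Ω, P s = 0 → MeasurableSet[𝓕 ⊥] s

/-- The initial enlargement `𝓖 t = ⋂_{T ≥ s > t} (𝓕 s ∨ σ(L))` for `t < T`,
and `𝓖 T = 𝓕 T ∨ σ(L)`. -/
def enlarge (𝓕 : Filtration (Time T) m) (L : Ω → ℝ) (hL : Measurable L) :
    Filtration (Time T) m :=
  (𝓕 ⊔ Filtration.const (Time T) (MeasurableSpace.comap L inferInstance) hL.comap_le).rightCont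

/-- Local martingales on the closed interval `[0, T]` with almost surely càdlàg paths.
The initial value need not be integrable. -/
def IsLocalMartingale (𝓕 : Filtration (Time T) m) (P : Measure Ω) (X : Time T → Ω → ℝ) : Prop :=
  (∀ᵐ ω ∂P, IsCadlag fun t ↦ X t ω) ∧ Locally (fun Y ↦ Martingale Y 𝓕 P) 𝓕 X P

/-- `A` is a version of the predictable covariation `⟨X, Y⟩` : a predictable càdlàg process of
finite variation, null at time `0`, such that `X Y - A` is a local martingale. -/
structure IsPredictableCovariation (𝓕 : Filtration (Time T) m) (P : Measure Ω)
    (X Y A : Time T → Ω → ℝ) : Prop where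
  predictable : IsStronglyPredictable 𝓕 A
  zero : ∀ᵐ ω ∂P, A ⊥ ω = 0
  cadlag : ∀ᵐ ω ∂P, IsCadlag fun t ↦ A t ω
  finiteVariation : ∀ᵐ ω ∂P, BoundedVariationOn (fun t ↦ A t ω) univ
  localMartingale : IsLocalMartingale 𝓕 P fun t ω ↦ X t ω * Y t ω - A t ω

/-- `C` is a version of the predictable quadratic variation `⟨X, X⟩`, with nondecreasing paths. -/
structure IsPredictableQuadraticVariation (𝓕 : Filtration (Time T) m) (P : Measure Ω)
    (X C : Time T → Ω → ℝ) : Prop extends IsPredictableCovariation 𝓕 P X X C where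
  mono : ∀ᵐ ω ∂P, Monotone fun t ↦ C t ω

instance : CompactIccSpace (Time T) where
  isCompact_Icc {a b} := by
    have h := (Topology.IsClosedEmbedding.subtypeVal
      (isClosed_Iic (a := T))).isCompact_preimage (isCompact_Icc (a := (a : ℝ≥0)) (b := b))
    exact h

open Classical in
/-- The Lebesgue–Stieltjes measure `df` on `[0, T]` of a nondecreasing right-continuous function,
with `df (s, t] = f t - f s` and no mass at time `0` (and the zero measure for any other `f`). -/
def stieltjes (f : Time T → ℝ) : Measure (Time T) :=
  if h : Monotone f ∧ ∀ t, ContinuousWithinAt f (Ici t) t then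
    (StieltjesFunction.mk f h.1 h.2).measure
  else 0

/-- `Q t ω` is a regular version of the conditional law of `L` given `𝓕 t`, chosen such that
`t ↦ Q t ω` is almost surely càdlàg for the weak topology, so that the left limits `Q_{t-}` make
sense. -/
structure IsRegularConditionalLaw (𝓕 : Filtration (Time T) m) (P : Measure Ω) (L : Ω → ℝ)
    (Q : Time T → Ω → ProbabilityMeasure ℝ) : Prop where
  measurable : ∀ t, ∀ B : Set ℝ, MeasurableSet B →
    Measurable[𝓕 t] fun ω ↦ (Q t ω : Measure ℝ) B
  condProb : ∀ t, ∀ B : Set ℝ, MeasurableSet B →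
    (fun ω ↦ (Q t ω : Measure ℝ).real B) =ᵐ[P] P⟦L ⁻¹' B | 𝓕 t⟧
  cadlag : ∀ᵐ ω ∂P, IsCadlag fun t ↦ Q t ω

/-- The left limit `Q_{t-}(ω, dx)` in the weak topology (and `Q_0` at `t = 0`). -/
def leftLaw (Q : Time T → Ω → ProbabilityMeasure ℝ) (t : Time T) (ω : Ω) : Measure ℝ :=
  (Function.leftLim (fun s ↦ Q s ω) t : ProbabilityMeasure ℝ)

/-- The tail process `∫_a^∞ Q_t(ω, dx) = Q_t(ω, (a, ∞))`. -/
def tail (Q : Time T → Ω → ProbabilityMeasure ℝ) (a : ℝ) (t : Time T) (ω : Ω) : ℝ :=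
  (Q t ω : Measure ℝ).real (Ioi a)

/-- `∫_0^t ∫_a^∞ α_s^x(ω) Q_{s-}(ω, dx) dC_s(ω)`; the process `α_s^x(ω)` is written `α s x ω`. -/
def tailIntegral (Q : Time T → Ω → ProbabilityMeasure ℝ) (C : Time T → Ω → ℝ)
    (α : Time T → ℝ → Ω → ℝ) (a : ℝ) (t : Time T) (ω : Ω) : ℝ :=
  ∫ s in Ioc ⊥ t, ∫ x in Ioi a, α s x ω ∂(leftLaw Q s ω) ∂(stieltjes fun u ↦ C u ω)

/-- The compensated process `M_t - ∫_0^t α_s^L dC_s`. -/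
def compensated (M C : Time T → Ω → ℝ) (α : Time T → ℝ → Ω → ℝ) (L : Ω → ℝ)
    (t : Time T) (ω : Ω) : ℝ :=
  M t ω - ∫ s in Ioc ⊥ t, α s (L ω) ω ∂(stieltjes fun u ↦ C u ω)

end Enlargement

end

noncomputable section

namespace Enlargement

variable {Ω : Type*} {m : MeasurableSpace Ω} {T : ℝ≥0}

/-! ### The time interval -/

/-! Write `C` for `⟨M, M⟩`. Ignoring integrability, fix `s < t`, an event `B` of `𝓕 s` and a real
`a`. Since `Q` is the conditional law of `L`, the mean of `M_t - M_s` over `B ∩ {L > a}` is the mean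
over `B` of `Q_t(a, ∞) M_t - Q_s(a, ∞) M_s`. The bracket hypothesis turns it into the mean over `B`
of `∫_s^t ∫_{(a, ∞)} α_u^x Q_{u-}(dx) dC_u`, and this is the mean over `B ∩ {L > a}` of `∫_s^t α_u^L
dC_u` (`setIntegral_stopped_eq_drift`). The sets `B ∩ {L > a}` form a π-system generating `𝓕 s ∨
σ(L)`, so the compensated increments average to zero on that σ-algebra; right-continuity of paths
then gives the same for `𝓖 s` (`martingale_indicator_stopped`). Only half-lines are tested, so no
density of `Q_t` is needed.

The last equality carries the weight: under `dP dC`, the kernel `Q_{u-}` disintegrates `L` over the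
predictable σ-algebra (`lintegral_leftLaw_stieltjes`). The measure `dC` is the image of Lebesgue
measure on the levels `c` under the first passage times `debut` (`IsIncreasing.map_debut`), and
these times have predictable graphs. It is therefore enough to know that `Q_{r-}` is the right
conditional law at a random time `r` with predictable graph (`IsCadlagLaw.law_leftLaw`).

For such an `r`, the graph is approximated from inside, up to small probability, by countable
intersections of foretold sets (`isApproximable_of_measurableSet`). Their debuts increase to `r` and
are known a little in advance (`exists_announcing`). The conditional law can thus be used at times
strictly before `r`, and its weak limit is `Q_{r-}`.

Integrability rests on the same announcement: it shows that increasing predictable processes are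
locally bounded (`IsIncreasing.exists_bounded`). Applied to `∫ ∫_{(a, ∞)} |α| dQ_- dC` and
transported by the disintegration, this bounds the drift on `{L > a}` up to a stopping time. As `L`
is already known to `𝓖` at time `0`, the events `{L > -n}` may take part in the localization
(`isLocalMartingale_compensated`). -/

/-- The order of `[0, T]` is complete. -/
abbrev timeOrder : ConditionallyCompleteLinearOrderBot (Time T) :=
  letI : Inhabited (Time T) := ⟨⊥⟩
  { (inferInstance : ConditionallyCompleteLinearOrder (Time T)),
    (inferInstance : OrderBot (Time T)) with
    csSup_empty := by
      rw [subset_sSup_def]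
      simp
      rfl }

/-- Truncated backward shift of a time. -/
def shiftBack (t : Time T) (δ : ℝ≥0) : Time T := ⟨t - δ, mem_Iic.2 (tsub_le_self.trans t.2)⟩

lemma coe_shiftBack (t : Time T) (δ : ℝ≥0) : (shiftBack t δ : ℝ≥0) = t - δ := rfl

lemma coe_bot : ((⊥ : Time T) : ℝ≥0) = 0 := rfl

lemma shiftBack_le (t : Time T) (δ : ℝ≥0) : shiftBack t δ ≤ t :=
  by
  rw [← Subtype.coe_le_coe, coe_shiftBack]
  exact tsub_le_self

lemma shiftBack_anti (t : Time T) {δ δ' : ℝ≥0} (h : δ ≤ δ') : shiftBack t δ' ≤ shiftBack t δ := by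
  rw [← Subtype.coe_le_coe, coe_shiftBack, coe_shiftBack]
  exact tsub_le_tsub_left h _

lemma shiftBack_lt {t : Time T} {δ : ℝ≥0} (ht : ⊥ < t) (hδ : 0 < δ) : shiftBack t δ < t := by
  rw [← Subtype.coe_lt_coe, coe_bot] at ht
  rw [← Subtype.coe_lt_coe, coe_shiftBack]
  exact tsub_lt_self ht hδ

/-- The smallest point of the grid of mesh `(n + 1)⁻¹` above `t`, or `T`. -/
def gridAbove (n : ℕ) (t : Time T) : Time T :=
  ⟨min (⌈(t : ℝ≥0) * (n + 1)⌉₊ / (n + 1)) T, mem_Iic.2 (min_le_right _ _)⟩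

lemma coe_gridAbove (n : ℕ) (t : Time T) :
    (gridAbove n t : ℝ≥0) = min ((⌈(t : ℝ≥0) * (n + 1)⌉₊ : ℝ≥0) / (n + 1)) T := rfl

lemma le_gridAbove (n : ℕ) (t : Time T) : t ≤ gridAbove n t := by
  rw [← Subtype.coe_le_coe, coe_gridAbove]
  refine le_min ?_ (mem_Iic.1 t.2)
  rw [le_div_iff₀ (by positivity)]
  exact Nat.le_ceil _

lemma monotone_gridAbove (n : ℕ) : Monotone (gridAbove n : Time T → Time T) := by
  intro s t h
  rw [← Subtype.coe_le_coe, coe_gridAbove, coe_gridAbove]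
  refine min_le_min ?_ le_rfl
  have : (s : ℝ≥0) ≤ t := h
  gcongr

lemma finite_range_gridAbove (n : ℕ) : (range (gridAbove n : Time T → Time T)).Finite := by
  refine ((Set.finite_Iic ⌈(T : ℝ≥0) * (n + 1)⌉₊).image
    fun k : ℕ ↦ (⟨min (k / (n + 1)) T, mem_Iic.2 (min_le_right _ _)⟩ : Time T)).subset ?_
  rintro _ ⟨t, rfl⟩
  refine ⟨⌈(t : ℝ≥0) * (n + 1)⌉₊, ?_, rfl⟩
  have : (t : ℝ≥0) ≤ T := t.2
  simp only [mem_Iic]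
  gcongr

lemma tendsto_gridAbove (t : Time T) : Tendsto (fun n ↦ gridAbove n t) atTop (𝓝[≥] t) := by
  refine tendsto_nhdsWithin_iff.2 ⟨?_, Eventually.of_forall fun n ↦ le_gridAbove n t⟩
  rw [tendsto_subtype_rng]
  have h : Tendsto (fun n : ℕ ↦ (t : ℝ≥0) + 1 / ((n : ℝ≥0) + 1)) atTop (𝓝 t) := by
    simpa using tendsto_const_nhds.add (tendsto_one_div_add_atTop_nhds_zero_nat (𝕜 := ℝ≥0))
  refine tendsto_of_tendsto_of_tendsto_of_le_of_le tendsto_const_nhds h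
    (fun n ↦ le_gridAbove n t) fun n ↦ ?_
  rw [coe_gridAbove]
  refine (min_le_left _ _).trans ?_
  rw [div_le_iff₀ (by positivity), add_mul, one_div, inv_mul_cancel₀ (by positivity)]
  exact (Nat.ceil_lt_add_one (by positivity)).le

/-- The largest point of the grid strictly below `t`, for `0 < t`. -/
def gridBelow (n : ℕ) (t : Time T) : Time T :=
  ⟨min ((⌈(t : ℝ≥0) * (n + 1)⌉₊ - 1 : ℕ) / (n + 1)) t, mem_Iic.2 ((min_le_right _ _).trans t.2)⟩

lemma coe_gridBelow (n : ℕ) {t : Time T} (ht : ⊥ < t) :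
    (gridBelow n t : ℝ≥0) = (⌈(t : ℝ≥0) * (n + 1)⌉₊ - 1 : ℕ) / (n + 1) ∧ gridBelow n t < t := by
  have h0 : (0 : ℝ≥0) < t := by rwa [← Subtype.coe_lt_coe, coe_bot] at ht
  have h : ((⌈(t : ℝ≥0) * (n + 1)⌉₊ - 1 : ℕ) : ℝ≥0) / (n + 1) < t := by
    rw [div_lt_iff₀ (by positivity)]
    refine Nat.lt_ceil.1 (Nat.sub_lt (Nat.ceil_pos.2 (by positivity)) one_pos)
  have h' : (gridBelow n t : ℝ≥0) = (⌈(t : ℝ≥0) * (n + 1)⌉₊ - 1 : ℕ) / (n + 1) :=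
by
    simp only [gridBelow, min_eq_left h.le]
  exact ⟨h', Subtype.coe_lt_coe.1 (h'.trans_lt h)⟩

lemma tendsto_gridBelow {t : Time T} (ht : ⊥ < t) :
    Tendsto (fun n ↦ gridBelow n t) atTop (𝓝[<] t) := by
  refine tendsto_nhdsWithin_iff.2 ⟨?_, Eventually.of_forall fun n ↦ (coe_gridBelow n ht).2⟩
  rw [tendsto_subtype_rng]
  have h : Tendsto (fun n : ℕ ↦ (t : ℝ≥0) - 1 / ((n : ℝ≥0) + 1)) atTop (𝓝 t) := by
    simpa using tendsto_const_nhds.sub (tendsto_one_div_add_atTop_nhds_zero_nat (𝕜 := ℝ≥0))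
  refine tendsto_of_tendsto_of_tendsto_of_le_of_le h tendsto_const_nhds
    (fun n ↦ ?_) fun n ↦ (coe_gridBelow n ht).2.le
  rw [(coe_gridBelow n ht).1, tsub_le_iff_right, ← add_div, le_div_iff₀ (by positivity)]
  refine (Nat.le_ceil _).trans ?_
  exact_mod_cast (by omega : ⌈(t : ℝ≥0) * (n + 1)⌉₊ ≤ ⌈(t : ℝ≥0) * (n + 1)⌉₊ - 1 + 1)

lemma measurable_gridBelow (n : ℕ) : Measurable (gridBelow n : Time T → Time T) := by
  refine Measurable.subtype_mk (Measurable.min (Measurable.div_const ?_ _) measurable_subtype_coe)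
  have h : Measurable fun k : ℕ ↦ ((k - 1 : ℕ) : ℝ≥0) := measurable_from_nat
  exact h.comp (Nat.measurable_ceil.comp (measurable_subtype_coe.mul_const _))

lemma finite_image_gridBelow (n : ℕ) :
    ((gridBelow n : Time T → Time T) '' Ioi ⊥).Finite := by
  refine Finite.of_finite_image (f := ((↑) : Time T → ℝ≥0)) ?_ Subtype.val_injective.injOn
  refine ((Set.finite_Iic (⌈(T : ℝ≥0) * (n + 1)⌉₊ - 1)).image
    fun k : ℕ ↦ (k : ℝ≥0) / (n + 1)).subset ?_
  rintro _ ⟨_, ⟨t, ht, rfl⟩, rfl⟩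
  refine ⟨⌈(t : ℝ≥0) * (n + 1)⌉₊ - 1, ?_, (coe_gridBelow n ht).1.symm⟩
  have : (t : ℝ≥0) ≤ T := t.2
  simp only [mem_Iic]
  gcongr

/-- Measurability of a function of two variables that depends on the first one only through
a map of countable range. -/
lemma measurable_uncurry_of_countable_range {A ι B : Type*} [MeasurableSpace A]
    {m' : MeasurableSpace Ω} [MeasurableSpace B] {g : A → ι} (hg : (range g).Countable)
    (hgm : ∀ i, MeasurableSet (g ⁻¹' {i})) {u : ι → Ω → B}
    (hu : ∀ a, Measurable (u (g a))) : Measurable fun p : A × Ω ↦ u (g p.1) p.2 := by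
  intro s hs
  have : (fun p : A × Ω ↦ u (g p.1) p.2) ⁻¹' s
      = ⋃ i ∈ range g, (g ⁻¹' {i}) ×ˢ (u i ⁻¹' s) := by
    ext ⟨a, ω⟩
    simp only [mem_preimage, mem_iUnion, mem_prod, mem_singleton_iff, exists_prop]
    exact ⟨fun h ↦ ⟨_, ⟨a, rfl⟩, rfl, h⟩, fun ⟨i, _, h, h'⟩ ↦ by rwa [h]⟩
  rw [this]
  refine MeasurableSet.biUnion hg ?_
  rintro _ ⟨a, rfl⟩
  exact (hgm _).prod (hu a hs)

/-- Right-continuous adapted processes are progressive. -/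
lemma isStronglyProgressive_of_rightContinuous {𝓕 : Filtration (Time T) m} {X : Time T → Ω → ℝ}
    (hX : StronglyAdapted 𝓕 X) (hc : ∀ ω t, ContinuousWithinAt (fun t ↦ X t ω) (Ici t) t) :
    IsStronglyProgressive 𝓕 X := by
  intro i
  refine Measurable.stronglyMeasurable ?_
  -- Capping the grid point at `i` keeps every sampled value `𝓕 i`-measurable and, as `s ≤ i`, does
  -- not change the limit.
  let g : ℕ → Iic i → Time T := fun n s ↦ min (gridAbove n (s : Time T)) i
  refine @measurable_of_tendsto_metrizable _ _ (_) _ _ _ _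
    (fun n (p : Iic i × Ω) ↦ X (g n p.1) p.2) _ (fun n ↦ ?_) ?_
  · refine measurable_uncurry_of_countable_range (g := g n) (Finite.countable ?_) (fun j ↦ ?_)
      fun a ↦ ?_
    · refine ((finite_range_gridAbove n).image (fun s : Time T ↦ min s i)).subset ?_
      rintro _ ⟨s, rfl⟩
      exact ⟨_, ⟨_, rfl⟩, rfl⟩
    · have : Measurable (g n) :=
        ((monotone_gridAbove n).measurable.comp measurable_subtype_coe).min measurable_const
      exact this (measurableSet_singleton j)
    · exact (hX.stronglyMeasurable_le (min_le_right _ _)).measurable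
  · rw [tendsto_pi_nhds]
    rintro ⟨⟨s, hs⟩, ω⟩
    refine (hc ω s).tendsto.comp (tendsto_nhdsWithin_iff.2 ⟨?_, Eventually.of_forall fun n ↦
      le_min (le_gridAbove n s) hs⟩)
    have h := ((tendsto_gridAbove s).mono_right nhdsWithin_le_nhds).min
      (tendsto_const_nhds (x := i))
    rwa [min_eq_left hs] at h

/-! ### The predictable σ-algebra -/

lemma predictable_le (𝓕 : Filtration (Time T) m) :
    𝓕.predictable ≤ (inferInstance : MeasurableSpace (Time T × Ω)) := by
  refine measurableSpace_le_predictable_of_measurableSet (fun A hA ↦ ?_) fun i A hA ↦ ?_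
  · exact (measurableSet_singleton _).prod (𝓕.le _ _ hA)
  · exact measurableSet_Ioi.prod (𝓕.le _ _ hA)

lemma predictable_mono {𝓕 𝓖 : Filtration (Time T) m} (h : 𝓕 ≤ 𝓖) :
    𝓕.predictable ≤ 𝓖.predictable :=
  measurableSpace_le_predictable_of_measurableSet
    (fun _ hA ↦ measurableSet_predictable_singleton_bot_prod (h _ _ hA))
    fun i _ hA ↦ measurableSet_predictable_Ioi_prod (h i _ hA)

lemma measurable_fst_predictable (𝓕 : Filtration (Time T) m) :
    Measurable[𝓕.predictable] (Prod.fst : Time T × Ω → Time T) := by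
  refine measurable_of_Ioi fun t ↦ ?_
  convert! measurableSet_predictable_Ioi_prod (𝓕 := 𝓕) (i := t) MeasurableSet.univ using 1
  ext; simp

/-- `𝓕 0`-measurable maps, as maps on `[0, T] × Ω`, are predictable. -/
lemma measurable_snd_predictable {B : Type*} [MeasurableSpace B] {𝓕 : Filtration (Time T) m}
    {f : Ω → B} (hf : Measurable[𝓕 ⊥] f) :
    Measurable[𝓕.predictable] fun p : Time T × Ω ↦ f p.2 := by
  intro s hs
  convert! (measurableSet_predictable_singleton_bot_prod (hf hs)).union
    (measurableSet_predictable_Ioi_prod (i := ⊥) (hf hs)) using 1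
  ext ⟨t, ω⟩
  by_cases h : t = ⊥ <;> simp [h, bot_lt_iff_ne_bot]

lemma measurableSet_predictable_prod {𝓕 : Filtration (Time T) m} {t : Time T} {B : Set (Time T)}
    (hB : MeasurableSet B) (hBt : B ⊆ Ioi t) {A : Set Ω} (hA : MeasurableSet[𝓕 t] A) :
    MeasurableSet[𝓕.predictable] (B ×ˢ A) := by
  convert! (measurable_fst_predictable 𝓕 hB).inter
    (measurableSet_predictable_Ioi_prod (i := t) hA) using 1
  ext ⟨s, ω⟩
  simp only [mem_prod, mem_inter_iff, mem_preimage, mem_Ioi]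
  exact ⟨fun h ↦ ⟨h.1, hBt h.1, h.2⟩, fun h ↦ ⟨h.1, h.2.2⟩⟩

/-- The left limits of an adapted process, when they exist, form a predictable process. -/
lemma measurable_leftLimit {𝓕 : Filtration (Time T) m} {B : Type*} [TopologicalSpace B]
    [TopologicalSpace.PseudoMetrizableSpace B] [MeasurableSpace B] [BorelSpace B]
    {X Y : Time T → Ω → B} (hX : ∀ t, Measurable[𝓕 t] (X t)) (h0 : ∀ ω, Y ⊥ ω = X ⊥ ω)
    (hY : ∀ ω t, ⊥ < t → Tendsto (fun s ↦ X s ω) (𝓝[<] t) (𝓝 (Y t ω))) :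
    Measurable[𝓕.predictable] fun p : Time T × Ω ↦ Y p.1 p.2 := by
  classical
  let Z : ℕ → Time T × Ω → B := fun n p ↦ if p.1 = ⊥ then X ⊥ p.2 else X (gridBelow n p.1) p.2
  refine @measurable_of_tendsto_metrizable _ _ 𝓕.predictable _ _ _ _ Z _ (fun n ↦ ?_) ?_
  · intro s hs
    have : Z n ⁻¹' s = {⊥} ×ˢ (X ⊥ ⁻¹' s) ∪
        ⋃ i ∈ (gridBelow n : Time T → Time T) '' Ioi ⊥,
          (Ioi ⊥ ∩ gridBelow n ⁻¹' {i}) ×ˢ (X i ⁻¹' s) := by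
      ext ⟨t, ω⟩
      by_cases h : t = ⊥
      · simp [Z, h]
      · simp only [Z, h, if_false, mem_preimage, mem_union, mem_prod, mem_singleton_iff, false_and,
          false_or, mem_iUnion, exists_prop, mem_inter_iff, mem_Ioi, bot_lt_iff_ne_bot, ne_eq,
          not_false_eq_true, true_and]
        exact ⟨fun h' ↦ ⟨_, ⟨t, bot_lt_iff_ne_bot.2 h, rfl⟩, rfl, h'⟩,
          fun ⟨i, _, hi, h'⟩ ↦ by rwa [hi]⟩
    rw [this]
    refine (measurableSet_predictable_singleton_bot_prod (hX ⊥ hs)).union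
      (MeasurableSet.biUnion (finite_image_gridBelow n).countable fun i _ ↦ ?_)
    -- Times whose lower grid point is `i` lie strictly after `i`, so events of `𝓕 i` are admissible
    -- there.
    refine measurableSet_predictable_prod (t := i)
      (measurableSet_Ioi.inter (measurable_gridBelow n (measurableSet_singleton i))) ?_ (hX i hs)
    rintro t ⟨ht, rfl⟩
    exact (coe_gridBelow n ht).2
  · rw [tendsto_pi_nhds]
    rintro ⟨t, ω⟩
    by_cases h : t = ⊥
    · simpa [Z, h, h0] using tendsto_const_nhds
    · simp only [Z, h, if_false]
      exact (hY ω t (bot_lt_iff_ne_bot.2 h)).comp (tendsto_gridBelow (bot_lt_iff_ne_bot.2 h))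

/-! ### Complete filtrations -/

/-- The preimages under `f` and `g` differ inside a null set, all of whose subsets belong to `𝓕 ⊥`.
This is what allows processes to be repaired on null sets without losing adaptedness. -/
lemma UsualConditions.measurable_congr {𝓕 : Filtration (Time T) m} {P : Measure Ω}
    (h : UsualConditions 𝓕 P) {B : Type*} [MeasurableSpace B] {f g : Ω → B} {t : Time T}
    (hf : Measurable[𝓕 t] f) (hfg : f =ᵐ[P] g) : Measurable[𝓕 t] g := by
  have hnull : ∀ s : Set Ω, P s = 0 → MeasurableSet[𝓕 t] s :=
    fun s hs ↦ 𝓕.mono bot_le _ (h.null s hs)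
  intro s hs
  have : g ⁻¹' s = (f ⁻¹' s \ {ω | f ω ≠ g ω}) ∪ (g ⁻¹' s ∩ {ω | f ω ≠ g ω}) := by
    ext ω
    by_cases hω : f ω = g ω <;> simp [hω]
  rw [this]
  refine ((hf hs).diff (hnull _ ?_)).union (hnull _ (measure_mono_null inter_subset_right ?_)) <;>
  exact ae_iff.1 hfg

lemma UsualConditions.stronglyMeasurable_congr {𝓕 : Filtration (Time T) m} {P : Measure Ω}
    (h : UsualConditions 𝓕 P) {f g : Ω → ℝ} {t : Time T}
    (hf : StronglyMeasurable[𝓕 t] f) (hfg : f =ᵐ[P] g) : StronglyMeasurable[𝓕 t] g :=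
  (h.measurable_congr hf.measurable hfg).stronglyMeasurable

lemma martingale_congr {𝓕 : Filtration (Time T) m} {P : Measure Ω}
    (h : UsualConditions 𝓕 P) {X Y : Time T → Ω → ℝ} (hX : Martingale X 𝓕 P)
    (hXY : ∀ t, X t =ᵐ[P] Y t) : Martingale Y 𝓕 P :=
  ⟨fun t ↦ h.stronglyMeasurable_congr (hX.1 t) (hXY t), fun s t hst ↦
    (condExp_congr_ae (hXY t).symm).trans ((hX.2 s t hst).trans (hXY s))⟩

/-- Processes with almost surely good paths coincide with processes all of whose paths are
good. -/
lemma exists_modification {𝓕 : Filtration (Time T) m} {P : Measure Ω}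
    (h : UsualConditions 𝓕 P) {X : Time T → Ω → ℝ} (hX : StronglyAdapted 𝓕 X)
    {p : (Time T → ℝ) → Prop} (h0 : p fun _ ↦ 0) (hp : ∀ᵐ ω ∂P, p fun t ↦ X t ω) :
    ∃ Y : Time T → Ω → ℝ, StronglyAdapted 𝓕 Y ∧ (∀ ω, p fun t ↦ Y t ω) ∧
      ∀ᵐ ω ∂P, ∀ t, X t ω = Y t ω := by
  classical
  let Y : Time T → Ω → ℝ := fun t ω ↦ if p fun t ↦ X t ω then X t ω else 0
  have hXY : ∀ᵐ ω ∂P, ∀ t, X t ω = Y t ω := by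
    filter_upwards [hp] with ω hω t
    simp [Y, hω]
  refine ⟨Y, fun t ↦ h.stronglyMeasurable_congr (hX t) ?_, fun ω ↦ ?_, hXY⟩
  · filter_upwards [hXY] with ω hω using hω t
  · by_cases hω : p fun t ↦ X t ω
    · simp [Y, hω]
    · simpa [Y, hω] using h0

/-! ### Convergence of conditional expectations of a fixed variable -/

/-- Conditional expectations of one integrable variable are uniformly integrable, so almost sure
convergence becomes convergence in `L¹`. No monotonicity of the σ-algebras `M n` is required. -/
lemma tendsto_of_condExp {P : Measure Ω} [IsFiniteMeasure P] {Z : Ω → ℝ} (hZ : Integrable Z P)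
    {M : ℕ → MeasurableSpace Ω} (hM : ∀ n, M n ≤ m) {Y : ℕ → Ω → ℝ} {y : Ω → ℝ}
    (hY : ∀ n, Y n =ᵐ[P] P[Z | M n]) (hy : ∀ᵐ ω ∂P, Tendsto (fun n ↦ Y n ω) atTop (𝓝 (y ω))) :
    Integrable y P ∧ ∀ s, Tendsto (fun n ↦ ∫ ω in s, Y n ω ∂P) atTop (𝓝 (∫ ω in s, y ω ∂P)) := by
  have hui : UniformIntegrable Y 1 P := (hZ.uniformIntegrable_condExp hM).ae_eq fun n ↦ (hY n).symm
  have hint : Integrable y P := memLp_one_iff_integrable.1 (hui.memLp_of_ae_tendsto hy)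
  refine ⟨hint, tendsto_setIntegral_of_L1' _ hint.1
    (Eventually.of_forall fun n ↦ integrable_condExp.congr (hY n).symm) ?_⟩
  exact tendsto_Lp_finite_of_tendsto_ae le_rfl ENNReal.one_ne_top hui.1
    (memLp_one_iff_integrable.2 hint) hui.2.1 hy

/-! ### Optional sampling -/

section OptionalSampling

variable {𝓕 : Filtration (Time T) m} {r : Ω → Time T}

lemma measurable_stoppingTime (hr : IsStoppingTime 𝓕 fun ω ↦ (r ω : WithTop (Time T)))
    {t : Time T} (hle : ∀ ω, r ω ≤ t) : Measurable[𝓕 t] r := by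
  have h := (hr.measurable_of_le (i := t) fun ω ↦ WithTop.coe_le_coe.2 (hle ω)).untopA
  simpa using h

lemma measurableSet_preimage_stoppingTime
    (hr : IsStoppingTime 𝓕 fun ω ↦ (r ω : WithTop (Time T)))
    {t : Time T} {B : Set (Time T)} (hB : MeasurableSet B) (hBt : B ⊆ Iic t) :
    MeasurableSet[𝓕 t] (r ⁻¹' B) := by
  have h := measurable_stoppingTime (r := fun ω ↦ min (r ω) t) (t := t)
    (by simpa using hr.min_const t) fun ω ↦ min_le_right _ _
  have : r ⁻¹' B = {ω | (r ω : WithTop (Time T)) ≤ t} ∩ (fun ω ↦ min (r ω) t) ⁻¹' B := by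
    ext ω
    simp only [mem_preimage, mem_inter_iff, mem_ofPred_eq, WithTop.coe_le_coe]
    refine ⟨fun hω ↦ ⟨hBt hω, ?_⟩, fun ⟨h1, h2⟩ ↦ ?_⟩
    · rwa [min_eq_left (hBt hω)]
    · rwa [min_eq_left h1] at h2
  rw [this]
  exact (hr.measurableSet_le t).inter (h hB)

/-- Rounding up never anticipates: a grid point that is at most `u` forces `r` to be at most `u`. -/
lemma isStoppingTime_gridAbove (hr : IsStoppingTime 𝓕 fun ω ↦ (r ω : WithTop (Time T)))
    (n : ℕ) (t : Time T) :
    IsStoppingTime 𝓕 fun ω ↦ ((min (gridAbove n (r ω)) t : Time T) : WithTop (Time T)) := by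
  have : IsStoppingTime 𝓕 fun ω ↦ ((gridAbove n (r ω) : Time T) : WithTop (Time T)) := by
    intro u
    refine measurableSet_preimage_stoppingTime (B := {s | gridAbove n s ≤ u}) hr ?_ ?_ |>.congr ?_
    · exact (monotone_gridAbove n).measurable measurableSet_Iic
    · exact fun s hs ↦ (le_gridAbove n s).trans hs
    · ext ω; simp
  simpa using this.min_const t

lemma tendsto_gridAbove_min {t s : Time T} (h : s ≤ t) :
    Tendsto (fun n ↦ min (gridAbove n s) t) atTop (𝓝[≥] s) := by
  refine tendsto_nhdsWithin_iff.2 ⟨?_, Eventually.of_forall fun n ↦ le_min (le_gridAbove n s) h⟩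
  have h' := ((tendsto_gridAbove s).mono_right nhdsWithin_le_nhds).min
    (tendsto_const_nhds (x := t))
  rwa [min_eq_left h] at h'

lemma finite_range_gridAbove_min (n : ℕ) (t : Time T) :
    (range fun ω ↦ min (gridAbove n (r ω)) t).Finite := by
  refine ((finite_range_gridAbove n).image (fun s : Time T ↦ min s t)).subset ?_
  rintro _ ⟨s, rfl⟩
  exact ⟨_, ⟨_, rfl⟩, rfl⟩

lemma measurable_stopped {P : Measure Ω} (h𝓕 : UsualConditions 𝓕 P)
    {X : Time T → Ω → ℝ} (hX : StronglyAdapted 𝓕 X)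
    (hc : ∀ᵐ ω ∂P, ∀ t, ContinuousWithinAt (fun t ↦ X t ω) (Ici t) t)
    (hr : IsStoppingTime 𝓕 fun ω ↦ (r ω : WithTop (Time T))) :
    ∃ Y : Ω → ℝ, Measurable[hr.measurableSpace] Y ∧ (fun ω ↦ X (r ω) ω) =ᵐ[P] Y := by
  obtain ⟨Y, hY, hYc, hXY⟩ := exists_modification h𝓕 hX
    (p := fun f ↦ ∀ t, ContinuousWithinAt f (Ici t) t) (fun t ↦ continuousWithinAt_const) hc
  refine ⟨_, measurable_stoppedValue (isStronglyProgressive_of_rightContinuous hY hYc) hr, ?_⟩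
  filter_upwards [hXY] with ω hω
  simp [stoppedValue, hω]

lemma measurable_stopped_of_le {P : Measure Ω} (h𝓕 : UsualConditions 𝓕 P)
    {X : Time T → Ω → ℝ} (hX : StronglyAdapted 𝓕 X)
    (hc : ∀ᵐ ω ∂P, ∀ t, ContinuousWithinAt (fun t ↦ X t ω) (Ici t) t)
    (hr : IsStoppingTime 𝓕 fun ω ↦ (r ω : WithTop (Time T))) {t : Time T} (hle : ∀ ω, r ω ≤ t) :
    StronglyMeasurable[𝓕 t] fun ω ↦ X (r ω) ω := by
  obtain ⟨Y, hY, hXY⟩ := measurable_stopped h𝓕 hX hc hr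
  refine h𝓕.stronglyMeasurable_congr (Measurable.stronglyMeasurable (hY.mono ?_ le_rfl)) hXY.symm
  exact hr.measurableSpace_le_of_le_const fun ω ↦ WithTop.coe_le_coe.2 (hle ω)

/-- Rounding `r` up to the grid gives stopping times with finitely many values, for which sampling
is elementary. Right-continuity and uniform integrability carry the identity to `r`. -/
theorem martingale_stopped_ae_eq_condExp {P : Measure Ω} [IsFiniteMeasure P]
    (h𝓕 : UsualConditions 𝓕 P) {X : Time T → Ω → ℝ} (hX : Martingale X 𝓕 P)
    (hc : ∀ᵐ ω ∂P, ∀ t, ContinuousWithinAt (fun t ↦ X t ω) (Ici t) t)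
    (hr : IsStoppingTime 𝓕 fun ω ↦ (r ω : WithTop (Time T))) {t : Time T} (hle : ∀ ω, r ω ≤ t) :
    (fun ω ↦ X (r ω) ω) =ᵐ[P] P[X t | hr.measurableSpace] := by
  let q : ℕ → Ω → Time T := fun n ω ↦ min (gridAbove n (r ω)) t
  have hq : ∀ n, IsStoppingTime 𝓕 fun ω ↦ (q n ω : WithTop (Time T)) :=
    fun n ↦ isStoppingTime_gridAbove hr n t
  have hqt : ∀ n ω, (q n ω : WithTop (Time T)) ≤ t := fun n ω ↦
    WithTop.coe_le_coe.2 (min_le_right _ _)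
  have hrq : ∀ n, (fun ω ↦ (r ω : WithTop (Time T))) ≤ fun ω ↦ (q n ω : WithTop (Time T)) :=
    fun n ω ↦ WithTop.coe_le_coe.2 (le_min (le_gridAbove n _) (hle ω))
  have hY : ∀ n, (fun ω ↦ X (q n ω) ω) =ᵐ[P] P[X t | (hq n).measurableSpace] := by
    intro n
    have := hX.stoppedValue_ae_eq_condExp_of_le_const_of_countable_range (hq n) (hqt n) ?_
    · refine EventuallyEq.trans (Eventually.of_forall fun ω ↦ ?_) this
      simp [stoppedValue]
    · refine (((finite_range_gridAbove_min (r := r) n t).image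
        ((↑) : Time T → WithTop (Time T))).subset ?_).countable
      rintro _ ⟨ω, rfl⟩
      exact ⟨_, ⟨ω, rfl⟩, rfl⟩
  obtain ⟨hint, hlim⟩ := tendsto_of_condExp (hX.integrable t) (fun n ↦ (hq n).measurableSpace_le)
    hY (y := fun ω ↦ X (r ω) ω) (by
      filter_upwards [hc] with ω hω
      exact (hω (r ω)).tendsto.comp (tendsto_gridAbove_min (hle ω)))
  obtain ⟨Y, hYm, hXY⟩ := measurable_stopped h𝓕 hX.1 hc hr
  refine ae_eq_condExp_of_forall_setIntegral_eq hr.measurableSpace_le (hX.integrable t)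
    (fun s _ _ ↦ hint.integrableOn) (fun s hs _ ↦ ?_) ⟨Y, hYm.stronglyMeasurable, hXY⟩
  -- Since `r ≤ q n`, the set `s` also belongs to the σ-algebra of `q n`, so the integrals do not
  -- depend on `n`.
  refine tendsto_nhds_unique (hlim s) (tendsto_const_nhds.congr fun n ↦ ?_)
  rw [← setIntegral_condExp (hq n).measurableSpace_le (hX.integrable t)
    (IsStoppingTime.measurableSpace_mono hr (hq n) (hrq n) s hs)]
  exact setIntegral_congr_ae ((hr.measurableSpace_le) s hs)
    ((hY n).mono fun ω hω _ ↦ hω.symm)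

end OptionalSampling

/-! ### Stopped processes -/

/-- The time `t ∧ τ`. -/
def stopAt (τ : Ω → WithTop (Time T)) (t : Time T) (ω : Ω) : Time T :=
  (min (t : WithTop (Time T)) (τ ω)).untopA

lemma coe_stopAt (τ : Ω → WithTop (Time T)) (t : Time T) (ω : Ω) :
    (stopAt τ t ω : WithTop (Time T)) = min (t : WithTop (Time T)) (τ ω) := by
  obtain ⟨u, hu⟩ := WithTop.ne_top_iff_exists.1
    (ne_of_lt ((min_le_left (t : WithTop (Time T)) (τ ω)).trans_lt (WithTop.coe_lt_top t)))
  simp [stopAt, ← hu]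

lemma stopAt_le (τ : Ω → WithTop (Time T)) (t : Time T) (ω : Ω) : stopAt τ t ω ≤ t := by
  rw [← WithTop.coe_le_coe, coe_stopAt]
  exact min_le_left _ _

lemma coe_stopAt_le (τ : Ω → WithTop (Time T)) (t : Time T) (ω : Ω) :
    (stopAt τ t ω : WithTop (Time T)) ≤ τ ω := by
  rw [coe_stopAt]
  exact min_le_right _ _

lemma stopAt_of_le {τ : Ω → WithTop (Time T)} {t : Time T} {ω : Ω}
    (h : (t : WithTop (Time T)) ≤ τ ω) : stopAt τ t ω = t := by
  rw [← WithTop.coe_inj, coe_stopAt, min_eq_left h]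

lemma stopAt_of_ge {τ : Ω → WithTop (Time T)} {t u : Time T} {ω : Ω}
    (h : τ ω = u) (hu : u ≤ t) : stopAt τ t ω = u := by
  rw [← WithTop.coe_inj, coe_stopAt, h, min_eq_right (WithTop.coe_le_coe.2 hu)]

lemma stopAt_eq_of_le {τ : Ω → WithTop (Time T)} {s t : Time T} {ω : Ω} (hst : s ≤ t)
    (h : τ ω ≤ s) : stopAt τ t ω = stopAt τ s ω := by
  rw [← WithTop.coe_inj, coe_stopAt, coe_stopAt, min_eq_right h,
    min_eq_right (h.trans (WithTop.coe_le_coe.2 hst))]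

lemma monotone_stopAt (τ : Ω → WithTop (Time T)) (ω : Ω) : Monotone fun t ↦ stopAt τ t ω := by
  intro s t hst
  change stopAt τ s ω ≤ stopAt τ t ω
  rw [← WithTop.coe_le_coe, coe_stopAt, coe_stopAt]
  exact min_le_min (WithTop.coe_le_coe.2 hst) le_rfl

lemma le_stopAt {τ : Ω → WithTop (Time T)} {s t : Time T} {ω : Ω} (hst : s ≤ t)
    (h : (s : WithTop (Time T)) ≤ τ ω) : s ≤ stopAt τ t ω := by
  rw [← WithTop.coe_le_coe, coe_stopAt]
  exact le_min (WithTop.coe_le_coe.2 hst) h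

lemma continuous_stopAt (τ : Ω → WithTop (Time T)) (ω : Ω) :
    Continuous fun t ↦ stopAt τ t ω := by
  induction h : τ ω using WithTop.recTopCoe with
  | top =>
    have : (fun t ↦ stopAt τ t ω) = id := by
      ext1 t
      exact stopAt_of_le (by simp [h])
    rw [this]
    exact continuous_id
  | coe u =>
    have : (fun t ↦ stopAt τ t ω) = fun t ↦ min t u := by
      ext1 t
      rw [← WithTop.coe_inj, coe_stopAt, h, WithTop.coe_min]
    rw [this]
    exact continuous_id.min continuous_const

lemma rightContinuous_stopped {B : Type*} [TopologicalSpace B] {f : Time T → B}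
    (hf : ∀ t, ContinuousWithinAt f (Ici t) t) (τ : Ω → WithTop (Time T)) (ω : Ω) (t : Time T) :
    ContinuousWithinAt (fun t ↦ f (stopAt τ t ω)) (Ici t) t :=
  (hf _).comp (continuous_stopAt τ ω).continuousWithinAt fun _ hs ↦ monotone_stopAt τ ω hs

lemma isStoppingTime_stopAt {𝓕 : Filtration (Time T) m} {τ : Ω → WithTop (Time T)}
    (hτ : IsStoppingTime 𝓕 τ) (t : Time T) :
    IsStoppingTime 𝓕 fun ω ↦ (stopAt τ t ω : WithTop (Time T)) := by
  simp_rw [coe_stopAt, min_comm (t : WithTop (Time T))]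
  exact hτ.min_const t

section

variable {𝓕 : Filtration (Time T) m} {P : Measure Ω} {τ : Ω → WithTop (Time T)}

lemma measurableSet_lt_stoppingTime (hτ : IsStoppingTime 𝓕 τ) (s : Time T) :
    MeasurableSet[𝓕 s] {ω | (s : WithTop (Time T)) < τ ω} := by
  convert! (hτ s).compl using 1
  ext; simp

lemma measurableSet_bot_lt (hτ : IsStoppingTime 𝓕 τ) :
    MeasurableSet[𝓕 ⊥] {ω | ⊥ < τ ω} := measurableSet_lt_stoppingTime hτ ⊥

/-- On this event `t ∧ τ ≥ s`, so nothing has to be decided before time `s`. -/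
lemma measurableSet_inter_lt_stopAt (hτ : IsStoppingTime 𝓕 τ) {s t : Time T} (hst : s ≤ t)
    {B : Set Ω} (hB : MeasurableSet[𝓕 s] B) :
    MeasurableSet[(isStoppingTime_stopAt hτ t).measurableSpace]
      (B ∩ {ω | (s : WithTop (Time T)) < τ ω}) := by
  have h := hB.inter (measurableSet_lt_stoppingTime hτ s)
  refine ⟨le_iSup 𝓕.seq s _ h, fun i ↦ ?_⟩
  by_cases hi : s ≤ i
  · exact (𝓕.mono hi _ h).inter (isStoppingTime_stopAt hτ t i)
  · convert! MeasurableSet.empty using 1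
    ext ω
    simp only [mem_inter_iff, mem_ofPred_eq, mem_empty_iff_false, iff_false, not_and,
      WithTop.coe_le_coe]
    exact fun h1 h2 ↦ hi ((le_stopAt hst h1.2.le).trans h2)

/-- The event lies both in `𝓕 s` and in the σ-algebra of `t ∧ τ`, so `X s` and the stopped variable
both integrate over it like `X t`. -/
lemma setIntegral_stopAt [IsFiniteMeasure P] (h𝓕 : UsualConditions 𝓕 P) {X : Time T → Ω → ℝ}
    (hX : Martingale X 𝓕 P)
    (hc : ∀ᵐ ω ∂P, ∀ t, ContinuousWithinAt (fun t ↦ X t ω) (Ici t) t)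
    (hτ : IsStoppingTime 𝓕 τ) {s t : Time T} (hst : s ≤ t) {B : Set Ω}
    (hB : MeasurableSet[𝓕 s] B) :
    ∫ ω in B ∩ {ω | (s : WithTop (Time T)) < τ ω}, X (stopAt τ t ω) ω ∂P
      = ∫ ω in B ∩ {ω | (s : WithTop (Time T)) < τ ω}, X s ω ∂P := by
  have h := martingale_stopped_ae_eq_condExp h𝓕 hX hc (isStoppingTime_stopAt hτ t)
    fun ω ↦ stopAt_le τ t ω
  have hm := measurableSet_inter_lt_stopAt hτ hst hB
  rw [hX.setIntegral_eq hst (hB.inter (measurableSet_lt_stoppingTime hτ s)),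
    ← setIntegral_condExp (isStoppingTime_stopAt hτ t).measurableSpace_le (hX.integrable t) hm]
  exact setIntegral_congr_ae ((isStoppingTime_stopAt hτ t).measurableSpace_le _ hm)
    (h.mono fun ω hω _ ↦ hω)

lemma integrable_stopAt [IsFiniteMeasure P] (h𝓕 : UsualConditions 𝓕 P) {X : Time T → Ω → ℝ}
    (hX : Martingale X 𝓕 P)
    (hc : ∀ᵐ ω ∂P, ∀ t, ContinuousWithinAt (fun t ↦ X t ω) (Ici t) t)
    (hτ : IsStoppingTime 𝓕 τ) (t : Time T) : Integrable (fun ω ↦ X (stopAt τ t ω) ω) P :=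
  integrable_condExp.congr (martingale_stopped_ae_eq_condExp h𝓕 hX hc (isStoppingTime_stopAt hτ t)
    fun ω ↦ stopAt_le τ t ω).symm

lemma martingale_of_setIntegral [IsFiniteMeasure P] {X : Time T → Ω → ℝ}
    (hX : StronglyAdapted 𝓕 X) (hi : ∀ t, Integrable (X t) P)
    (h : ∀ s t, s < t → ∀ B, MeasurableSet[𝓕 s] B → ∫ ω in B, (X t ω - X s ω) ∂P = 0) :
    Martingale X 𝓕 P := by
  refine ⟨hX, fun s t hst ↦ ?_⟩
  rcases hst.eq_or_lt with rfl | hst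
  · exact (condExp_of_stronglyMeasurable (𝓕.le _) (hX _) (hi _)).eventuallyEq
  refine (ae_eq_condExp_of_forall_setIntegral_eq (𝓕.le s) (hi t)
    (fun _ _ _ ↦ (hi s).integrableOn) (fun B hB _ ↦ ?_) (hX s).aestronglyMeasurable).symm
  have := h s t hst B hB
  rw [integral_sub (hi t).integrableOn (hi s).integrableOn] at this
  linarith

/-- The process `1_{τ > 0} X_{t ∧ τ}`. -/
def stopped (τ : Ω → WithTop (Time T)) (X : Time T → Ω → ℝ) (t : Time T) (ω : Ω) : ℝ :=
  {ω | ⊥ < τ ω}.indicator (fun ω ↦ X (stopAt τ t ω) ω) ω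

lemma stoppedProcess_indicator (τ : Ω → WithTop (Time T)) (X : Time T → Ω → ℝ) :
    stoppedProcess (fun i ↦ {ω | ⊥ < τ ω}.indicator (X i)) τ = stopped τ X := by
  ext t ω
  rfl

lemma stopped_of_lt {X : Time T → Ω → ℝ} {t s : Time T} {ω : Ω}
    (h : (s : WithTop (Time T)) < τ ω) : stopped τ X t ω = X (stopAt τ t ω) ω :=
  indicator_of_mem (s := {ω | ⊥ < τ ω}) (bot_le.trans_lt h) _

lemma stopped_sub_of_le {X : Time T → Ω → ℝ} {s t : Time T} {ω : Ω} (hst : s ≤ t)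
    (h : τ ω ≤ s) : stopped τ X t ω = stopped τ X s ω := by
  simp only [stopped, indicator, stopAt_eq_of_le hst h]

lemma rightContinuous_stopped' {X : Time T → Ω → ℝ} {ω : Ω}
    (hc : ∀ t, ContinuousWithinAt (fun t ↦ X t ω) (Ici t) t) (t : Time T) :
    ContinuousWithinAt (fun t ↦ stopped τ X t ω) (Ici t) t := by
  by_cases h : ω ∈ {ω | ⊥ < τ ω}
  · simp only [stopped, indicator_of_mem h]
    exact rightContinuous_stopped hc τ ω t
  · simp only [stopped, indicator_of_notMem h]
    exact continuousWithinAt_const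

/-- On `{τ ≤ s}` the stopped process no longer moves after `s`; on `{s < τ}` the increment is
handled by `setIntegral_stopAt`. -/
theorem martingale_stopped [IsFiniteMeasure P] (h𝓕 : UsualConditions 𝓕 P) {X : Time T → Ω → ℝ}
    (hX : Martingale X 𝓕 P)
    (hc : ∀ᵐ ω ∂P, ∀ t, ContinuousWithinAt (fun t ↦ X t ω) (Ici t) t)
    (hτ : IsStoppingTime 𝓕 τ) : Martingale (stopped τ X) 𝓕 P := by
  have hint : ∀ t, Integrable (stopped τ X t) P := fun t ↦
    (integrable_stopAt h𝓕 hX hc hτ t).indicator (𝓕.le _ _ (measurableSet_bot_lt hτ))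
  refine martingale_of_setIntegral (fun t ↦ ?_) hint fun s t hst B hB ↦ ?_
  · exact (measurable_stopped_of_le h𝓕 hX.1 hc (isStoppingTime_stopAt hτ t)
      fun ω ↦ stopAt_le τ t ω).indicator (𝓕.mono bot_le _ (measurableSet_bot_lt hτ))
  · have hB' := 𝓕.le _ _ hB
    have hS := hB'.inter (𝓕.le _ _ (measurableSet_lt_stoppingTime hτ s))
    rw [setIntegral_eq_of_subset_of_forall_sdiff_eq_zero hB' inter_subset_left (s := B ∩ {ω | s < τ ω})
      (fun ω hω ↦ ?_), integral_sub (hint t).integrableOn (hint s).integrableOn, sub_eq_zero]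
    · have h1 := setIntegral_stopAt h𝓕 hX hc hτ hst.le hB
      rw [setIntegral_congr_fun hS (g := fun ω ↦ X (stopAt τ t ω) ω)
        fun ω hω ↦ stopped_of_lt hω.2, h1]
      refine setIntegral_congr_fun hS fun ω hω ↦ ?_
      rw [stopped_of_lt hω.2, stopAt_of_le hω.2.le]
    · rw [stopped_sub_of_le hst.le, sub_self]
      simpa [hω.1] using hω.2

end

/-! ### Inner approximation of predictable sets by foretold sets -/

lemma shiftBack_mono (δ : ℝ≥0) : Monotone fun t : Time T ↦ shiftBack t δ := by
  intro s t h
  change shiftBack s δ ≤ shiftBack t δ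
  rw [← Subtype.coe_le_coe, coe_shiftBack, coe_shiftBack]
  exact tsub_le_tsub_right (Subtype.coe_le_coe.2 h) _

/-- Sets whose paths are finite unions of closed intervals with left end points in a fixed finite
set, and whose value at time `t` is known `δ` before `t`. -/
def IsForetold (𝓕 : Filtration (Time T) m) (E : Set (Time T × Ω)) : Prop :=
  ∃ δ : ℝ≥0, 0 < δ ∧ (∀ t, MeasurableSet[𝓕 (shiftBack t δ)] {ω | (t, ω) ∈ E}) ∧
    (∀ ω, IsClosed {t | (t, ω) ∈ E}) ∧ ∃ F : Finset (Time T),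
      ∀ t ω, (t, ω) ∈ E → ∃ f ∈ F, f ≤ t ∧ ∀ u, f ≤ u → u ≤ t → (u, ω) ∈ E

section

variable {𝓕 : Filtration (Time T) m}

lemma IsForetold.empty : IsForetold 𝓕 (∅ : Set (Time T × Ω)) :=
  ⟨1, one_pos, by simp, by simp, ∅, by simp⟩

lemma IsForetold.union {E F : Set (Time T × Ω)} (hE : IsForetold 𝓕 E) (hF : IsForetold 𝓕 F) :
    IsForetold 𝓕 (E ∪ F) := by
  classical
  obtain ⟨δ, hδ, hm, hc, S, hS⟩ := hE
  obtain ⟨δ', hδ', hm', hc', S', hS'⟩ := hF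
  refine ⟨min δ δ', lt_min hδ hδ', fun t ↦ ?_, fun ω ↦ (hc ω).union (hc' ω), S ∪ S', ?_⟩
  · exact (𝓕.mono (shiftBack_anti t (min_le_left _ _)) _ (hm t)).union
      (𝓕.mono (shiftBack_anti t (min_le_right _ _)) _ (hm' t))
  · rintro t ω (h | h)
    · obtain ⟨f, hf, hft, h⟩ := hS t ω h
      exact ⟨f, Finset.mem_union_left _ hf, hft, fun u h1 h2 ↦ Or.inl (h u h1 h2)⟩
    · obtain ⟨f, hf, hft, h⟩ := hS' t ω h
      exact ⟨f, Finset.mem_union_right _ hf, hft, fun u h1 h2 ↦ Or.inr (h u h1 h2)⟩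

lemma IsForetold.inter {E F : Set (Time T × Ω)} (hE : IsForetold 𝓕 E) (hF : IsForetold 𝓕 F) :
    IsForetold 𝓕 (E ∩ F) := by
  classical
  obtain ⟨δ, hδ, hm, hc, S, hS⟩ := hE
  obtain ⟨δ', hδ', hm', hc', S', hS'⟩ := hF
  refine ⟨min δ δ', lt_min hδ hδ', fun t ↦ ?_, fun ω ↦ (hc ω).inter (hc' ω), S ∪ S', ?_⟩
  · exact (𝓕.mono (shiftBack_anti t (min_le_left _ _)) _ (hm t)).inter
      (𝓕.mono (shiftBack_anti t (min_le_right _ _)) _ (hm' t))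
  · rintro t ω ⟨h, h'⟩
    obtain ⟨f, hf, hft, h⟩ := hS t ω h
    obtain ⟨f', hf', hft', h'⟩ := hS' t ω h'
    -- The intersection of two intervals starts at the larger of their left end points, so no new
    -- end point is created.
    refine ⟨max f f', ?_, max_le hft hft', fun u h1 h2 ↦
      ⟨h u ((le_max_left _ _).trans h1) h2, h' u ((le_max_right _ _).trans h1) h2⟩⟩
    rcases max_choice f f' with h | h <;> simp [h, hf, hf']

lemma isForetold_bot_prod {A : Set Ω} (hA : MeasurableSet[𝓕 ⊥] A) :
    IsForetold 𝓕 ({⊥} ×ˢ A) := by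
  refine ⟨1, one_pos, fun t ↦ ?_, fun ω ↦ ?_, {⊥}, ?_⟩
  · by_cases ht : t = ⊥
    · simpa [ht] using 𝓕.mono bot_le _ hA
    · simp [ht]
  · by_cases h : ω ∈ A <;> simp [h]
  · rintro t ω ⟨h, h'⟩
    simp only [mem_singleton_iff] at h
    subst h
    exact ⟨⊥, by simp, le_rfl, fun u _ hu ↦ ⟨le_bot_iff.1 hu, h'⟩⟩

/-- The gap `s - i` between the moment when `A` is known and the start of the interval provides the
advance notice `δ`. -/
lemma isForetold_Icc_prod {i s t : Time T} (his : i < s) {A : Set Ω} (hA : MeasurableSet[𝓕 i] A) :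
    IsForetold 𝓕 (Icc s t ×ˢ A) := by
  have his' : (i : ℝ≥0) < s := his
  refine ⟨s - i, tsub_pos_of_lt his', fun u ↦ ?_, fun ω ↦ ?_, {s}, ?_⟩
  · by_cases hu : u ∈ Icc s t
    · simp only [mem_prod, hu, true_and]
      refine 𝓕.mono ?_ _ hA
      rw [← Subtype.coe_le_coe, coe_shiftBack]
      have : (s : ℝ≥0) ≤ u := hu.1
      refine le_tsub_of_add_le_left ?_
      rwa [tsub_add_cancel_of_le his'.le]
    · simp only [mem_prod, hu, false_and]
      exact @MeasurableSet.empty _ (_)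
  · by_cases h : ω ∈ A
    · simp only [mem_prod, h, and_true]
      exact isClosed_Icc
    · simp [h]
  · rintro u ω ⟨h, h'⟩
    exact ⟨s, by simp, h.1, fun v hv hvu ↦ ⟨⟨hv, hvu.trans h.2⟩, h'⟩⟩

/-- The debut of a foretold set. -/
lemma IsForetold.exists_debut {E : Set (Time T × Ω)} (hE : IsForetold 𝓕 E) :
    ∃ δ : ℝ≥0, 0 < δ ∧ ∃ d : Ω → WithTop (Time T), (range d).Finite ∧
      (∀ f : Time T, MeasurableSet[𝓕 (shiftBack f δ)] {ω | d ω = f}) ∧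
      (∀ ω, ∀ f : Time T, d ω = f → (f, ω) ∈ E) ∧
      ∀ ω t, (t, ω) ∈ E → d ω ≤ t := by
  classical
  obtain ⟨δ, hδ, hm, hc, F, hF⟩ := hE
  -- A nonempty section has its least point in `F`, because every point of it is joined inside the
  -- section to a left end point in `F`. The event `d = f` only involves the section at times up to
  -- `f`, hence is known `δ` earlier.
  let d : Ω → WithTop (Time T) := fun ω ↦ (F.filter fun f ↦ (f, ω) ∈ E).min
  refine ⟨δ, hδ, d, ?_, fun f ↦ ?_, fun ω f h ↦ ?_, fun ω t h ↦ ?_⟩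
  · refine ((F.powerset.finite_toSet).image Finset.min).subset ?_
    rintro _ ⟨ω, rfl⟩
    exact ⟨_, Finset.mem_coe.2 (Finset.mem_powerset.2 (Finset.filter_subset _ F)), rfl⟩
  · have : {ω | d ω = f} = {ω | f ∈ F ∧ (f, ω) ∈ E} ∩
        ⋂ g ∈ F.filter (· < f), {ω | (g, ω) ∈ E}ᶜ := by
      ext ω
      simp only [mem_ofPred_eq, mem_inter_iff, mem_iInter, Finset.mem_filter, mem_compl_iff]
      constructor
      · intro h
        have h1 := Finset.mem_of_min h
        refine ⟨Finset.mem_filter.1 h1, fun g hg hgE ↦ ?_⟩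
        have := Finset.min_le_of_eq (Finset.mem_filter.2 ⟨hg.1, hgE⟩) h
        exact absurd this (not_le.2 hg.2)
      · rintro ⟨h1, h2⟩
        refine le_antisymm (Finset.min_le (Finset.mem_filter.2 h1)) (Finset.le_min fun g hg ↦ ?_)
        rw [Finset.mem_filter] at hg
        rw [WithTop.coe_le_coe]
        by_contra hlt
        exact h2 g ⟨hg.1, not_le.1 hlt⟩ hg.2
    rw [this]
    refine MeasurableSet.inter ?_ (Finset.measurableSet_biInter _ fun g hg ↦ ?_)
    · by_cases hf : f ∈ F
      · simpa [hf] using hm f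
      · simp [hf]
    · exact (𝓕.mono (shiftBack_mono δ (Finset.mem_filter.1 hg).2.le) _ (hm g)).compl
  · exact (Finset.mem_filter.1 (Finset.mem_of_min h)).2
  · obtain ⟨f, hf, hft, h'⟩ := hF t ω h
    exact (Finset.min_le (Finset.mem_filter.2 ⟨hf, h' f le_rfl hft⟩)).trans
      (WithTop.coe_le_coe.2 hft)

/-- Countable intersections of foretold sets. -/
def IsForetoldInter (𝓕 : Filtration (Time T) m) (K : Set (Time T × Ω)) : Prop :=
  ∃ E : ℕ → Set (Time T × Ω), (∀ n, IsForetold 𝓕 (E n)) ∧ K = ⋂ n, E n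

lemma IsForetold.isForetoldInter {E : Set (Time T × Ω)} (hE : IsForetold 𝓕 E) :
    IsForetoldInter 𝓕 E := ⟨fun _ ↦ E, fun _ ↦ hE, (iInter_const E).symm⟩

/-- By distributivity, `(⋂ E i) ∪ (⋂ F j)` is the intersection over all pairs of `E i ∪ F j`; the
pairs are enumerated by `Nat.unpair`. -/
lemma IsForetoldInter.union {K L : Set (Time T × Ω)} (hK : IsForetoldInter 𝓕 K)
    (hL : IsForetoldInter 𝓕 L) : IsForetoldInter 𝓕 (K ∪ L) := by
  obtain ⟨E, hE, rfl⟩ := hK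
  obtain ⟨F, hF, rfl⟩ := hL
  refine ⟨fun n ↦ E n.unpair.1 ∪ F n.unpair.2, fun n ↦ (hE _).union (hF _), ?_⟩
  ext p
  simp only [mem_union, mem_iInter]
  refine ⟨fun h n ↦ h.imp (fun h ↦ h _) fun h ↦ h _, fun h ↦ ?_⟩
  by_contra! hne
  obtain ⟨⟨i, hi⟩, j, hj⟩ := hne
  have := h (Nat.pair i j)
  simp [hi, hj] at this

lemma IsForetoldInter.iInter {K : ℕ → Set (Time T × Ω)} (hK : ∀ n, IsForetoldInter 𝓕 (K n)) :
    IsForetoldInter 𝓕 (⋂ n, K n) := by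
  choose E hE hKE using hK
  refine ⟨fun n ↦ E n.unpair.1 n.unpair.2, fun n ↦ hE _ _, ?_⟩
  ext p
  simp only [hKE, mem_iInter]
  refine ⟨fun h n ↦ h _ _, fun h i j ↦ ?_⟩
  simpa using h (Nat.pair i j)

/-- Inner approximability by countable intersections of foretold sets. -/
def IsApproximable (𝓕 : Filtration (Time T) m) (ν : @Measure (Time T × Ω) 𝓕.predictable)
    (S : Set (Time T × Ω)) : Prop :=
  ∀ ε : ℝ≥0∞, ε ≠ 0 → ∃ K, IsForetoldInter 𝓕 K ∧ K ⊆ S ∧ ν (S \ K) ≤ ε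

variable {ν : @Measure (Time T × Ω) 𝓕.predictable}

lemma IsForetold.isApproximable {E : Set (Time T × Ω)} (hE : IsForetold 𝓕 E) :
    IsApproximable 𝓕 ν E := fun ε _ ↦ ⟨E, hE.isForetoldInter, subset_rfl, by simp⟩

lemma IsApproximable.iInter {S : ℕ → Set (Time T × Ω)} (hS : ∀ n, IsApproximable 𝓕 ν (S n)) :
    IsApproximable 𝓕 ν (⋂ n, S n) := by
  intro ε hε
  obtain ⟨ε', hε', hsum⟩ := ENNReal.exists_pos_sum_of_countable' hε ℕ
  choose K hK hKS hν using fun n ↦ hS n (ε' n) (hε' n).ne'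
  refine ⟨⋂ n, K n, IsForetoldInter.iInter hK, iInter_mono hKS, ?_⟩
  calc ν ((⋂ n, S n) \ ⋂ n, K n) ≤ ν (⋃ n, S n \ K n) := by
        refine measure_mono fun p ⟨h1, h2⟩ ↦ ?_
        simp only [mem_iInter, not_forall] at h1 h2
        obtain ⟨n, hn⟩ := h2
        exact mem_iUnion.2 ⟨n, h1 n, hn⟩
    _ ≤ ∑' n, ν (S n \ K n) := measure_iUnion_le _
    _ ≤ ∑' n, ε' n := ENNReal.tsum_le_tsum hν
    _ ≤ ε := hsum.le

lemma IsApproximable.union {S S' : Set (Time T × Ω)} (hS : IsApproximable 𝓕 ν S)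
    (hS' : IsApproximable 𝓕 ν S') : IsApproximable 𝓕 ν (S ∪ S') := by
  intro ε hε
  have hε2 : ε / 2 ≠ 0 := (ENNReal.half_pos hε).ne'
  obtain ⟨K, hK, hKS, hν⟩ := hS _ hε2
  obtain ⟨K', hK', hKS', hν'⟩ := hS' _ hε2
  refine ⟨K ∪ K', hK.union hK', union_subset_union hKS hKS', ?_⟩
  calc ν ((S ∪ S') \ (K ∪ K')) ≤ ν ((S \ K) ∪ (S' \ K')) := by
        refine measure_mono ?_
        rintro p ⟨h | h, h'⟩
        · exact Or.inl ⟨h, fun h'' ↦ h' (Or.inl h'')⟩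
        · exact Or.inr ⟨h, fun h'' ↦ h' (Or.inr h'')⟩
    _ ≤ ν (S \ K) + ν (S' \ K') := measure_union_le _ _
    _ ≤ ε / 2 + ε / 2 := add_le_add hν hν'
    _ = ε := ENNReal.add_halves ε

/-- As `ν` is finite, a partial union exhausts the whole union up to `ε / 2`. Approximating this
finite union suffices, which avoids countable unions of the inner sets. -/
lemma IsApproximable.iUnion [IsFiniteMeasure ν] {S : ℕ → Set (Time T × Ω)}
    (hm : ∀ n, MeasurableSet[𝓕.predictable] (S n)) (hS : ∀ n, IsApproximable 𝓕 ν (S n)) :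
    IsApproximable 𝓕 ν (⋃ n, S n) := by
  intro ε hε
  have hε2 : ε / 2 ≠ 0 := (ENNReal.half_pos hε).ne'
  have hacc : ∀ n, IsApproximable 𝓕 ν (accumulate S n) := by
    intro n
    induction n with
    | zero => simpa using hS 0
    | succ n ih => rw [accumulate_succ]; exact ih.union (hS _)
  have hlim : Tendsto (fun n ↦ ν ((⋃ n, S n) \ accumulate S n)) atTop (𝓝 0) := by
    have := tendsto_measure_iInter_atTop (μ := ν) (s := fun n ↦ (⋃ n, S n) \ accumulate S n)
      (fun n ↦ ((MeasurableSet.iUnion hm).diff (by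
        rw [accumulate_def]
        exact MeasurableSet.biUnion (to_countable _) fun i _ ↦ hm i)).nullMeasurableSet)
      (fun i j hij ↦ sdiff_subset_sdiff_right (monotone_accumulate hij))
      ⟨0, measure_ne_top _ _⟩
    rw [← sdiff_iUnion, iUnion_accumulate, sdiff_self] at this
    rw [measure_empty] at this
    exact this
  obtain ⟨n, hn⟩ := (hlim.eventually_lt_const (pos_iff_ne_zero.2 hε2)).exists
  obtain ⟨K, hK, hKS, hν⟩ := hacc n _ hε2
  have hsub : accumulate S n ⊆ ⋃ n, S n := by
    rw [accumulate_def]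
    exact iUnion₂_subset fun i _ ↦ subset_iUnion S i
  refine ⟨K, hK, hKS.trans hsub, ?_⟩
  calc ν ((⋃ n, S n) \ K) ≤ ν (((⋃ n, S n) \ accumulate S n) ∪ (accumulate S n \ K)) := by
        refine measure_mono fun p ⟨h1, h2⟩ ↦ ?_
        by_cases h : p ∈ accumulate S n
        · exact Or.inr ⟨h, h2⟩
        · exact Or.inl ⟨h1, h⟩
    _ ≤ _ := measure_union_le _ _
    _ ≤ ε / 2 + ε / 2 := add_le_add hn.le hν
    _ = ε := ENNReal.add_halves ε

lemma isApproximable_Ioc_prod [IsFiniteMeasure ν] (i j : Time T) {A : Set Ω}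
    (hA : MeasurableSet[𝓕 i] A) : IsApproximable 𝓕 ν (Ioc i j ×ˢ A) := by
  by_cases hij : i < j
  · obtain ⟨u, -, hu, hlim⟩ := exists_seq_strictAnti_tendsto' hij
    have : Ioc i j ×ˢ A = ⋃ n, Icc (u n) j ×ˢ A := by
      rw [← iUnion_prod_const]
      congr 1
      ext t
      simp only [mem_Ioc, mem_iUnion, mem_Icc, exists_and_right]
      refine and_congr_left fun _ ↦ ⟨fun h ↦ ?_, fun ⟨n, hn⟩ ↦ (hu n).1.trans_le hn⟩
      exact (hlim.eventually_lt_const h).exists.imp fun _ h ↦ h.le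
    rw [this]
    refine IsApproximable.iUnion (fun n ↦ ?_) fun n ↦
      (isForetold_Icc_prod (hu n).1 hA).isApproximable
    exact measurableSet_predictable_prod measurableSet_Icc
      (fun t ht ↦ (hu n).1.trans_le ht.1) hA
  · rw [Ioc_eq_empty hij, empty_prod]
    exact IsForetold.empty.isApproximable

lemma isApproximable_Ioi_prod [IsFiniteMeasure ν] (i : Time T) {A : Set Ω}
    (hA : MeasurableSet[𝓕 i] A) : IsApproximable 𝓕 ν (Ioi i ×ˢ A) := by
  have : (Ioi i : Set (Time T)) = Ioc i ⊤ := by ext; simp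
  rw [this]
  exact isApproximable_Ioc_prod i ⊤ hA

/-- The sets which are approximable together with their complements form a σ-algebra containing the
generators. The complement has to be carried along, since approximability alone is not stable under
complementation. -/
theorem isApproximable_of_measurableSet [IsFiniteMeasure ν] {S : Set (Time T × Ω)}
    (hS : MeasurableSet[𝓕.predictable] S) : IsApproximable 𝓕 ν S := by
  suffices IsApproximable 𝓕 ν S ∧ IsApproximable 𝓕 ν Sᶜ from this.1
  have hbot : ∀ A, MeasurableSet[𝓕 ⊥] A → IsApproximable 𝓕 ν ({⊥} ×ˢ A) :=
    fun A hA ↦ (isForetold_bot_prod hA).isApproximable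
  induction S, hS using MeasurableSpace.generateFrom_induction with
  | hC S hS' _ =>
    rcases hS' with ⟨A, hA, rfl⟩ | ⟨i, A, hA, rfl⟩
    · refine ⟨hbot A hA, ?_⟩
      convert! (hbot _ hA.compl).union (isApproximable_Ioi_prod ⊥ MeasurableSet.univ) using 1
      ext ⟨t, ω⟩
      by_cases h : t = ⊥ <;> simp [h, bot_lt_iff_ne_bot]
    · refine ⟨isApproximable_Ioi_prod i hA, ?_⟩
      convert! ((hbot _ MeasurableSet.univ).union
        (isApproximable_Ioc_prod ⊥ i MeasurableSet.univ)).union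
        (isApproximable_Ioi_prod i hA.compl) using 1
      ext ⟨t, ω⟩
      by_cases h : t = ⊥
      · simp [h]
      · by_cases h' : i < t <;> simp [h, h', bot_lt_iff_ne_bot, not_lt.1]
  | empty =>
    refine ⟨IsForetold.empty.isApproximable, ?_⟩
    convert! (hbot _ MeasurableSet.univ).union
      (isApproximable_Ioi_prod ⊥ MeasurableSet.univ) using 1
    ext ⟨t, ω⟩
    by_cases h : t = ⊥ <;> simp [h, bot_lt_iff_ne_bot]
  | compl S _ ih => exact ⟨ih.2, by rw [compl_compl]; exact ih.1⟩
  | iUnion S hS ih =>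
    refine ⟨IsApproximable.iUnion hS fun n ↦ (ih n).1, ?_⟩
    rw [compl_iUnion]
    exact IsApproximable.iInter fun n ↦ (ih n).2

/-! ### Announcing random times with predictable graph. -/

/-- Monotone sequences of times converge. -/
lemma exists_tendsto_of_monotone {e : ℕ → Time T} (he : Monotone e) :
    ∃ t, Tendsto e atTop (𝓝 t) ∧ ∀ n, e n ≤ t := by
  have h1 : Monotone fun n ↦ (e n : ℝ≥0) := fun i j hij ↦ he hij
  have h2 : BddAbove (range fun n ↦ (e n : ℝ≥0)) := ⟨T, by rintro _ ⟨n, rfl⟩; exact (e n).2⟩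
  refine ⟨⟨⨆ n, (e n : ℝ≥0), mem_Iic.2 (ciSup_le fun n ↦ (e n).2)⟩, ?_, fun n ↦ ?_⟩
  · rw [tendsto_subtype_rng]
    exact tendsto_atTop_ciSup h1 h2
  · exact Subtype.coe_le_coe.1 (le_ciSup h2 n)

/-- Random times with predictable graph are announced by stopping times, up to an event of
small probability. -/
theorem exists_announcing {P : Measure Ω} [IsFiniteMeasure P] {Ω₀ : Set Ω}
    {r : Ω → Time T} (hr : Measurable r)
    (hG : MeasurableSet[𝓕.predictable] {p : Time T × Ω | p.2 ∈ Ω₀ ∧ p.1 = r p.2})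
    {ε : ℝ≥0∞} (hε : ε ≠ 0) :
    ∃ (δ : ℕ → ℝ≥0) (d : ℕ → Ω → WithTop (Time T)),
      (∀ n, 0 < δ n) ∧ Tendsto δ atTop (𝓝 0) ∧ (∀ n, (range (d n)).Finite) ∧
      (∀ n, ∀ f : Time T, MeasurableSet[𝓕 (shiftBack f (δ n))] {ω | d n ω = f}) ∧
      P (Ω₀ \ {ω | ∀ n, d n ω ≠ ⊤}) ≤ ε ∧
      (∀ ω, (∀ n, d n ω ≠ ⊤) → ω ∈ Ω₀ ∧ ∃ e : ℕ → Time T,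
        (∀ n, d n ω = e n ∧ e n ≤ r ω) ∧ Tendsto e atTop (𝓝 (r ω))) ∧
      ∀ ω, (∃ n, d n ω = ⊤) → ∀ᶠ n in atTop, d n ω = ⊤ := by
  set G : Set (Time T × Ω) := {p | p.2 ∈ Ω₀ ∧ p.1 = r p.2} with hGdef
  have hg : @Measurable Ω (Time T × Ω) m 𝓕.predictable fun ω ↦ (r ω, ω) :=
    (hr.prodMk measurable_id).mono le_rfl (predictable_le 𝓕)
  -- This measure lives on the graph of `r` over `Ω₀`: approximating the graph within `ε` under `ν`
  -- means losing an event of probability at most `ε`.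
  let ν : @Measure (Time T × Ω) 𝓕.predictable :=
    @Measure.map Ω (Time T × Ω) m 𝓕.predictable (fun ω ↦ (r ω, ω)) (P.restrict Ω₀)
  have : IsFiniteMeasure ν := by
    refine ⟨?_⟩
    rw [Measure.map_apply hg MeasurableSet.univ]
    exact measure_lt_top _ _
  obtain ⟨K, ⟨E, hE, hKE⟩, hKG, hνK⟩ := isApproximable_of_measurableSet (ν := ν) hG ε hε
  let E' : ℕ → Set (Time T × Ω) := fun n ↦ Nat.rec (E 0) (fun n F ↦ F ∩ E (n + 1)) n
  have hE' : ∀ n, IsForetold 𝓕 (E' n) := fun n ↦ by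
    induction n with
    | zero => exact hE 0
    | succ n ih => exact ih.inter (hE _)
  have hanti : Antitone E' := antitone_nat_of_succ_le fun n ↦ inter_subset_left
  have hE'E : ∀ n, E' n ⊆ E n := fun n ↦ by
    cases n with
    | zero => exact subset_rfl
    | succ n => exact inter_subset_right
  have hKE' : ∀ n, K ⊆ E' n := fun n ↦ by
    induction n with
    | zero => rw [hKE]; exact iInter_subset _ 0
    | succ n ih => exact subset_inter ih (by rw [hKE]; exact iInter_subset _ _)
  have hE'K : ∀ p, (∀ n, p ∈ E' n) → p ∈ K := fun p hp ↦ by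
    rw [hKE]
    exact mem_iInter.2 fun n ↦ hE'E n (hp n)
  choose δ hδ d hd hdm hdE hdle using fun n ↦ (hE' n).exists_debut
  have hclosed : ∀ n ω, IsClosed {t | (t, ω) ∈ E' n} := fun n ω ↦ by
    obtain ⟨_, _, _, h, _⟩ := hE' n
    exact h ω
  have hmono : ∀ ω i j, i ≤ j → d i ω ≤ d j ω := by
    intro ω i j hij
    induction h : d j ω using WithTop.recTopCoe with
    | top => exact le_top
    | coe f => exact hdle i ω f (hanti hij (hdE j ω f h))
  -- Shortening the notice is harmless for measurability and makes it tend to `0`.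
  refine ⟨fun n ↦ min (δ n) (1 / (n + 1)), d, fun n ↦ lt_min (hδ n) (by positivity), ?_, hd,
    fun n f ↦ 𝓕.mono (shiftBack_anti f (min_le_left _ _)) _ (hdm n f), ?_, fun ω hω ↦ ?_,
    fun ω ⟨n, hn⟩ ↦ ?_⟩
  · exact tendsto_of_tendsto_of_tendsto_of_le_of_le tendsto_const_nhds
      (tendsto_one_div_add_atTop_nhds_zero_nat (𝕜 := ℝ≥0)) (fun _ ↦ zero_le)
      fun n ↦ min_le_right _ _
  · refine le_trans ?_ hνK
    refine le_trans ?_ (@Measure.le_map_apply Ω (Time T × Ω) m 𝓕.predictable (P.restrict Ω₀)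
      _ ⟨_, hg, EventuallyEq.rfl⟩ _)
    refine le_trans (measure_mono ?_) (Measure.le_restrict_apply _ _)
    rintro ω ⟨h1, h2⟩
    refine ⟨⟨⟨h1, rfl⟩, fun hK ↦ h2 fun n hn ↦ ?_⟩, h1⟩
    have := hdle n ω (r ω) (hKE' n hK)
    rw [hn] at this
    exact absurd this (by simp)
  · choose e he using fun n ↦ WithTop.ne_top_iff_exists.1 (hω n)
    have hemono : Monotone e := fun i j hij ↦ by
      have := hmono ω i j hij
      rwa [← he, ← he, WithTop.coe_le_coe] at this
    obtain ⟨t, ht, hle⟩ := exists_tendsto_of_monotone hemono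
    -- The debuts increase to a limit `t`. Closedness of the sections puts `t` in every `E' n`,
    -- hence in `K`, which lies inside the graph; therefore `t = r ω`.
    have htK : (t, ω) ∈ K := hE'K _ fun n ↦ (hclosed n ω).mem_of_tendsto ht <|
      (eventually_ge_atTop n).mono fun k hk ↦ hanti hk (hdE k ω _ (he k).symm)
    obtain ⟨h1, h2⟩ := hKG htK
    simp only at h1 h2
    exact ⟨h1, e, fun n ↦ ⟨(he n).symm, h2 ▸ hle n⟩, h2 ▸ ht⟩
  · exact (eventually_ge_atTop n).mono fun k hk ↦ top_le_iff.1 (hn ▸ hmono ω n k hk)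

end

/-! ### Conditional laws -/

/-- Closed sets form a generating π-system, and their indicators are limits of bounded continuous
functions. Weak limits are only accessible through such test functions. -/
lemma measurable_of_lintegral_bcf {A : Type*} [MeasurableSpace A] {κ : A → Measure ℝ}
    [∀ a, IsProbabilityMeasure (κ a)]
    (h : ∀ g : BoundedContinuousFunction ℝ ℝ≥0, Measurable fun a ↦ ∫⁻ x, g x ∂(κ a)) :
    Measurable κ := by
  have hgen : (inferInstance : MeasurableSpace ℝ) = .generateFrom {s : Set ℝ | IsClosed s} := by
    rw [BorelSpace.measurable_eq (α := ℝ), borel_eq_generateFrom_isClosed]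
  refine .measure_of_isPiSystem_of_isProbabilityMeasure hgen isPiSystem_isClosed fun s hs ↦ ?_
  refine measurable_of_tendsto_metrizable (fun n ↦ h (IsClosed.apprSeq hs n)) ?_
  rw [tendsto_pi_nhds]
  exact fun a ↦ HasOuterApproxClosed.tendsto_lintegral_apprSeq hs (κ a)

section

variable {Ω : Type*} {𝒢 m : MeasurableSpace Ω} {P : Measure Ω} {L : Ω → ℝ} {κ : Ω → Measure ℝ}

lemma lintegral_law_of_bind_eq (hL : Measurable L) (hκ : Measurable κ) {A : Set Ω}
    (h : (P.restrict A).bind κ = (P.restrict A).map L) {f : ℝ → ℝ≥0∞} (hf : Measurable f) :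
    ∫⁻ ω in A, ∫⁻ x, f x ∂(κ ω) ∂P = ∫⁻ ω in A, f (L ω) ∂P := by
  rw [← Measure.lintegral_bind hκ.aemeasurable hf.aemeasurable, h, lintegral_map hf hL]

/-- Both sides are integrals of `f` against finite measures on `ℝ`, which are determined by bounded
continuous functions. -/
lemma lintegral_law_of_bcf [IsFiniteMeasure P] (hL : Measurable L) (hκ : Measurable κ) {A : Set Ω}
    (h : ∀ g : BoundedContinuousFunction ℝ ℝ≥0,
      ∫⁻ ω in A, ∫⁻ x, g x ∂(κ ω) ∂P = ∫⁻ ω in A, g (L ω) ∂P)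
    {f : ℝ → ℝ≥0∞} (hf : Measurable f) :
    ∫⁻ ω in A, ∫⁻ x, f x ∂(κ ω) ∂P = ∫⁻ ω in A, f (L ω) ∂P := by
  refine lintegral_law_of_bind_eq hL hκ ?_ hf
  refine (ext_of_forall_lintegral_eq_of_IsFiniteMeasure fun g ↦ ?_).symm
  have hg : Measurable fun x ↦ (g x : ℝ≥0∞) := g.continuous.measurable.coe_nnreal_ennreal
  rw [Measure.lintegral_bind hκ.aemeasurable hg.aemeasurable, lintegral_map hg hL, h]

/-- `κ` is a conditional law of `L` given `𝒢`. -/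
def IsConditionalLaw (P : Measure Ω) (L : Ω → ℝ) (𝒢 : MeasurableSpace Ω) (κ : Ω → Measure ℝ) :
    Prop :=
  ∀ A, MeasurableSet[𝒢] A → ∀ f : ℝ → ℝ≥0∞, Measurable f →
    ∫⁻ ω in A, ∫⁻ x, f x ∂(κ ω) ∂P = ∫⁻ ω in A, f (L ω) ∂P

variable [IsFiniteMeasure P] [∀ ω, IsProbabilityMeasure (κ ω)]

lemma isConditionalLaw_of_condProb (h𝒢 : 𝒢 ≤ m) (hL : Measurable L) (hκ : Measurable κ)
    (h : ∀ B, MeasurableSet B → (fun ω ↦ (κ ω).real B) =ᵐ[P] P⟦L ⁻¹' B | 𝒢⟧) :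
    IsConditionalLaw P L 𝒢 κ := by
  intro A hA f hf
  refine lintegral_law_of_bind_eq hL hκ (Measure.ext fun B hB ↦ ?_) hf
  have hκB : Measurable fun ω ↦ κ ω B := (Measure.measurable_coe hB).comp hκ
  rw [Measure.bind_apply hB hκ.aemeasurable, Measure.map_apply hL hB,
    Measure.restrict_apply (hL hB), inter_comm]
  have h1 : ∫ ω in A, (κ ω).real B ∂P = P.real (A ∩ L ⁻¹' B) := by
    rw [setIntegral_congr_ae (h𝒢 _ hA) ((h B hB).mono fun ω hω _ ↦ hω),
      setIntegral_condExp h𝒢 ((integrable_const 1).indicator (hL hB)) hA,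
      setIntegral_indicator (hL hB)]
    simp
  simp only [Measure.real] at h1
  rw [integral_toReal hκB.aemeasurable (ae_of_all _ fun ω ↦ measure_lt_top _ _)] at h1
  refine (ENNReal.toReal_eq_toReal_iff' ?_ (measure_ne_top _ _)).1 h1
  refine ne_top_of_le_ne_top (measure_ne_top P A) ?_
  calc ∫⁻ ω in A, κ ω B ∂P ≤ ∫⁻ ω in A, 1 ∂P := lintegral_mono fun ω ↦ prob_le_one
    _ = P A := by simp

lemma lintegral_bdd_lt_top {f : ℝ → ℝ≥0} {c : ℝ≥0} (hc : ∀ x, f x ≤ c) (ω : Ω) :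
    ∫⁻ x, f x ∂(κ ω) ≤ c := by
  calc ∫⁻ x, f x ∂(κ ω) ≤ ∫⁻ _, (c : ℝ≥0∞) ∂(κ ω) :=
        lintegral_mono fun x ↦ ENNReal.coe_le_coe.2 (hc x)
    _ = c := by simp

lemma integrable_bdd_law (hL : Measurable L) {f : ℝ → ℝ≥0} (hf : Measurable f) {c : ℝ≥0}
    (hc : ∀ x, f x ≤ c) : Integrable (fun ω ↦ (f (L ω) : ℝ)) P :=
  Integrable.of_bound (hf.comp hL).coe_nnreal_real.aestronglyMeasurable c
    (ae_of_all _ fun ω ↦ by simpa using hc (L ω))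

lemma IsConditionalLaw.condExp (h𝒢 : 𝒢 ≤ m) (hL : Measurable L) (hκ : Measurable[𝒢] κ)
    (h : IsConditionalLaw P L 𝒢 κ) {f : ℝ → ℝ≥0} (hf : Measurable f) {c : ℝ≥0}
    (hc : ∀ x, f x ≤ c) :
    (fun ω ↦ (∫⁻ x, f x ∂(κ ω)).toReal) =ᵐ[P] P[fun ω ↦ (f (L ω) : ℝ) | 𝒢] := by
  have hm : Measurable[𝒢] fun ω ↦ ∫⁻ x, f x ∂(κ ω) :=
    (Measure.measurable_lintegral hf.coe_nnreal_ennreal).comp hκ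
  have hb : ∀ ω, ∫⁻ x, f x ∂(κ ω) < ∞ := fun ω ↦
    (lintegral_bdd_lt_top hc ω).trans_lt ENNReal.coe_lt_top
  have hi : Integrable (fun ω ↦ (∫⁻ x, f x ∂(κ ω)).toReal) P := by
    refine Integrable.of_bound (hm.mono h𝒢 le_rfl).ennreal_toReal.aestronglyMeasurable c
      (ae_of_all _ fun ω ↦ ?_)
    simpa using ENNReal.toReal_mono ENNReal.coe_ne_top (lintegral_bdd_lt_top hc ω)
  refine ae_eq_condExp_of_forall_setIntegral_eq h𝒢 (integrable_bdd_law hL hf hc)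
    (fun _ _ _ ↦ hi.integrableOn) (fun A hA _ ↦ ?_)
    hm.ennreal_toReal.stronglyMeasurable.aestronglyMeasurable
  rw [integral_toReal (hm.mono h𝒢 le_rfl).aemeasurable (ae_of_all _ hb),
    h A hA _ hf.coe_nnreal_ennreal]
  have h2 := integral_toReal (μ := P.restrict A) (hf.comp hL).coe_nnreal_ennreal.aemeasurable
    (ae_of_all _ fun _ ↦ ENNReal.coe_lt_top)
  simp only [ENNReal.coe_toReal, Function.comp_apply] at h2
  exact h2.symm

lemma isConditionalLaw_of_bcf (h𝒢 : 𝒢 ≤ m) (hL : Measurable L) (hκ : Measurable κ)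
    (h : ∀ g : BoundedContinuousFunction ℝ ℝ≥0,
      (fun ω ↦ (∫⁻ x, g x ∂(κ ω)).toReal) =ᵐ[P] P[fun ω ↦ (g (L ω) : ℝ) | 𝒢]) :
    IsConditionalLaw P L 𝒢 κ := by
  intro A hA f hf
  refine lintegral_law_of_bcf hL hκ (fun g ↦ ?_) hf
  have hgm : Measurable g := g.continuous.measurable
  have hc : ∀ x, g x ≤ nndist g 0 := BoundedContinuousFunction.NNReal.upper_bound g
  have hm : Measurable fun ω ↦ ∫⁻ x, g x ∂(κ ω) :=
    (Measure.measurable_lintegral hgm.coe_nnreal_ennreal).comp hκ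
  have hb : ∀ ω, ∫⁻ x, g x ∂(κ ω) < ∞ := fun ω ↦
    (lintegral_bdd_lt_top hc ω).trans_lt ENNReal.coe_lt_top
  have h1 := setIntegral_condExp h𝒢 (integrable_bdd_law (P := P) hL hgm hc) hA
  rw [← setIntegral_congr_ae (h𝒢 _ hA) ((h g).mono fun ω hω _ ↦ hω),
    integral_toReal hm.aemeasurable (ae_of_all _ hb)] at h1
  have h2 := integral_toReal (μ := P.restrict A) (hgm.comp hL).coe_nnreal_ennreal.aemeasurable
    (ae_of_all _ fun _ ↦ ENNReal.coe_lt_top)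
  simp only [ENNReal.coe_toReal, Function.comp_apply] at h2
  rw [h2] at h1
  have hfin : ∀ F : Ω → ℝ≥0∞, (∀ ω, F ω ≤ nndist g 0) → ∫⁻ ω in A, F ω ∂P ≠ ∞ := by
    intro F hF
    refine ne_top_of_le_ne_top (ENNReal.mul_ne_top (ENNReal.coe_ne_top (r := nndist g 0))
      (measure_ne_top P A)) ?_
    calc ∫⁻ ω in A, F ω ∂P ≤ ∫⁻ ω in A, nndist g 0 ∂P := lintegral_mono hF
      _ = _ := by simp
  exact (ENNReal.toReal_eq_toReal_iff' (hfin _ fun ω ↦ lintegral_bdd_lt_top hc ω)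
    (hfin _ fun ω ↦ ENNReal.coe_le_coe.2 (hc _))).1 h1

/-- Averaging against a conditional law. -/
lemma IsConditionalLaw.integral_mul (h𝒢 : 𝒢 ≤ m) (hL : Measurable L) (hκ : Measurable[𝒢] κ)
    (h : IsConditionalLaw P L 𝒢 κ) {B : Set ℝ} (hB : MeasurableSet B) {X : Ω → ℝ}
    (hX : AEStronglyMeasurable[𝒢] X P) (hXi : Integrable X P) :
    ∫ ω, X ω * (L ⁻¹' B).indicator 1 ω ∂P = ∫ ω, X ω * (κ ω).real B ∂P := by
  have h1 := h.condExp h𝒢 hL hκ (f := B.indicator 1) (measurable_one.indicator hB) (c := 1)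
    fun x ↦ by by_cases hx : x ∈ B <;> simp [hx]
  have e1 : (fun ω ↦ (((B.indicator 1 (L ω) : ℝ≥0)) : ℝ)) = (L ⁻¹' B).indicator 1 := by
    ext ω
    by_cases hx : L ω ∈ B <;> simp [hx]
  have e2 : ∀ ω, ∫⁻ x, ((B.indicator (1 : ℝ → ℝ≥0) x : ℝ≥0) : ℝ≥0∞) ∂(κ ω) = κ ω B := fun ω ↦ by
    rw [← lintegral_indicator_one hB]
    congr with x
    by_cases hx : x ∈ B <;> simp [hx]
  rw [e1] at h1
  simp only [e2] at h1
  have hi : Integrable ((L ⁻¹' B).indicator (1 : Ω → ℝ)) P :=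
    (integrable_const (1 : ℝ)).indicator (hL hB)
  have hXI : Integrable (X * (L ⁻¹' B).indicator (1 : Ω → ℝ)) P := by
    have : X * (L ⁻¹' B).indicator (1 : Ω → ℝ) = (L ⁻¹' B).indicator X := by
      ext ω
      by_cases hx : L ω ∈ B <;> simp [hx]
    rw [this]
    exact hXi.indicator (hL hB)
  have h2 := condExp_bilin_of_aestronglyMeasurable_left (.mul ℝ ℝ) hX hXI hi
  calc ∫ ω, X ω * (L ⁻¹' B).indicator 1 ω ∂P
      = ∫ ω, (X * (L ⁻¹' B).indicator (1 : Ω → ℝ)) ω ∂P := rfl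
    _ = ∫ ω, P[X * (L ⁻¹' B).indicator (1 : Ω → ℝ) | 𝒢] ω ∂P := (integral_condExp h𝒢).symm
    _ = _ := by
      refine integral_congr_ae ?_
      filter_upwards [h1, h2] with ω hω1 hω2
      exact hω2.trans (by simp [← hω1, Measure.real])

end

/-! ### Regular conditional laws with càdlàg paths -/

/-- A regular conditional law all of whose paths are càdlàg. -/
structure IsCadlagLaw (𝓕 : Filtration (Time T) m) (P : Measure Ω) (L : Ω → ℝ)
    (Q : Time T → Ω → ProbabilityMeasure ℝ) : Prop where
  measurable : ∀ t, Measurable[𝓕 t] fun ω ↦ (Q t ω : Measure ℝ)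
  law : ∀ t, IsConditionalLaw P L (𝓕 t) fun ω ↦ (Q t ω : Measure ℝ)
  cadlag : ∀ ω, IsCadlag fun t ↦ Q t ω

instance (Q : Time T → Ω → ProbabilityMeasure ℝ) (t : Time T) (ω : Ω) :
    IsProbabilityMeasure (leftLaw Q t ω) := by
  unfold leftLaw
  infer_instance

section

variable {𝓕 : Filtration (Time T) m} {P : Measure Ω} [IsFiniteMeasure P] {L : Ω → ℝ}
  {Q : Time T → Ω → ProbabilityMeasure ℝ}

lemma IsRegularConditionalLaw.exists_isCadlagLaw (h𝓕 : UsualConditions 𝓕 P) (hL : Measurable L)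
    (hQ : IsRegularConditionalLaw 𝓕 P L Q) :
    ∃ Q', IsCadlagLaw 𝓕 P L Q' ∧ ∀ᵐ ω ∂P, ∀ t, Q t ω = Q' t ω := by
  classical
  -- On the null set of bad paths, any constant law will do.
  let Q' : Time T → Ω → ProbabilityMeasure ℝ := fun t ω ↦
    if IsCadlag fun t ↦ Q t ω then Q t ω else ⟨Measure.dirac 0, inferInstance⟩
  have hQQ : ∀ᵐ ω ∂P, ∀ t, Q t ω = Q' t ω := by
    filter_upwards [hQ.cadlag] with ω hω t
    simp [Q', hω]
  have hm : ∀ t, Measurable[𝓕 t] fun ω ↦ (Q' t ω : Measure ℝ) := fun t ↦ by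
    refine h𝓕.measurable_congr (f := fun ω ↦ (Q t ω : Measure ℝ)) ?_ ?_
    · exact Measure.measurable_of_measurable_coe _ fun B hB ↦ hQ.measurable t B hB
    · filter_upwards [hQQ] with ω hω
      rw [hω t]
  refine ⟨Q', ⟨hm, fun t ↦ ?_, fun ω ↦ ?_⟩, hQQ⟩
  · refine isConditionalLaw_of_condProb (𝓕.le t) hL ((hm t).mono (𝓕.le t) le_rfl) fun B hB ↦ ?_
    refine EventuallyEq.trans ?_ (hQ.condProb t B hB)
    filter_upwards [hQQ] with ω hω
    rw [hω t]
  · by_cases hω : IsCadlag fun t ↦ Q t ω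
    · simp [Q', hω]
    · simp only [Q', hω]
      exact fun t ↦ ⟨continuousWithinAt_const, _, tendsto_const_nhds⟩

lemma leftLaw_bot (ω : Ω) : leftLaw Q ⊥ ω = Q ⊥ ω := by
  rw [leftLaw, leftLim_eq_of_isBot isBot_bot]

lemma IsCadlagLaw.tendsto_leftLaw (hQ : IsCadlagLaw 𝓕 P L Q) {t : Time T} (ht : ⊥ < t) (ω : Ω) :
    Tendsto (fun s ↦ Q s ω) (𝓝[<] t) (𝓝 (Function.leftLim (fun s ↦ Q s ω) t)) := by
  have : (𝓝[<] t).NeBot := by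
    refine neBot_of_le (f := map (fun n ↦ gridBelow n t) atTop) (tendsto_gridBelow ht)
  exact tendsto_leftLim_of_tendsto ((hQ.cadlag ω t).2)

lemma IsCadlagLaw.tendsto_lintegral_leftLaw (hQ : IsCadlagLaw 𝓕 P L Q) {t : Time T} (ht : ⊥ < t)
    (ω : Ω) (g : BoundedContinuousFunction ℝ ℝ≥0) :
    Tendsto (fun s ↦ ∫⁻ x, g x ∂(Q s ω : Measure ℝ)) (𝓝[<] t)
      (𝓝 (∫⁻ x, g x ∂(leftLaw Q t ω))) :=
  ProbabilityMeasure.tendsto_iff_forall_lintegral_tendsto.1 (hQ.tendsto_leftLaw ht ω) g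

/-- Tested on a bounded continuous `g`, the left limits of the laws become the left limits of an
adapted real process, which are predictable. -/
lemma IsCadlagLaw.measurable_leftLaw (hQ : IsCadlagLaw 𝓕 P L Q) :
    Measurable[𝓕.predictable] fun p : Time T × Ω ↦ leftLaw Q p.1 p.2 := by
  refine @measurable_of_lintegral_bcf _ 𝓕.predictable _ _ fun g ↦ ?_
  refine measurable_leftLimit (X := fun t ω ↦ ∫⁻ x, g x ∂(Q t ω : Measure ℝ))
    (Y := fun t ω ↦ ∫⁻ x, g x ∂(leftLaw Q t ω)) (fun t ↦ ?_) (fun ω ↦ ?_) fun ω t ht ↦ ?_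
  · exact (Measure.measurable_lintegral g.continuous.measurable.coe_nnreal_ennreal).comp
      (hQ.measurable t)
  · simp only [leftLaw_bot]
  · exact hQ.tendsto_lintegral_leftLaw ht ω g

/-- The martingale of conditional expectations of `g (L)`. -/
lemma IsCadlagLaw.martingale_lintegral (h𝓕 : UsualConditions 𝓕 P) (hL : Measurable L)
    (hQ : IsCadlagLaw 𝓕 P L Q) {f : ℝ → ℝ≥0} (hf : Measurable f) {c : ℝ≥0} (hc : ∀ x, f x ≤ c) :
    Martingale (fun t ω ↦ (∫⁻ x, f x ∂(Q t ω : Measure ℝ)).toReal) 𝓕 P :=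
  martingale_congr h𝓕 (martingale_condExp (fun ω ↦ (f (L ω) : ℝ)) 𝓕 P) fun t ↦
    ((hQ.law t).condExp (𝓕.le t) hL (hQ.measurable t) hf hc).symm

lemma IsCadlagLaw.rightContinuous_lintegral (hQ : IsCadlagLaw 𝓕 P L Q)
    (g : BoundedContinuousFunction ℝ ℝ≥0) (ω : Ω) (t : Time T) :
    ContinuousWithinAt (fun t ↦ (∫⁻ x, g x ∂(Q t ω : Measure ℝ)).toReal) (Ici t) t :=
  (ENNReal.tendsto_toReal (lintegral_bdd_lt_top (κ := fun ω ↦ (Q t ω : Measure ℝ))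
    (BoundedContinuousFunction.NNReal.upper_bound g) ω |>.trans_lt ENNReal.coe_lt_top).ne).comp
    (ProbabilityMeasure.tendsto_iff_forall_lintegral_tendsto.1 (hQ.cadlag ω t).1 g)

lemma IsCadlagLaw.measurable_stopped (hQ : IsCadlagLaw 𝓕 P L Q) {r : Ω → Time T}
    (hr : IsStoppingTime 𝓕 fun ω ↦ (r ω : WithTop (Time T))) :
    Measurable[hr.measurableSpace] fun ω ↦ (Q (r ω) ω : Measure ℝ) := by
  refine @measurable_of_lintegral_bcf _ hr.measurableSpace _ _ fun g ↦ ?_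
  have hX : StronglyAdapted 𝓕 fun t ω ↦ (∫⁻ x, g x ∂(Q t ω : Measure ℝ)).toReal := fun t ↦
    Measurable.stronglyMeasurable (((Measure.measurable_lintegral
      g.continuous.measurable.coe_nnreal_ennreal).comp (hQ.measurable t)).ennreal_toReal)
  have h := measurable_stoppedValue (isStronglyProgressive_of_rightContinuous hX
    (hQ.rightContinuous_lintegral g)) hr
  convert! h.ennreal_ofReal using 2 with ω
  change _ = ENNReal.ofReal (∫⁻ x, g x ∂(Q (r ω) ω : Measure ℝ)).toReal
  rw [ENNReal.ofReal_toReal]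
  exact (lintegral_bdd_lt_top (κ := fun ω ↦ (Q (r ω) ω : Measure ℝ))
    (BoundedContinuousFunction.NNReal.upper_bound g) ω |>.trans_lt ENNReal.coe_lt_top).ne

/-- For bounded continuous `g`, the process `∫ g dQ_t` is a right-continuous martingale and can be
sampled at `r`; such `g` determine the law. The tails `Q_t(a, ∞)` are not weakly continuous
functionals, so they are reached only after this detour. -/
lemma IsCadlagLaw.law_stopped (h𝓕 : UsualConditions 𝓕 P) (hL : Measurable L)
    (hQ : IsCadlagLaw 𝓕 P L Q) {r : Ω → Time T}
    (hr : IsStoppingTime 𝓕 fun ω ↦ (r ω : WithTop (Time T))) :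
    IsConditionalLaw P L hr.measurableSpace fun ω ↦ (Q (r ω) ω : Measure ℝ) := by
  refine isConditionalLaw_of_bcf hr.measurableSpace_le hL
    ((hQ.measurable_stopped hr).mono hr.measurableSpace_le le_rfl) fun g ↦ ?_
  have hgm : Measurable g := g.continuous.measurable
  have hc := BoundedContinuousFunction.NNReal.upper_bound g
  refine (martingale_stopped_ae_eq_condExp h𝓕 (hQ.martingale_lintegral h𝓕 hL hgm hc)
    (ae_of_all _ (hQ.rightContinuous_lintegral g)) hr (t := ⊤) fun ω ↦ le_top).trans ?_
  refine (condExp_congr_ae ((hQ.law ⊤).condExp (𝓕.le ⊤) hL (hQ.measurable ⊤) hgm hc)).trans ?_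
  exact condExp_condExp_of_le (hr.measurableSpace_le_of_le_const
    fun ω ↦ WithTop.coe_le_coe.2 le_top) (𝓕.le ⊤)

/-- The left limit of the conditional laws at a predictable time. -/
theorem IsCadlagLaw.law_leftLaw (hL : Measurable L)
    (hQ : IsCadlagLaw 𝓕 P L Q) {Ω₀ : Set Ω} {r : Ω → Time T}
    (hr : Measurable r) (hgr : MeasurableSet[𝓕.predictable] {p : Time T × Ω | p.2 ∈ Ω₀ ∧ p.1 = r p.2})
    (hpos : ∀ ω ∈ Ω₀, ⊥ < r ω) {f : ℝ → ℝ≥0∞} (hf : Measurable f) :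
    ∫⁻ ω in Ω₀, ∫⁻ x, f x ∂(leftLaw Q (r ω) ω) ∂P = ∫⁻ ω in Ω₀, f (L ω) ∂P := by
  classical
  have hκ : Measurable fun ω ↦ leftLaw Q (r ω) ω :=
    (hQ.measurable_leftLaw.mono (predictable_le 𝓕) le_rfl).comp (hr.prodMk measurable_id)
  refine lintegral_law_of_bcf hL hκ (fun g ↦ ?_) hf
  set c : ℝ≥0 := nndist g 0
  have hc : ∀ x, g x ≤ c := BoundedContinuousFunction.NNReal.upper_bound g
  have hgm : Measurable fun x ↦ (g x : ℝ≥0∞) := g.continuous.measurable.coe_nnreal_ennreal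
  have hF : ∀ ω, ∫⁻ x, g x ∂(leftLaw Q (r ω) ω) ≤ c :=
    lintegral_bdd_lt_top (κ := fun ω ↦ leftLaw Q (r ω) ω) hc
  have hG : ∀ ω, (g (L ω) : ℝ≥0∞) ≤ c := fun ω ↦ ENNReal.coe_le_coe.2 (hc _)
  have key : ∀ ε : ℝ≥0∞, ε ≠ 0 → ∃ K ⊆ Ω₀, MeasurableSet K ∧ P (Ω₀ \ K) ≤ ε ∧
      ∫⁻ ω in K, ∫⁻ x, g x ∂(leftLaw Q (r ω) ω) ∂P = ∫⁻ ω in K, g (L ω) ∂P := by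
    intro ε hε
    obtain ⟨δ, d, hδ, hδ0, hfin, hd, hPε, hK, htop⟩ := exists_announcing (P := P) hr hgr hε
    have hdm : ∀ n (f : Time T), MeasurableSet {ω | d n ω = f} := fun n f ↦ 𝓕.le _ _ (hd n f)
    let S : ℕ → Finset (Time T) := fun n ↦
      ((hfin n).preimage WithTop.coe_injective.injOn : Set.Finite ((↑) ⁻¹' range (d n))).toFinset
    have hS : ∀ n ω (e : Time T), d n ω = e → e ∈ S n := fun n ω e he ↦ by
      simpa [S] using ⟨ω, he⟩
    -- The value of `u` at the random time `d n`, with value `0` where `d n = ⊤`, written as a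
    -- finite sum over the possible times.
    let Φ : (Time T → Ω → ℝ≥0∞) → ℕ → Ω → ℝ≥0∞ := fun u n ω ↦
      ∑ f ∈ S n, {ω | d n ω = f}.indicator (u f) ω
    have hΦtop : ∀ u n ω, d n ω = ⊤ → Φ u n ω = 0 := fun u n ω h ↦ by
      refine Finset.sum_eq_zero fun f _ ↦ indicator_of_notMem ?_ _
      simp [h]
    have hΦ : ∀ u n ω (e : Time T), d n ω = e → Φ u n ω = u e ω := fun u n ω e h ↦ by
      refine (Finset.sum_eq_single_of_mem e (hS n ω e h) fun f _ hf ↦ ?_).trans ?_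
      · refine indicator_of_notMem ?_ _
        simpa [h] using hf.symm
      · exact indicator_of_mem (s := {ω | d n ω = e}) h _
    have hΦc : ∀ u n, (∀ f ω, u f ω ≤ (c : ℝ≥0∞)) → ∀ ω, Φ u n ω ≤ (c : ℝ≥0∞) := fun u n hu ω ↦ by
      induction h : d n ω using WithTop.recTopCoe with
      | top => simp [hΦtop u n ω h]
      | coe e => rw [hΦ u n ω e h]; exact hu _ _
    have hΦm : ∀ u n, (∀ f, Measurable (u f)) → Measurable (Φ u n) := fun u n hu ↦
      Finset.measurable_fun_sum _ fun f _ ↦ (hu f).indicator (hdm n f)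
    have hΦi : ∀ u n, (∀ f, Measurable (u f)) →
        ∫⁻ ω, Φ u n ω ∂P = ∑ f ∈ S n, ∫⁻ ω in {ω | d n ω = f}, u f ω ∂P := fun u n hu ↦ by
      rw [lintegral_finsetSum _ fun f _ ↦ (hu f).indicator (hdm n f)]
      exact Finset.sum_congr rfl fun f _ ↦ lintegral_indicator (hdm n f) _
    -- The law is taken `δ n` before `f`: the event `d n = f` is already known then, so the
    -- conditional law applies on it, and the time is strictly before `r`.
    let u : ℕ → Time T → Ω → ℝ≥0∞ := fun n f ω ↦ ∫⁻ x, g x ∂(Q (shiftBack f (δ n)) ω : Measure ℝ)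
    let v : Time T → Ω → ℝ≥0∞ := fun _ ω ↦ g (L ω)
    have hum : ∀ n f, Measurable (u n f) := fun n f ↦ (Measure.measurable_lintegral hgm).comp
      ((hQ.measurable _).mono (𝓕.le _) le_rfl)
    have hvm : ∀ f, Measurable (v f) := fun f ↦ hgm.comp hL
    have huc : ∀ n f ω, u n f ω ≤ c := fun n f ω ↦
      lintegral_bdd_lt_top (κ := fun ω ↦ (Q (shiftBack f (δ n)) ω : Measure ℝ)) hc ω
    set K : Set Ω := {ω | ∀ n, d n ω ≠ ⊤} with hKdef
    have hKm : MeasurableSet K := by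
      have : K = ⋂ n, ⋃ f ∈ S n, {ω | d n ω = f} := by
        ext ω
        simp only [K, mem_ofPred_eq, mem_iInter, mem_iUnion, exists_prop]
        refine forall_congr' fun n ↦ ⟨fun h ↦ ?_, fun ⟨f, _, h⟩ ↦ by simp [h]⟩
        obtain ⟨e, he⟩ := WithTop.ne_top_iff_exists.1 h
        exact ⟨e, hS n ω e he.symm, he.symm⟩
      rw [this]
      exact MeasurableSet.iInter fun n ↦ Finset.measurableSet_biUnion _ fun f _ ↦ hdm n f
    refine ⟨K, fun ω hω ↦ (hK ω hω).1, hKm, hPε, ?_⟩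
    -- Dominated convergence with bound `c`; off `K` the times `d n` are eventually `⊤`, so the
    -- integrand vanishes in the limit.
    have hlim : ∀ (w : ℕ → Time T → Ω → ℝ≥0∞) (W : Ω → ℝ≥0∞), (∀ n f, Measurable (w n f)) →
        (∀ n f ω, w n f ω ≤ c) → (∀ ω ∈ K, Tendsto (fun n ↦ Φ (w n) n ω) atTop (𝓝 (W ω))) →
        Tendsto (fun n ↦ ∫⁻ ω, Φ (w n) n ω ∂P) atTop (𝓝 (∫⁻ ω in K, W ω ∂P)) := by
      intro w W hwm hwc hW
      rw [← lintegral_indicator hKm]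
      refine tendsto_lintegral_of_dominated_convergence (fun _ ↦ (c : ℝ≥0∞))
        (fun n ↦ hΦm _ _ (hwm n)) (fun n ↦ ae_of_all _ (hΦc _ _ (hwc n))) ?_
        (ae_of_all _ fun ω ↦ ?_)
      · simpa using ENNReal.mul_ne_top ENNReal.coe_ne_top (measure_ne_top P _)
      · by_cases hω : ω ∈ K
        · simpa only [indicator_of_mem hω] using hW ω hω
        · rw [indicator_of_notMem hω]
          refine tendsto_const_nhds.congr' ?_
          filter_upwards [htop ω (by simpa [K] using hω)] with n hn
          exact (hΦtop _ _ _ hn).symm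
    refine tendsto_nhds_unique (hlim u _ hum huc fun ω hω ↦ ?_)
      ((hlim (fun _ ↦ v) _ (fun _ ↦ hvm) (fun _ _ ↦ hG) fun ω hω ↦ ?_).congr fun n ↦ ?_)
    · obtain ⟨hω₀, e, he, her⟩ := hK ω hω
      have h1 : Tendsto (fun n ↦ shiftBack (e n) (δ n)) atTop (𝓝[<] r ω) := by
        refine tendsto_nhdsWithin_iff.2 ⟨?_, Eventually.of_forall fun n ↦ ?_⟩
        · rw [tendsto_subtype_rng]
          simpa [coe_shiftBack] using (tendsto_subtype_rng.1 her).sub hδ0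
        · rcases (he n).2.eq_or_lt with h | h
          · rw [h]
            exact shiftBack_lt (hpos ω hω₀) (hδ n)
          · exact (shiftBack_le _ _).trans_lt h
      refine ((hQ.tendsto_lintegral_leftLaw (hpos ω hω₀) ω g).comp h1).congr fun n ↦ ?_
      exact (hΦ (u n) n ω _ (he n).1).symm
    · obtain ⟨-, e, he, -⟩ := hK ω hω
      refine tendsto_const_nhds.congr fun n ↦ ?_
      exact (hΦ v n ω _ (he n).1).symm
    · rw [hΦi _ _ hvm, hΦi _ _ (hum n)]
      exact Finset.sum_congr rfl fun f _ ↦ ((hQ.law _) _ (hd n f) _ hgm).symm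
  -- Passing from `K` to `Ω₀` costs at most `c` times the lost probability. Dividing `ε` by `c + 1`
  -- covers the case `c = 0`. The one-sided bound is used twice, with the roles of the two
  -- integrands exchanged.
  have step : ∀ F G : Ω → ℝ≥0∞, (∀ ω, F ω ≤ c) → (∀ ε : ℝ≥0∞, ε ≠ 0 → ∃ K ⊆ Ω₀, MeasurableSet K ∧
      P (Ω₀ \ K) ≤ ε ∧ ∫⁻ ω in K, F ω ∂P = ∫⁻ ω in K, G ω ∂P) →
      ∫⁻ ω in Ω₀, F ω ∂P ≤ ∫⁻ ω in Ω₀, G ω ∂P := by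
    intro F G hF h
    refine ENNReal.le_of_forall_pos_le_add fun ε hε _ ↦ ?_
    obtain ⟨K, hKΩ, hKm, hP, hFG⟩ := h (ε / (c + 1)) (by simp [hε.ne'])
    calc ∫⁻ ω in Ω₀, F ω ∂P = ∫⁻ ω in K ∪ Ω₀ \ K, F ω ∂P := by rw [union_sdiff_cancel hKΩ]
      _ ≤ ∫⁻ ω in K, F ω ∂P + ∫⁻ ω in Ω₀ \ K, F ω ∂P := lintegral_union_le _ _ _
      _ ≤ ∫⁻ ω in Ω₀, G ω ∂P + c * (ε / (c + 1)) := by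
        refine add_le_add (hFG.trans_le (lintegral_mono_set hKΩ)) ?_
        calc ∫⁻ ω in Ω₀ \ K, F ω ∂P ≤ ∫⁻ ω in Ω₀ \ K, c ∂P := lintegral_mono hF
          _ = c * P (Ω₀ \ K) := by simp
          _ ≤ _ := by gcongr
      _ ≤ _ := by
        gcongr
        calc (c : ℝ≥0∞) * (ε / (c + 1)) ≤ (c + 1) * (ε / (c + 1)) := by gcongr; exact le_self_add
          _ = ε := ENNReal.mul_div_cancel (by simp) (by simp)
  refine le_antisymm (step _ _ hF key) (step _ _ hG fun ε hε ↦ ?_)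
  obtain ⟨K, h1, h2, h3, h4⟩ := key ε hε
  exact ⟨K, h1, h2, h3, h4.symm⟩

end

/-! ### Increasing predictable processes and time changes -/

/-- Increasing right-continuous predictable processes null at `0`. -/
structure IsIncreasing (𝓕 : Filtration (Time T) m) (C : Time T → Ω → ℝ) : Prop where
  predictable : Measurable[𝓕.predictable] fun p : Time T × Ω ↦ C p.1 p.2
  zero : ∀ ω, C ⊥ ω = 0
  mono : ∀ ω, Monotone fun t ↦ C t ω
  rightCont : ∀ ω t, ContinuousWithinAt (fun t ↦ C t ω) (Ici t) t

/-- The first time at which `f` reaches the level `c`, or the final time. -/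
def debut (f : Time T → ℝ) (c : ℝ) : Time T :=
  open Classical in if c ≤ f ⊤ then (letI := timeOrder (T := T); sInf {t | c ≤ f t}) else ⊤

section

variable {f : Time T → ℝ} {c : ℝ}

/-- Right-continuity makes the infimum of the times at or above the level be attained. -/
lemma isLeast_debut (hf : ∀ t, ContinuousWithinAt f (Ici t) t)
    (hc : c ≤ f ⊤) : IsLeast {t | c ≤ f t} (debut f c) := by
  have hne : {t | c ≤ f t}.Nonempty := ⟨⊤, hc⟩
  have hglb : IsGLB {t | c ≤ f t} (debut f c) := by
    rw [debut, if_pos hc]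
    let := timeOrder (T := T)
    exact isGLB_csInf hne (OrderBot.bddBelow _)
  refine ⟨?_, hglb.1⟩
  by_contra h
  have h1 : f (debut f c) < c := not_le.1 h
  have h2 : ∀ᶠ s in 𝓝[≥] debut f c, f s < c := (hf _).eventually_lt_const h1
  obtain ⟨s, hs, hs'⟩ := (hglb.frequently_mem hne).and_eventually h2 |>.exists
  exact absurd hs' (not_lt.2 hs)

/-- The alternative `t = ⊤` accounts for levels never reached, where `debut` defaults to the final
time. -/
lemma debut_le_iff (hf : ∀ t, ContinuousWithinAt f (Ici t) t) (hm : Monotone f)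
    {t : Time T} : debut f c ≤ t ↔ c ≤ f t ∨ t = ⊤ := by
  by_cases hc : c ≤ f ⊤
  · have h := isLeast_debut hf hc
    refine ⟨fun ht ↦ Or.inl (h.1.trans (hm ht)), ?_⟩
    rintro (ht | rfl)
    · exact h.2 ht
    · exact le_top
  · rw [debut, if_neg hc, top_le_iff]
    exact ⟨Or.inr, fun h ↦ h.resolve_left fun h ↦ hc (h.trans (hm le_top))⟩

end

/-! ### Lebesgue–Stieltjes measures and the time change by first passage times. -/

lemma stieltjes_Ioc {f : Time T → ℝ} (hf : ∀ t, ContinuousWithinAt f (Ici t) t) (hm : Monotone f)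
    (s t : Time T) : stieltjes f (Ioc s t) = ENNReal.ofReal (f t - f s) := by
  rw [stieltjes, dif_pos ⟨hm, hf⟩, StieltjesFunction.measure_Ioc]

lemma stieltjes_Iic {f : Time T → ℝ} (hf : ∀ t, ContinuousWithinAt f (Ici t) t) (hm : Monotone f)
    (t : Time T) : stieltjes f (Iic t) = ENNReal.ofReal (f t - f ⊥) := by
  rw [stieltjes, dif_pos ⟨hm, hf⟩, ← Icc_bot (a := t), StieltjesFunction.measure_Icc,
    leftLim_eq_of_isBot isBot_bot]

lemma stieltjes_bot (f : Time T → ℝ) : stieltjes f {⊥} = 0 := by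
  by_cases h : Monotone f ∧ ∀ t, ContinuousWithinAt f (Ici t) t
  · rw [← Iic_bot, stieltjes_Iic h.2 h.1]
    simp
  · rw [stieltjes, dif_neg h]
    simp

instance (f : Time T → ℝ) : IsFiniteMeasure (stieltjes f) := by
  by_cases h : Monotone f ∧ ∀ t, ContinuousWithinAt f (Ici t) t
  · refine ⟨?_⟩
    rw [← Iic_top, stieltjes_Iic h.2 h.1]
    exact ENNReal.ofReal_lt_top
  · rw [stieltjes, dif_neg h]
    infer_instance

lemma restrict_stieltjes_Ioc_bot_top (f : Time T → ℝ) :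
    (stieltjes f).restrict (Ioc ⊥ ⊤) = stieltjes f := by
  rw [Measure.restrict_eq_self_of_ae_mem]
  have : ∀ᵐ t ∂(stieltjes f), t ∉ ({⊥} : Set (Time T)) :=
    measure_eq_zero_iff_ae_notMem.1 (stieltjes_bot f)
  filter_upwards [this] with t ht
  exact ⟨bot_lt_iff_ne_bot.2 ht, le_top⟩

namespace IsIncreasing

variable {𝓕 : Filtration (Time T) m} {C : Time T → Ω → ℝ}

lemma adapted (hC : IsIncreasing 𝓕 C) : StronglyAdapted 𝓕 C :=
  IsStronglyPredictable.stronglyAdapted (E := ℝ)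
    (show StronglyMeasurable[𝓕.predictable] (Function.uncurry C) from
      hC.predictable.stronglyMeasurable)

lemma measurable (hC : IsIncreasing 𝓕 C) (t : Time T) : Measurable (C t) :=
  (hC.adapted t).measurable.mono (𝓕.le t) le_rfl

lemma measurable_debut (hC : IsIncreasing 𝓕 C) :
    Measurable fun p : ℝ × Ω ↦ debut (fun t ↦ C t p.2) p.1 := by
  refine measurable_of_Iic fun t ↦ ?_
  have : (fun p : ℝ × Ω ↦ debut (fun t ↦ C t p.2) p.1) ⁻¹' Iic t
      = {p | p.1 ≤ C t p.2} ∪ {_p | t = ⊤} := by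
    ext p
    simp only [mem_preimage, mem_Iic, debut_le_iff (hC.rightCont p.2) (hC.mono p.2)]
    rfl
  rw [this]
  exact (measurableSet_le measurable_fst ((hC.measurable t).comp measurable_snd)).union
    (MeasurableSet.const _)

lemma debut_pos (hC : IsIncreasing 𝓕 C) {c : ℝ} (hc : 0 < c) {ω : Ω} (h : c ≤ C ⊤ ω) :
    ⊥ < debut (fun t ↦ C t ω) c := by
  rw [bot_lt_iff_ne_bot]
  intro h'
  have := (isLeast_debut (hC.rightCont ω) h).1
  rw [h', mem_ofPred_eq, hC.zero] at this
  exact hc.not_ge this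

/-- The graph of the first passage time is predictable. -/
lemma measurableSet_graph_debut (hC : IsIncreasing 𝓕 C) (c : ℝ) :
    MeasurableSet[𝓕.predictable]
      {p : Time T × Ω | p.2 ∈ {ω | c ≤ C ⊤ ω} ∧ p.1 = debut (fun t ↦ C t p.2) c} := by
  obtain ⟨D, hDc, hD⟩ := TopologicalSpace.exists_countable_dense (Time T)
  -- The first passage time is the time at which the level holds but held at no strictly earlier
  -- point of `D`. A countable dense set suffices: by monotonicity, an earlier passage would be seen
  -- at some point of `D` in between.
  have : {p : Time T × Ω | p.2 ∈ {ω | c ≤ C ⊤ ω} ∧ p.1 = debut (fun t ↦ C t p.2) c}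
      = {p | c ≤ C p.1 p.2} ∩ ⋂ q ∈ D, (Prod.fst ⁻¹' Iic q ∪ Ioi q ×ˢ {ω | C q ω < c}) := by
    ext ⟨t, ω⟩
    simp only [mem_ofPred_eq, mem_inter_iff, mem_iInter, mem_union, mem_preimage, mem_Iic, mem_prod,
      mem_Ioi]
    constructor
    · rintro ⟨hω, rfl⟩
      have h := isLeast_debut (hC.rightCont ω) hω
      refine ⟨h.1, fun q _ ↦ ?_⟩
      by_contra! hne
      exact absurd (h.2 (hne.2 hne.1)) (not_le.2 hne.1)
    · rintro ⟨hω, hq⟩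
      have hω' : c ≤ C ⊤ ω := hω.trans (hC.mono ω le_top)
      have h := isLeast_debut (hC.rightCont ω) hω'
      refine ⟨hω', le_antisymm ?_ (h.2 hω)⟩
      by_contra! hlt
      obtain ⟨q, hqD, hq1, hq2⟩ := hD.exists_between hlt
      rcases hq q hqD with h' | h'
      · exact absurd h' (not_le.2 hq2)
      · exact absurd (h.1.trans (hC.mono ω hq1.le)) (not_le.2 h'.2)
  rw [this]
  refine MeasurableSet.inter ?_ (MeasurableSet.biInter hDc fun q _ ↦ ?_)
  · exact hC.predictable measurableSet_Ici
  · exact (measurable_fst_predictable 𝓕 measurableSet_Iic).union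
      (measurableSet_predictable_Ioi_prod ((hC.adapted q).measurable measurableSet_Iio))

/-- First passage is the generalized inverse of the path: the levels in `(0, C_T]` passed by time
`t` are exactly those in `(0, C_t]`. Integrals against `dC` thus become integrals over deterministic
levels of values at predictable times. -/
lemma map_debut (hC : IsIncreasing 𝓕 C) (ω : Ω) :
    (volume.restrict (Ioc 0 (C ⊤ ω))).map (debut fun t ↦ C t ω) = stieltjes fun t ↦ C t ω := by
  have hm : Measurable (debut fun t ↦ C t ω) := hC.measurable_debut.comp measurable_prodMk_right
  refine Measure.ext_of_Iic _ _ fun t ↦ ?_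
  rw [Measure.map_apply hm measurableSet_Iic, stieltjes_Iic (hC.rightCont ω) (hC.mono ω),
    Measure.restrict_apply (hm measurableSet_Iic)]
  have : (debut fun t ↦ C t ω) ⁻¹' Iic t ∩ Ioc 0 (C ⊤ ω) = Ioc 0 (C t ω) := by
    ext c
    simp only [mem_inter_iff, mem_preimage, mem_Iic,
      debut_le_iff (hC.rightCont ω) (hC.mono ω), mem_Ioc]
    constructor
    · rintro ⟨h | rfl, h1, h2⟩
      · exact ⟨h1, h⟩
      · exact ⟨h1, h2⟩
    · rintro ⟨h1, h2⟩
      exact ⟨Or.inl h2, h1, h2.trans (hC.mono ω le_top)⟩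
  rw [this, Real.volume_Ioc, hC.zero]

lemma lintegral_stieltjes (hC : IsIncreasing 𝓕 C) (ω : Ω) {G : Time T → ℝ≥0∞} (hG : Measurable G) :
    ∫⁻ s, G s ∂(stieltjes fun t ↦ C t ω)
      = ∫⁻ c in Ioi (0 : ℝ), {c | c ≤ C ⊤ ω}.indicator (fun c ↦ G (debut (fun t ↦ C t ω) c)) c := by
  have hm : Measurable (debut fun t ↦ C t ω) := hC.measurable_debut.comp measurable_prodMk_right
  have hs : MeasurableSet {c | c ≤ C ⊤ ω} := measurableSet_Iic
  rw [← hC.map_debut ω, lintegral_map hG hm, lintegral_indicator hs, Measure.restrict_restrict hs]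
  congr 2
  ext c
  simp [and_comm]

lemma measurable_lintegral_stieltjes_aux (hC : IsIncreasing 𝓕 C) {G : Time T × Ω → ℝ≥0∞}
    (hG : Measurable G) : Measurable fun p : ℝ × Ω ↦
      {c | c ≤ C ⊤ p.2}.indicator (fun c ↦ G (debut (fun t ↦ C t p.2) c, p.2)) p.1 := by
  have h : Measurable fun p : ℝ × Ω ↦ G (debut (fun t ↦ C t p.2) p.1, p.2) :=
    hG.comp (hC.measurable_debut.prodMk measurable_snd)
  exact h.indicator (measurableSet_le measurable_fst ((hC.measurable ⊤).comp measurable_snd))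

lemma measurable_lintegral (hC : IsIncreasing 𝓕 C) {G : Time T × Ω → ℝ≥0∞} (hG : Measurable G) :
    Measurable fun ω ↦ ∫⁻ s, G (s, ω) ∂(stieltjes fun t ↦ C t ω) := by
  have hG' : ∀ ω, Measurable fun s ↦ G (s, ω) := fun ω ↦ hG.comp measurable_prodMk_right
  rw [funext fun ω ↦ hC.lintegral_stieltjes ω (hG' ω)]
  exact (hC.measurable_lintegral_stieltjes_aux hG).lintegral_prod_left'

lemma lintegral_lintegral_stieltjes (hC : IsIncreasing 𝓕 C) {P : Measure Ω} [SFinite P]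
    {G : Time T × Ω → ℝ≥0∞} (hG : Measurable G) :
    ∫⁻ ω, ∫⁻ s, G (s, ω) ∂(stieltjes fun t ↦ C t ω) ∂P
      = ∫⁻ c in Ioi (0 : ℝ), ∫⁻ ω in {ω | c ≤ C ⊤ ω}, G (debut (fun t ↦ C t ω) c, ω) ∂P := by
  have hG' : ∀ ω, Measurable fun s ↦ G (s, ω) := fun ω ↦ hG.comp measurable_prodMk_right
  rw [lintegral_congr fun ω ↦ hC.lintegral_stieltjes ω (hG' ω),
    lintegral_lintegral_swap
      (f := fun ω c ↦ {c | c ≤ C ⊤ ω}.indicator (fun c ↦ G (debut (fun t ↦ C t ω) c, ω)) c)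
      ((hC.measurable_lintegral_stieltjes_aux hG).comp measurable_swap).aemeasurable]
  refine lintegral_congr fun c ↦ ?_
  rw [← lintegral_indicator (measurableSet_le measurable_const (hC.measurable ⊤))]
  rfl

end IsIncreasing

/-! ### Disintegration of `L` along the predictable σ-algebra -/

/-- The hypothesis says that, on rectangles, the law of `(φ, L)` under `P` restricted to `S` is the
composition of the law of `φ` with the kernel `κ`. Rectangles determine this law, so any measurable
`H` may be integrated. -/
lemma lintegral_comp_law {A : Type*} [MeasurableSpace A] {P : Measure Ω} [IsFiniteMeasure P]
    {φ : Ω → A} (hφ : Measurable φ) {κ : A → Measure ℝ} [∀ a, IsProbabilityMeasure (κ a)]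
    (hκ : Measurable κ) {L : Ω → ℝ} (hL : Measurable L) {S : Set Ω}
    (h : ∀ E, MeasurableSet E → ∀ B, MeasurableSet B →
      ∫⁻ ω in φ ⁻¹' E ∩ S, κ (φ ω) B ∂P = P (L ⁻¹' B ∩ (φ ⁻¹' E ∩ S)))
    {H : A × ℝ → ℝ≥0∞} (hH : Measurable H) :
    ∫⁻ ω in S, ∫⁻ x, H (φ ω, x) ∂(κ (φ ω)) ∂P = ∫⁻ ω in S, H (φ ω, L ω) ∂P := by
  let K : Kernel A ℝ := ⟨κ, hκ⟩
  have : IsMarkovKernel K := ⟨fun a ↦ inferInstanceAs (IsProbabilityMeasure (κ a))⟩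
  have key : ((P.restrict S).map φ) ⊗ₘ K = (P.restrict S).map fun ω ↦ (φ ω, L ω) := by
    refine Measure.ext_prod fun {E B} hE hB ↦ ?_
    rw [Measure.compProd_apply_prod hE hB, setLIntegral_map hE (K.measurable_coe hB) hφ,
      Measure.restrict_restrict (hφ hE), Measure.map_apply (hφ.prodMk hL) (hE.prod hB),
      Measure.restrict_apply ((hφ.prodMk hL) (hE.prod hB))]
    refine (h E hE B hB).trans (congrArg P ?_)
    ext ω
    simp only [mem_inter_iff, mem_preimage, mem_prod]
    tauto
  have h1 := congrArg (fun μ ↦ ∫⁻ p, H p ∂μ) key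
  beta_reduce at h1
  rw [Measure.lintegral_compProd hH, lintegral_map (hH.lintegral_kernel_prod_right' (κ := K)) hφ,
    lintegral_map hH (hφ.prodMk hL)] at h1
  exact h1

section

variable {𝓕 : Filtration (Time T) m} {P : Measure Ω} [IsFiniteMeasure P] {L : Ω → ℝ}
  {Q : Time T → Ω → ProbabilityMeasure ℝ} {C : Time T → Ω → ℝ}

lemma measurable_lintegral_leftLaw (hQ : IsCadlagLaw 𝓕 P L Q)
    {H : (Time T × Ω) × ℝ → ℝ≥0∞} (hH : Measurable[𝓕.predictable.prod (borel ℝ)] H) :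
    Measurable[𝓕.predictable] fun p : Time T × Ω ↦ ∫⁻ x, H (p, x) ∂(leftLaw Q p.1 p.2) := by
  let K : @Kernel (Time T × Ω) ℝ 𝓕.predictable _ :=
    @Kernel.mk _ _ 𝓕.predictable _ (fun p ↦ leftLaw Q p.1 p.2) hQ.measurable_leftLaw
  have : @IsMarkovKernel _ _ 𝓕.predictable _ K :=
    @IsMarkovKernel.mk _ _ 𝓕.predictable _ K
      fun p ↦ inferInstanceAs (IsProbabilityMeasure (leftLaw Q p.1 p.2))
  exact @Measurable.lintegral_kernel_prod_right' _ _ 𝓕.predictable _ K _ H hH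

lemma measurable_prod_of_predictable {B : Type*} [MeasurableSpace B] {H : (Time T × Ω) × ℝ → B}
    (hH : Measurable[𝓕.predictable.prod (borel ℝ)] H) : Measurable H := by
  refine hH.mono ?_ le_rfl
  rw [← BorelSpace.measurable_eq (α := ℝ)]
  exact sup_le_sup (MeasurableSpace.comap_mono (predictable_le 𝓕)) le_rfl

/-- Integrals of predictable functions of `L` against a predictable increasing process may be
computed by means of the left limits of the conditional laws. -/
theorem lintegral_leftLaw_stieltjes (hL : Measurable L) (hQ : IsCadlagLaw 𝓕 P L Q)
    (hC : IsIncreasing 𝓕 C)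
    {H : (Time T × Ω) × ℝ → ℝ≥0∞} (hH : Measurable[𝓕.predictable.prod (borel ℝ)] H) :
    ∫⁻ ω, ∫⁻ s, ∫⁻ x, H ((s, ω), x) ∂(leftLaw Q s ω) ∂(stieltjes fun t ↦ C t ω) ∂P
      = ∫⁻ ω, ∫⁻ s, H ((s, ω), L ω) ∂(stieltjes fun t ↦ C t ω) ∂P := by
  have hH' := measurable_prod_of_predictable hH
  rw [hC.lintegral_lintegral_stieltjes (P := P)
      (G := fun p ↦ ∫⁻ x, H (p, x) ∂(leftLaw Q p.1 p.2))
      ((measurable_lintegral_leftLaw hQ hH).mono (predictable_le 𝓕) le_rfl),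
    hC.lintegral_lintegral_stieltjes (P := P) (G := fun p ↦ H (p, L p.2))
      (hH'.comp (measurable_id.prodMk (hL.comp measurable_snd)))]
  refine setLIntegral_congr_fun measurableSet_Ioi fun c hc ↦ ?_
  have hr : Measurable fun ω ↦ debut (fun t ↦ C t ω) c :=
    hC.measurable_debut.comp measurable_prodMk_left
  refine @lintegral_comp_law Ω m (Time T × Ω) 𝓕.predictable P _
    (fun ω ↦ (debut (fun t ↦ C t ω) c, ω))
    ((hr.prodMk measurable_id).mono le_rfl (predictable_le 𝓕))
    (fun p ↦ leftLaw Q p.1 p.2) (fun p ↦ inferInstance) hQ.measurable_leftLaw L hL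
    {ω | c ≤ C ⊤ ω} (fun E hE B hB ↦ ?_) H hH
  have hE' := predictable_le 𝓕 _ hE
  -- Cutting the predictable graph of the first passage time by the predictable set `E` leaves a
  -- predictable graph, over a smaller event.
  have h := hQ.law_leftLaw hL (Ω₀ := (fun ω ↦ (debut (fun t ↦ C t ω) c, ω)) ⁻¹' E ∩ {ω | c ≤ C ⊤ ω})
    hr ?_ (fun ω hω ↦ hC.debut_pos hc hω.2) (f := B.indicator 1) (measurable_one.indicator hB)
  · simp_rw [lintegral_indicator_one hB] at h
    rw [h]
    have : (fun ω ↦ B.indicator (1 : ℝ → ℝ≥0∞) (L ω)) = (L ⁻¹' B).indicator 1 := rfl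
    rw [this, lintegral_indicator_one (hL hB), Measure.restrict_apply (hL hB)]
  · convert! hE.inter (hC.measurableSet_graph_debut c) using 1
    ext ⟨t, ω⟩
    simp only [mem_ofPred_eq, mem_inter_iff, mem_preimage]
    constructor
    · rintro ⟨⟨h1, h2⟩, rfl⟩
      exact ⟨h1, h2, rfl⟩
    · rintro ⟨h1, h2, rfl⟩
      exact ⟨⟨h1, h2⟩, rfl⟩

end

/-! ### Integrals with respect to increasing predictable processes -/

lemma isCadlag_setIntegral {μ : Measure (Time T)} {f : Time T → ℝ} (hf : Integrable f μ) :
    IsCadlag fun t ↦ ∫ s in Ioc ⊥ t, f s ∂μ := by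
  have hi : ∀ t, ∫ s in Ioc ⊥ t, f s ∂μ = ∫ s, (Ioc ⊥ t).indicator f s ∂μ := fun t ↦
    (integral_indicator measurableSet_Ioc).symm
  have hb : ∀ (l : Filter (Time T)), ∀ᶠ t in l, ∀ᵐ s ∂μ, ‖(Ioc ⊥ t).indicator f s‖ ≤ ‖f s‖ :=
    fun l ↦ Eventually.of_forall fun t ↦ ae_of_all _ fun s ↦ norm_indicator_le_norm_self f s
  have hm : ∀ (l : Filter (Time T)), ∀ᶠ t in l, AEStronglyMeasurable ((Ioc ⊥ t).indicator f) μ :=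
    fun l ↦ Eventually.of_forall fun t ↦ hf.1.indicator measurableSet_Ioc
  simp_rw [hi]
  refine fun t ↦ ⟨?_, ∫ s, (Ioo ⊥ t).indicator f s ∂μ, ?_⟩
  · refine tendsto_integral_filter_of_dominated_convergence (fun s ↦ ‖f s‖) (hm _) (hb _) hf.norm
      (ae_of_all _ fun s ↦ tendsto_const_nhds.congr' ?_)
    rcases le_or_gt s t with h | h
    · filter_upwards [self_mem_nhdsWithin] with u hu
      have : s ≤ u := h.trans hu
      simp [indicator, h, this]
    · filter_upwards [nhdsWithin_le_nhds (Iio_mem_nhds h)] with u hu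
      simp [indicator, not_le.2 h, not_le.2 (mem_Iio.1 hu)]
  · refine tendsto_integral_filter_of_dominated_convergence (fun s ↦ ‖f s‖) (hm _) (hb _) hf.norm
      (ae_of_all _ fun s ↦ tendsto_const_nhds.congr' ?_)
    rcases lt_or_ge s t with h | h
    · filter_upwards [nhdsWithin_le_nhds (Ioi_mem_nhds h)] with u hu
      simp [indicator, h, (mem_Ioi.1 hu).le]
    · filter_upwards [self_mem_nhdsWithin] with u hu
      simp [indicator, not_lt.2 h, not_le.2 (lt_of_lt_of_le (mem_Iio.1 hu) h)]

/-! ### Predictability of integrals against `dC`. -/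

lemma isPiSystem_predictable (𝓕 : Filtration (Time T) m) :
    IsPiSystem ({s | ∃ A, MeasurableSet[𝓕 ⊥] A ∧ s = {(⊥ : Time T)} ×ˢ A} ∪
      {s | ∃ i A, MeasurableSet[𝓕 i] A ∧ s = Ioi i ×ˢ A}) := by
  rintro _ (⟨A, hA, rfl⟩ | ⟨i, A, hA, rfl⟩) _ (⟨B, hB, rfl⟩ | ⟨j, B, hB, rfl⟩) hne
  · exact Or.inl ⟨A ∩ B, hA.inter hB, by rw [prod_inter_prod, inter_self]⟩
  · obtain ⟨⟨t, ω⟩, ⟨ht, -⟩, ht', -⟩ := hne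
    simp only [mem_singleton_iff] at ht
    simp [ht] at ht'
  · obtain ⟨⟨t, ω⟩, ⟨ht', -⟩, ht, -⟩ := hne
    simp only [mem_singleton_iff] at ht
    simp [ht] at ht'
  · refine Or.inr ⟨max i j, A ∩ B, ?_, by rw [prod_inter_prod, Ioi_inter_Ioi]⟩
    exact (𝓕.mono (le_max_left i j) _ hA).inter (𝓕.mono (le_max_right i j) _ hB)

lemma measurable_indicator_Ioi {𝓕 : Filtration (Time T) m} {B : Type*} [MeasurableSpace B] [Zero B]
    {i : Time T} {f : Ω → B} (hf : Measurable[𝓕 i] f) :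
    Measurable[𝓕.predictable] ((Prod.fst ⁻¹' Ioi i).indicator fun p : Time T × Ω ↦ f p.2) := by
  intro s hs
  have h1 := measurable_fst_predictable 𝓕 (measurableSet_Ioi (a := i))
  have : (Prod.fst ⁻¹' Ioi i).indicator (fun p : Time T × Ω ↦ f p.2) ⁻¹' s
      = Ioi i ×ˢ (f ⁻¹' s) ∪ (Prod.fst ⁻¹' Ioi i)ᶜ ∩ {_p | (0 : B) ∈ s} := by
    ext ⟨t, ω⟩
    by_cases h : i < t <;> simp [indicator, h]
  rw [this]
  exact (measurableSet_predictable_Ioi_prod (hf hs)).union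
    (h1.compl.inter (@MeasurableSet.const _ 𝓕.predictable _))

lemma measurableSet_snd_predictable {𝓕 : Filtration (Time T) m} {A : Set Ω}
    (hA : MeasurableSet[𝓕 ⊥] A) : MeasurableSet[𝓕.predictable] {p : Time T × Ω | p.2 ∈ A} := by
  convert! (measurableSet_predictable_singleton_bot_prod hA).union
    (measurableSet_predictable_Ioi_prod (i := ⊥) hA) using 1
  ext ⟨t, ω⟩
  by_cases h : t = ⊥ <;> simp [h, bot_lt_iff_ne_bot]

/-- `[0, T] × Ω` with the predictable σ-algebra. -/
def PredictableSpace (_ : Filtration (Time T) m) : Type _ := Time T × Ω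

instance (𝓕 : Filtration (Time T) m) : MeasurableSpace (PredictableSpace 𝓕) := 𝓕.predictable

/-- The section of `[0, T] × Ω` at `ω`. -/
def predictableSection (𝓕 : Filtration (Time T) m) (ω : Ω) (s : Time T) : PredictableSpace 𝓕 :=
  (s, ω)

lemma measurable_predictableSection (𝓕 : Filtration (Time T) m) (ω : Ω) :
    Measurable (predictableSection 𝓕 ω) := fun E hE ↦
  measurable_prodMk_right (y := ω) (predictable_le 𝓕 E hE)

/-- The measure `1_{(0, t]}(s) dC_s(ω)`, on the section of `[0, T] × Ω` at `ω`. -/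
def sectionMeasure (𝓕 : Filtration (Time T) m) (C : Time T → Ω → ℝ) (t : Time T) (ω : Ω) :
    Measure (PredictableSpace 𝓕) :=
  ((stieltjes fun t ↦ C t ω).restrict (Ioc ⊥ t)).map (predictableSection 𝓕 ω)

instance (𝓕 : Filtration (Time T) m) (C : Time T → Ω → ℝ) (t : Time T) (ω : Ω) :
    IsFiniteMeasure (sectionMeasure 𝓕 C t ω) := by
  unfold sectionMeasure
  infer_instance

lemma measurable_of_eq {A B : Type*} {mA : MeasurableSpace A} {mB : MeasurableSpace B} {f g : A → B}
    (hf : Measurable f) (h : f = g) : Measurable g := h ▸ hf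

namespace IsIncreasing

section

variable {𝓕 : Filtration (Time T) m} {C : Time T → Ω → ℝ}

/-- On the generating π-system the measures are explicit predictable processes: `0` for `{⊥} ×ˢ A`,
and `1_A (C_t - C_i)⁺` for `Ioi i ×ˢ A`. Predictability of integrals then follows from the theory of
kernels. -/
lemma measurable_sectionMeasure (hC : IsIncreasing 𝓕 C) :
    Measurable[𝓕.predictable] fun p : Time T × Ω ↦ sectionMeasure 𝓕 C p.1 p.2 := by
  have happ : ∀ (t : Time T) (ω : Ω) (E : Set (PredictableSpace 𝓕)), MeasurableSet E →
      sectionMeasure 𝓕 C t ω E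
        = stieltjes (fun t ↦ C t ω) (predictableSection 𝓕 ω ⁻¹' E ∩ Ioc ⊥ t) := fun t ω E hE ↦ by
    rw [sectionMeasure, Measure.map_apply (measurable_predictableSection 𝓕 ω) hE,
      Measure.restrict_apply (measurable_predictableSection 𝓕 ω hE)]
  refine @Measurable.measure_of_isPiSystem (Time T × Ω) (PredictableSpace 𝓕) 𝓕.predictable _ _ _ _
    rfl (isPiSystem_predictable 𝓕) ?_ ?_
  · rintro _ (⟨A, hA, rfl⟩ | ⟨i, A, hA, rfl⟩)
    · refine measurable_of_eq (@measurable_const _ _ _ 𝓕.predictable (0 : ℝ≥0∞)) ?_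
      ext ⟨t, ω⟩
      refine Eq.trans ?_ (happ t ω _ (measurableSet_predictable_singleton_bot_prod hA)).symm
      refine (measure_mono_null (t := {⊥}) ?_ (stieltjes_bot _)).symm
      rintro s ⟨⟨h, -⟩, -⟩
      exact h
    · have hA1 : Measurable[𝓕 i] (A.indicator fun _ ↦ (1 : ℝ)) := measurable_const.indicator hA
      have h1 := measurable_indicator_Ioi hA1
      have h2 : Measurable[𝓕.predictable] ((Prod.fst ⁻¹' Ioi i).indicator
          fun p : Time T × Ω ↦ C i p.2) := measurable_indicator_Ioi (hC.adapted i).measurable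
      refine measurable_of_eq (h1.mul (hC.predictable.sub h2)).ennreal_ofReal ?_
      ext ⟨t, ω⟩
      refine Eq.trans ?_ (happ t ω _ (measurableSet_predictable_Ioi_prod hA)).symm
      by_cases hω : ω ∈ A
      · have : predictableSection 𝓕 ω ⁻¹' (Ioi i ×ˢ A) ∩ Ioc ⊥ t = Ioc i t := by
          ext s
          exact ⟨fun h ↦ ⟨h.1.1, h.2.2⟩, fun h ↦ ⟨⟨h.1, hω⟩, bot_le.trans_lt h.1, h.2⟩⟩
        rw [this, stieltjes_Ioc (hC.rightCont ω) (hC.mono ω)]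
        by_cases hit : i < t
        · simp [indicator, hit, hω]
        · simpa [indicator, hit, hω] using hC.mono ω (not_lt.1 hit)
      · have : predictableSection 𝓕 ω ⁻¹' (Ioi i ×ˢ A) ∩ Ioc ⊥ t = ∅ := by
          ext s
          simp only [mem_inter_iff, mem_empty_iff_false, iff_false]
          exact fun h ↦ hω h.1.2
        rw [this]
        simp [indicator, hω]
  · refine measurable_of_eq hC.predictable.ennreal_ofReal ?_
    ext ⟨t, ω⟩
    refine Eq.trans ?_ (happ t ω _ MeasurableSet.univ).symm
    rw [preimage_univ, univ_inter, stieltjes_Ioc (hC.rightCont ω) (hC.mono ω), hC.zero, sub_zero]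

/-- The integral of a predictable process against a predictable increasing process is
predictable. -/
lemma measurable_setIntegral (hC : IsIncreasing 𝓕 C) {G : Time T × Ω → ℝ}
    (hG : Measurable[𝓕.predictable] G) :
    Measurable[𝓕.predictable] fun p : Time T × Ω ↦
      ∫ s in Ioc ⊥ p.1, G (s, p.2) ∂(stieltjes fun t ↦ C t p.2) := by
  let K : @Kernel (Time T × Ω) (PredictableSpace 𝓕) 𝓕.predictable _ :=
    @Kernel.mk _ _ 𝓕.predictable _ (fun p ↦ sectionMeasure 𝓕 C p.1 p.2) hC.measurable_sectionMeasure
  let G' : PredictableSpace 𝓕 → ℝ := G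
  have hG' : Measurable G' := hG
  have h := (StronglyMeasurable.integral_kernel (mα := 𝓕.predictable) (κ := K)
    hG'.stronglyMeasurable).measurable
  refine measurable_of_eq h ?_
  ext p
  exact integral_map (measurable_predictableSection 𝓕 p.2).aemeasurable
    hG'.stronglyMeasurable.aestronglyMeasurable

end

/-- Integrals of nonnegative predictable processes, when almost surely finite, are increasing
predictable processes. -/
lemma exists_integral {𝓕 : Filtration (Time T) m} {C : Time T → Ω → ℝ} {P : Measure Ω}
    (h𝓕 : UsualConditions 𝓕 P) (hC : IsIncreasing 𝓕 C) {φ : Time T × Ω → ℝ≥0∞}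
    (hφ : Measurable[𝓕.predictable] φ)
    (hfin : ∀ᵐ ω ∂P, ∫⁻ s, φ (s, ω) ∂(stieltjes fun t ↦ C t ω) < ∞) :
    ∃ Γ, IsIncreasing 𝓕 Γ ∧ ∀ᵐ ω ∂P, ∀ t,
      ENNReal.ofReal (Γ t ω) = ∫⁻ s in Ioc ⊥ t, φ (s, ω) ∂(stieltjes fun t ↦ C t ω) := by
  classical
  set N : Set Ω := {ω | ∫⁻ s, φ (s, ω) ∂(stieltjes fun t ↦ C t ω) < ∞} with hN
  have hNm : MeasurableSet[𝓕 ⊥] N := by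
    have := (h𝓕.null Nᶜ (ae_iff.1 hfin)).compl
    rwa [compl_compl] at this
  have hφm : ∀ ω, Measurable fun s ↦ φ (s, ω) := fun ω ↦
    (hφ.mono (predictable_le 𝓕) le_rfl).comp measurable_prodMk_right
  have hint : ∀ ω ∈ N, Integrable (fun s ↦ (φ (s, ω)).toReal) (stieltjes fun t ↦ C t ω) :=
    fun ω hω ↦ integrable_toReal_of_lintegral_ne_top (hφm ω).aemeasurable hω.ne
  refine ⟨fun t ω ↦ N.indicator
    (fun ω ↦ ∫ s in Ioc ⊥ t, (φ (s, ω)).toReal ∂(stieltjes fun t ↦ C t ω)) ω,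
    ⟨?_, fun ω ↦ ?_, fun ω ↦ ?_, fun ω ↦ ?_⟩, ?_⟩
  · have h1 := hC.measurable_setIntegral (G := fun p ↦ (φ p).toReal) hφ.ennreal_toReal
    exact h1.indicator (measurableSet_snd_predictable hNm)
  · by_cases hω : ω ∈ N <;> simp [hω]
  · by_cases hω : ω ∈ N
    · simp only [indicator_of_mem hω]
      intro s t hst
      exact setIntegral_mono_set (hint ω hω).integrableOn
        (ae_of_all _ fun _ ↦ ENNReal.toReal_nonneg) (Ioc_subset_Ioc_right hst).eventuallyLE
    · simp only [indicator_of_notMem hω]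
      exact monotone_const
  · by_cases hω : ω ∈ N
    · simp only [indicator_of_mem hω]
      exact fun t ↦ (isCadlag_setIntegral (hint ω hω) t).1
    · simp only [indicator_of_notMem hω]
      exact fun t ↦ continuousWithinAt_const
  · filter_upwards [hfin] with ω hω t
    rw [indicator_of_mem (show ω ∈ N from hω), ofReal_integral_eq_lintegral_ofReal
      (hint ω hω).integrableOn (ae_of_all _ fun _ ↦ ENNReal.toReal_nonneg)]
    refine lintegral_congr_ae (ae_restrict_of_ae ?_)
    filter_upwards [ae_lt_top (hφm ω) hω.ne] with s hs using ENNReal.ofReal_toReal hs.ne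

end IsIncreasing

/-! ### Local boundedness of increasing predictable processes -/

section

variable {𝓕 : Filtration (Time T) m} {P : Measure Ω}

/-- The infimum is below `a` exactly when some `S n` is, so right-continuity of the filtration
applies. -/
lemma exists_isStoppingTime_isGLB (h𝓕 : 𝓕.IsRightContinuous) {S : ℕ → Ω → WithTop (Time T)}
    (hS : ∀ n, IsStoppingTime 𝓕 (S n)) :
    ∃ σ, IsStoppingTime 𝓕 σ ∧ ∀ ω, IsGLB (range fun n ↦ S n ω) (σ ω) := by
  have hex : ∀ ω, ∃ u, IsGLB (range fun n ↦ S n ω) u := fun ω ↦ by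
    let := timeOrder (T := T)
    exact ⟨_, isGLB_ciInf (OrderBot.bddBelow _)⟩
  choose σ hσ using hex
  have hlt : ∀ a ω, σ ω < a ↔ ∃ n, S n ω < a := fun a ω ↦ by
    simpa using isGLB_lt_iff (hσ ω) (b := a)
  refine ⟨σ, @isStoppingTime_of_measurableSet_lt_of_isRightContinuous' _ _ _ timeOrder.toConditionallyCompleteLinearOrder _ _ _ 𝓕 σ h𝓕
    (fun i ↦ ?_) fun i hi ↦ ?_, hσ⟩
  · simp_rw [hlt, ofPred_exists]
    exact MeasurableSet.iUnion fun n ↦ (hS n).measurableSet_lt i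
  -- Only the final time has nothing to its right inside `[0, T]`. There, being at most `T` is the
  -- same as differing from the infinite value.
  · have hi' : i = ⊤ := by
      by_contra h
      have : (𝓝[>] i).NeBot := nhdsGT_neBot_of_exists_gt ⟨⊤, lt_top_iff_ne_top.2 h⟩
      exact this.ne hi
    subst hi'
    have h1 : ∀ a : WithTop (Time T), a ≤ ((⊤ : Time T) : WithTop (Time T)) ↔ a < ⊤ := fun a ↦ by
      induction a using WithTop.recTopCoe with
      | top => simp
      | coe a => simp
    have : {ω | σ ω = ((⊤ : Time T) : WithTop (Time T))}
        = (⋃ n, {ω | S n ω ≤ ((⊤ : Time T) : WithTop (Time T))}) \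
          ⋃ n, {ω | S n ω < ((⊤ : Time T) : WithTop (Time T))} := by
      ext ω
      simp only [mem_ofPred_eq, Set.mem_sdiff, mem_iUnion, h1]
      rw [← hlt, ← hlt, ← h1, not_lt]
      exact le_antisymm_iff
    rw [this]
    exact (MeasurableSet.iUnion fun n ↦ hS n ⊤).diff
      (MeasurableSet.iUnion fun n ↦ (hS n).measurableSet_lt ⊤)

variable [IsFiniteMeasure P]

/-- One announcing time `d n`, moved back by its notice `δ n`, remains a stopping time and is
strictly before `r` where the announcement succeeds. For `n` large, `{d n ≠ ⊤}` exceeds the event of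
success by little probability. -/
lemma exists_isStoppingTime_lt_of_predictable {Ω₀ : Set Ω} {r : Ω → Time T} (hr : Measurable r)
    (hG : MeasurableSet[𝓕.predictable] {p : Time T × Ω | p.2 ∈ Ω₀ ∧ p.1 = r p.2})
    (hpos : ∀ ω ∈ Ω₀, ⊥ < r ω) {ε : ℝ≥0∞} (hε : ε ≠ 0) :
    ∃ S, IsStoppingTime 𝓕 S ∧ P (Ω₀ \ {ω | S ω < r ω}) ≤ ε ∧ P ({ω | S ω < ⊤} \ Ω₀) ≤ ε := by
  classical
  obtain ⟨δ, d, hδ, hδ0, hfin, hd, hPε, hK, htop⟩ := exists_announcing (P := P) hr hG hε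
  set K : Set Ω := {ω | ∀ n, d n ω ≠ ⊤} with hKdef
  have hdm : ∀ n, MeasurableSet {ω | d n ω = ⊤} := fun n ↦ by
    have : {ω | d n ω = ⊤} = (⋃ f ∈ ((↑) : Time T → WithTop (Time T)) ⁻¹' range (d n),
        {ω | d n ω = f})ᶜ := by
      ext ω
      simp only [mem_ofPred_eq, mem_compl_iff, mem_iUnion, exists_prop, not_exists, not_and]
      refine ⟨fun h f _ ↦ by simp [h], fun h ↦ ?_⟩
      by_contra hne
      obtain ⟨e, he⟩ := WithTop.ne_top_iff_exists.1 hne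
      exact h e ⟨ω, he.symm⟩ he.symm
    rw [this]
    exact (MeasurableSet.biUnion ((hfin n).preimage WithTop.coe_injective.injOn).countable
      fun f _ ↦ 𝓕.le _ _ (hd n f)).compl
  have hKm : MeasurableSet K := by
    have : K = ⋂ n, {ω | d n ω = ⊤}ᶜ := by ext; simp [K]
    rw [this]
    exact MeasurableSet.iInter fun n ↦ (hdm n).compl
  have hlim : Tendsto (fun n ↦ P ({ω | d n ω = ⊤}ᶜ \ K)) atTop (𝓝 (P ∅)) := by
    refine tendsto_measure_of_tendsto_indicator_of_isFiniteMeasure atTop P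
      (fun n ↦ (hdm n).compl.diff hKm) fun ω ↦ ?_
    by_cases hω : ω ∈ K
    · simp [hω]
    · filter_upwards [htop ω (by simpa [K] using hω)] with n hn
      simp [hn]
  rw [measure_empty] at hlim
  obtain ⟨n, hn⟩ := (hlim.eventually_lt_const (pos_iff_ne_zero.2 hε)).exists
  refine ⟨fun ω ↦ (d n ω).map fun f ↦ shiftBack f (δ n), fun t ↦ ?_, ?_, ?_⟩
  · have : {ω | (d n ω).map (fun f ↦ shiftBack f (δ n)) ≤ t} =
        ⋃ f ∈ ((↑) : Time T → WithTop (Time T)) ⁻¹' range (d n),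
          ({ω | d n ω = f} ∩ {_ω | shiftBack f (δ n) ≤ t}) := by
      ext ω
      simp only [mem_ofPred_eq, mem_iUnion, exists_prop, mem_inter_iff]
      constructor
      · intro h
        induction h' : d n ω using WithTop.recTopCoe with
        | top => simp [h'] at h
        | coe e =>
          rw [h'] at h
          exact ⟨e, ⟨ω, h'⟩, rfl, WithTop.coe_le_coe.1 h⟩
      · rintro ⟨f, -, h1, h2⟩
        rw [h1]
        exact WithTop.coe_le_coe.2 h2
    rw [this]
    refine MeasurableSet.biUnion ((hfin n).preimage WithTop.coe_injective.injOn).countable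
      fun f _ ↦ ?_
    by_cases hf : shiftBack f (δ n) ≤ t
    · simpa [hf] using 𝓕.mono hf _ (hd n f)
    · simp [hf]
  · refine (measure_mono ?_).trans hPε
    rintro ω ⟨hω, hω'⟩
    refine ⟨hω, fun hωK ↦ hω' ?_⟩
    obtain ⟨-, e, he, -⟩ := hK ω hωK
    change (d n ω).map (fun f ↦ shiftBack f (δ n)) < r ω
    rw [(he n).1]
    refine WithTop.coe_lt_coe.2 ?_
    rcases (he n).2.eq_or_lt with h | h
    · rw [h]
      exact shiftBack_lt (hpos ω hω) (hδ n)
    · exact (shiftBack_le _ _).trans_lt h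
  · refine (measure_mono ?_).trans hn.le
    rintro ω ⟨hω, hω'⟩
    refine ⟨fun h ↦ ?_, fun hωK ↦ hω' (hK ω hωK).1⟩
    rw [mem_ofPred_eq] at h hω
    simp [h] at hω

/-- Increasing predictable processes are locally bounded. -/
theorem IsIncreasing.exists_bounded (h𝓕 : 𝓕.IsRightContinuous) {Γ : Time T → Ω → ℝ}
    (hΓ : IsIncreasing 𝓕 Γ) {ε : ℝ≥0∞} (hε : ε ≠ 0) :
    ∃ S, IsStoppingTime 𝓕 S ∧ P {ω | S ω < ⊤} ≤ ε ∧
      ∃ k : ℝ, ∀ᵐ ω ∂P, ∀ t, Γ (stopAt S t ω) ω ≤ k := by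
  have hε2 : ε / 2 ≠ 0 := (ENNReal.half_pos hε).ne'
  obtain ⟨k, hk⟩ : ∃ k : ℕ, P {ω | (k : ℝ) + 1 ≤ Γ ⊤ ω} ≤ ε / 2 := by
    have hlim : Tendsto (fun k : ℕ ↦ P {ω | (k : ℝ) + 1 ≤ Γ ⊤ ω}) atTop (𝓝 (P ∅)) := by
      refine tendsto_measure_of_tendsto_indicator_of_isFiniteMeasure atTop P
        (fun n ↦ measurableSet_le measurable_const (hΓ.measurable ⊤)) fun ω ↦ ?_
      obtain ⟨N, hN⟩ := exists_nat_gt (Γ ⊤ ω)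
      filter_upwards [eventually_ge_atTop N] with n hn
      have : (N : ℝ) ≤ n := by exact_mod_cast hn
      simp only [mem_empty_iff_false, iff_false]
      change ¬ ((n : ℝ) + 1 ≤ Γ ⊤ ω)
      linarith
    rw [measure_empty] at hlim
    obtain ⟨k, hk⟩ := (hlim.eventually_lt_const (pos_iff_ne_zero.2 hε2)).exists
    exact ⟨k, hk.le⟩
  set c : ℝ := k + 1
  have hc : 0 < c := by positivity
  set Ω₀ : Set Ω := {ω | c ≤ Γ ⊤ ω}
  set r : Ω → Time T := fun ω ↦ debut (fun t ↦ Γ t ω) c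
  -- Announcements of the first passage `r` are taken with summable errors. Their infimum precedes
  -- `r` strictly almost everywhere on `Ω₀`, since the errors tend to `0`, and stops elsewhere with
  -- small probability, since they are summable. Strictness matters: a jump of `Γ` at `r` is
  -- avoided.
  obtain ⟨ε', hε', hsum⟩ := ENNReal.exists_pos_sum_of_countable' hε2 ℕ
  choose S hS hS1 hS2 using fun n ↦ exists_isStoppingTime_lt_of_predictable (P := P) (Ω₀ := Ω₀)
    (r := r) (hΓ.measurable_debut.comp measurable_prodMk_left) (hΓ.measurableSet_graph_debut c)
    (fun ω hω ↦ hΓ.debut_pos hc hω) (hε' n).ne'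
  obtain ⟨σ, hσ, hσglb⟩ := exists_isStoppingTime_isGLB h𝓕 hS
  have hlt : ∀ a ω, σ ω < a ↔ ∃ n, S n ω < a := fun a ω ↦ by
    simpa using isGLB_lt_iff (hσglb ω) (b := a)
  refine ⟨σ, hσ, ?_, c, ?_⟩
  · calc P {ω | σ ω < ⊤} ≤ P (Ω₀ ∪ ⋃ n, {ω | S n ω < ⊤} \ Ω₀) := by
          refine measure_mono fun ω hω ↦ ?_
          obtain ⟨n, hn⟩ := (hlt _ _).1 hω
          by_cases h : ω ∈ Ω₀
          · exact Or.inl h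
          · exact Or.inr (mem_iUnion.2 ⟨n, hn, h⟩)
      _ ≤ P Ω₀ + ∑' n, P ({ω | S n ω < ⊤} \ Ω₀) :=
        (measure_union_le _ _).trans (add_le_add le_rfl (measure_iUnion_le _))
      _ ≤ ε / 2 + ∑' n, ε' n := add_le_add hk (ENNReal.tsum_le_tsum hS2)
      _ ≤ ε / 2 + ε / 2 := add_le_add le_rfl hsum.le
      _ = ε := ENNReal.add_halves ε
  · have hnull : P (Ω₀ \ {ω | σ ω < r ω}) = 0 := by
      have hε0 : Tendsto ε' atTop (𝓝 0) :=
        ENNReal.tendsto_atTop_zero_of_tsum_ne_top (hsum.trans_le le_top).ne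
      refine le_antisymm (ge_of_tendsto' hε0 fun n ↦ (measure_mono ?_).trans (hS1 n)) zero_le
      exact sdiff_subset_sdiff_right fun ω hω ↦ (hlt _ _).2 ⟨n, hω⟩
    filter_upwards [measure_eq_zero_iff_ae_notMem.1 hnull] with ω hω t
    by_cases h : ω ∈ Ω₀
    · have h1 : σ ω < r ω := by
        by_contra h'
        exact hω ⟨h, h'⟩
      have h2 : stopAt σ t ω < r ω := WithTop.coe_lt_coe.1 ((coe_stopAt_le σ t ω).trans_lt h1)
      by_contra! h3
      exact absurd ((isLeast_debut (hΓ.rightCont ω) h).2 h3.le) (not_le.2 h2)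
    · exact (hΓ.mono ω le_top).trans (not_le.1 h).le

end

/-! ### Integrability of the drift -/

/-- A time `t` exceeds `τ` exactly when some `q` of a countable dense set satisfies `τ ≤ q < t`. -/
lemma measurableSet_le_stoppingTime {𝓕 : Filtration (Time T) m} {τ : Ω → WithTop (Time T)}
    (hτ : IsStoppingTime 𝓕 τ) :
    MeasurableSet[𝓕.predictable] {p : Time T × Ω | (p.1 : WithTop (Time T)) ≤ τ p.2} := by
  obtain ⟨D, hDc, hD⟩ := TopologicalSpace.exists_countable_dense (Time T)
  have : {p : Time T × Ω | (p.1 : WithTop (Time T)) ≤ τ p.2}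
      = (⋃ q ∈ D, Ioi q ×ˢ {ω | τ ω ≤ q})ᶜ := by
    ext ⟨t, ω⟩
    simp only [mem_ofPred_eq, mem_compl_iff, mem_iUnion, mem_prod, mem_Ioi, exists_prop, not_exists,
      not_and, not_le]
    refine ⟨fun h q _ hq ↦ (WithTop.coe_lt_coe.2 hq).trans_le h, fun h ↦ ?_⟩
    by_contra! hlt
    obtain ⟨u, hu⟩ := WithTop.ne_top_iff_exists.1 (hlt.trans_le le_top).ne
    rw [← hu, WithTop.coe_lt_coe] at hlt
    obtain ⟨q, hqD, h1, h2⟩ := hD.exists_between hlt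
    refine absurd (h q hqD h2) (not_lt.2 ?_)
    rw [← hu]
    exact WithTop.coe_le_coe.2 h1.le
  rw [this]
  exact (MeasurableSet.biUnion hDc fun q _ ↦ measurableSet_predictable_Ioi_prod (hτ q)).compl

lemma le_stopAt_top_iff {τ : Ω → WithTop (Time T)} {s : Time T} {ω : Ω} :
    s ≤ stopAt τ ⊤ ω ↔ (s : WithTop (Time T)) ≤ τ ω := by
  rw [← WithTop.coe_le_coe, coe_stopAt, le_min_iff]
  exact and_iff_right (WithTop.coe_le_coe.2 le_top)

lemma integral_eq_toReal_sub {A : Type*} {mA : MeasurableSpace A} {μ : Measure A} {f : A → ℝ}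
    (hf : Measurable f) (hfin : ∫⁻ x, ‖f x‖ₑ ∂μ < ∞) :
    ∫ x, f x ∂μ = (∫⁻ x, ENNReal.ofReal (f x) ∂μ).toReal
      - (∫⁻ x, ENNReal.ofReal (-f x) ∂μ).toReal :=
  integral_eq_lintegral_pos_part_sub_lintegral_neg_part ⟨hf.aestronglyMeasurable, hfin⟩

section

variable {𝓕 : Filtration (Time T) m} {P : Measure Ω} [IsFiniteMeasure P] {L : Ω → ℝ}
  {Q : Time T → Ω → ProbabilityMeasure ℝ} {C : Time T → Ω → ℝ}

/-- Positive and negative parts are treated separately. Finiteness along `L` passes to the side of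
the left limit laws by the nonnegative identity itself. -/
theorem integral_leftLaw_stieltjes (hL : Measurable L) (hQ : IsCadlagLaw 𝓕 P L Q)
    (hC : IsIncreasing 𝓕 C)
    {h : (Time T × Ω) × ℝ → ℝ} (hh : Measurable[𝓕.predictable.prod (borel ℝ)] h)
    (hfin : ∫⁻ ω, ∫⁻ s, ‖h ((s, ω), L ω)‖ₑ ∂(stieltjes fun t ↦ C t ω) ∂P < ∞) :
    Integrable (fun ω ↦ ∫ s, h ((s, ω), L ω) ∂(stieltjes fun t ↦ C t ω)) P ∧
    ∫ ω, ∫ s, ∫ x, h ((s, ω), x) ∂(leftLaw Q s ω) ∂(stieltjes fun t ↦ C t ω) ∂P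
      = ∫ ω, ∫ s, h ((s, ω), L ω) ∂(stieltjes fun t ↦ C t ω) ∂P := by
  have hh' := measurable_prod_of_predictable hh
  have hhx : ∀ p, Measurable fun x ↦ h (p, x) := fun p ↦ hh'.comp measurable_prodMk_left
  have hhs : ∀ ω, Measurable fun s ↦ h ((s, ω), L ω) := fun ω ↦
    hh'.comp ((measurable_id.prodMk measurable_const).prodMk measurable_const)
  have hLH : ∀ H : (Time T × Ω) × ℝ → ℝ≥0∞, Measurable H →
      Measurable fun ω ↦ ∫⁻ s, H ((s, ω), L ω) ∂(stieltjes fun t ↦ C t ω) := fun H hH ↦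
    hC.measurable_lintegral (G := fun p ↦ H (p, L p.2))
      (hH.comp (measurable_id.prodMk (hL.comp measurable_snd)))
  have hinner : ∀ H : (Time T × Ω) × ℝ → ℝ≥0∞, Measurable[𝓕.predictable.prod (borel ℝ)] H →
      Measurable fun p : Time T × Ω ↦ ∫⁻ x, H (p, x) ∂(leftLaw Q p.1 p.2) := fun H hH ↦
    (measurable_lintegral_leftLaw hQ hH).mono (predictable_le 𝓕) le_rfl
  have hQH : ∀ H : (Time T × Ω) × ℝ → ℝ≥0∞, Measurable[𝓕.predictable.prod (borel ℝ)] H →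
      Measurable fun ω ↦ ∫⁻ s, ∫⁻ x, H ((s, ω), x) ∂(leftLaw Q s ω) ∂(stieltjes fun t ↦ C t ω) :=
    fun H hH ↦ hC.measurable_lintegral (hinner H hH)
  have hpos := hh.ennreal_ofReal
  have hneg : Measurable[𝓕.predictable.prod (borel ℝ)] fun p ↦ ENNReal.ofReal (-h p) :=
    ENNReal.measurable_ofReal.comp (measurable_neg.comp hh)
  have hneg' : Measurable fun p ↦ ENNReal.ofReal (-h p) :=
    ENNReal.measurable_ofReal.comp (measurable_neg.comp hh')
  have hnorm : Measurable[𝓕.predictable.prod (borel ℝ)] fun p ↦ ‖h p‖ₑ := measurable_enorm.comp hh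
  have hfin' := (lintegral_leftLaw_stieltjes hL hQ hC hnorm).trans_lt hfin
  have hneg_le : ∀ p, ENNReal.ofReal (-h p) ≤ ‖h p‖ₑ := fun p ↦ by
    simpa using Real.ofReal_le_enorm (-h p)
  have hV : ∀ H : (Time T × Ω) × ℝ → ℝ≥0∞, (∀ p, H p ≤ ‖h p‖ₑ) →
      ∫⁻ ω, ∫⁻ s, H ((s, ω), L ω) ∂(stieltjes fun t ↦ C t ω) ∂P < ∞ := fun H hH ↦
    (lintegral_mono fun ω ↦ lintegral_mono fun s ↦ hH _).trans_lt hfin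
  have e1 : ∀ᵐ ω ∂P, ∫ s, h ((s, ω), L ω) ∂(stieltjes fun t ↦ C t ω)
      = (∫⁻ s, ENNReal.ofReal (h ((s, ω), L ω)) ∂(stieltjes fun t ↦ C t ω)).toReal
        - (∫⁻ s, ENNReal.ofReal (-h ((s, ω), L ω)) ∂(stieltjes fun t ↦ C t ω)).toReal := by
    filter_upwards [ae_lt_top (hLH _ hh'.enorm) hfin.ne] with ω hω
    exact integral_eq_toReal_sub (hhs ω) hω
  have e2 : ∀ᵐ ω ∂P, ∫ s, ∫ x, h ((s, ω), x) ∂(leftLaw Q s ω) ∂(stieltjes fun t ↦ C t ω)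
      = (∫⁻ s, ∫⁻ x, ENNReal.ofReal (h ((s, ω), x)) ∂(leftLaw Q s ω)
          ∂(stieltjes fun t ↦ C t ω)).toReal
        - (∫⁻ s, ∫⁻ x, ENNReal.ofReal (-h ((s, ω), x)) ∂(leftLaw Q s ω)
          ∂(stieltjes fun t ↦ C t ω)).toReal := by
    filter_upwards [ae_lt_top (hQH _ hnorm) hfin'.ne] with ω hω
    have hsec : ∀ H : (Time T × Ω) × ℝ → ℝ≥0∞, Measurable[𝓕.predictable.prod (borel ℝ)] H →
        Measurable fun s ↦ ∫⁻ x, H ((s, ω), x) ∂(leftLaw Q s ω) := fun H hH ↦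
      (hinner H hH).comp measurable_prodMk_right
    have hlt : ∀ H : (Time T × Ω) × ℝ → ℝ≥0∞, (∀ p, H p ≤ ‖h p‖ₑ) →
        ∫⁻ s, ∫⁻ x, H ((s, ω), x) ∂(leftLaw Q s ω) ∂(stieltjes fun t ↦ C t ω) < ∞ := fun H hH ↦
      (lintegral_mono fun s ↦ lintegral_mono fun x ↦ hH _).trans_lt hω
    have hp := hlt (fun p ↦ ENNReal.ofReal (h p)) fun p ↦ Real.ofReal_le_enorm _
    have hn := hlt (fun p ↦ ENNReal.ofReal (-h p)) hneg_le
    rw [← integral_toReal (hsec _ hpos).aemeasurable (ae_lt_top (hsec _ hpos) hp.ne),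
      ← integral_toReal (hsec _ hneg).aemeasurable (ae_lt_top (hsec _ hneg) hn.ne),
      ← integral_sub (integrable_toReal_of_lintegral_ne_top (hsec _ hpos).aemeasurable hp.ne)
        (integrable_toReal_of_lintegral_ne_top (hsec _ hneg).aemeasurable hn.ne)]
    refine integral_congr_ae ?_
    filter_upwards [ae_lt_top (hsec _ hnorm) hω.ne] with s hs
    exact integral_eq_toReal_sub (hhx _) hs
  have hVp := hV (fun p ↦ ENNReal.ofReal (h p)) fun p ↦ Real.ofReal_le_enorm _
  have hVn := hV (fun p ↦ ENNReal.ofReal (-h p)) hneg_le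
  have hUp := (lintegral_leftLaw_stieltjes hL hQ hC hpos).trans_lt hVp
  have hUn := (lintegral_leftLaw_stieltjes hL hQ hC hneg).trans_lt hVn
  have mVp := hLH _ hh'.ennreal_ofReal
  have mVn := hLH _ hneg'
  have mUp := hQH _ hpos
  have mUn := hQH _ hneg
  refine ⟨((integrable_toReal_of_lintegral_ne_top mVp.aemeasurable hVp.ne).sub
    (integrable_toReal_of_lintegral_ne_top mVn.aemeasurable hVn.ne)).congr
    (e1.mono fun ω hω ↦ hω.symm), ?_⟩
  rw [integral_congr_ae e1, integral_congr_ae e2,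
    integral_sub (integrable_toReal_of_lintegral_ne_top mVp.aemeasurable hVp.ne)
    (integrable_toReal_of_lintegral_ne_top mVn.aemeasurable hVn.ne),
    integral_sub (integrable_toReal_of_lintegral_ne_top mUp.aemeasurable hUp.ne)
    (integrable_toReal_of_lintegral_ne_top mUn.aemeasurable hUn.ne),
    integral_toReal mVp.aemeasurable (ae_lt_top mVp hVp.ne),
    integral_toReal mVn.aemeasurable (ae_lt_top mVn hVn.ne),
    integral_toReal mUp.aemeasurable (ae_lt_top mUp hUp.ne),
    integral_toReal mUn.aemeasurable (ae_lt_top mUn hUn.ne)]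
  congr 2
  · exact lintegral_leftLaw_stieltjes hL hQ hC hpos
  · exact lintegral_leftLaw_stieltjes hL hQ hC hneg

variable {α : Time T → ℝ → Ω → ℝ}

lemma measurable_indicator_Ioi_comp {β : Type*} [MeasurableSpace β] [Zero β]
    {h : (Time T × Ω) × ℝ → β} (hh : Measurable[𝓕.predictable.prod (borel ℝ)] h)
    {E : Set (Time T × Ω)} (hE : MeasurableSet[𝓕.predictable] E) (a : ℝ) :
    Measurable[𝓕.predictable.prod (borel ℝ)] ((E ×ˢ Ioi a).indicator h) :=
  hh.indicator (@MeasurableSet.prod _ _ 𝓕.predictable (borel ℝ) _ _ hE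
    (by rw [← BorelSpace.measurable_eq (α := ℝ)]; exact measurableSet_Ioi))

/-- The drift, up to a stopping time, is integrable on `{L > a}`. -/
lemma exists_stoppingTime_lintegral_lt_top (h𝓕 : UsualConditions 𝓕 P) (hL : Measurable L)
    (hQ : IsCadlagLaw 𝓕 P L Q) (hC : IsIncreasing 𝓕 C)
    (hα : Measurable[𝓕.predictable.prod (borel ℝ)] fun p : (Time T × Ω) × ℝ ↦ α p.1.1 p.2 p.1.2)
    {a : ℝ} (hint : ∀ᵐ ω ∂P, ∫⁻ s, ∫⁻ x in Ioi a, ‖α s x ω‖ₑ ∂(leftLaw Q s ω)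
      ∂(stieltjes fun u ↦ C u ω) < ∞) {ε : ℝ≥0∞} (hε : ε ≠ 0) :
    ∃ S, IsStoppingTime 𝓕 S ∧ P {ω | S ω < ⊤} ≤ ε ∧
      ∫⁻ ω in {ω | a < L ω}, ∫⁻ s in Ioc ⊥ (stopAt S ⊤ ω), ‖α s (L ω) ω‖ₑ
        ∂(stieltjes fun u ↦ C u ω) ∂P < ∞ := by
  have hΦ : Measurable[𝓕.predictable] fun p : Time T × Ω ↦
      ∫⁻ x in Ioi a, ‖α p.1 x p.2‖ₑ ∂(leftLaw Q p.1 p.2) := by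
    convert! measurable_lintegral_leftLaw hQ (measurable_indicator_Ioi_comp (measurable_enorm.comp hα)
      (@MeasurableSet.univ _ 𝓕.predictable) a) using 1
    ext p
    rw [← lintegral_indicator measurableSet_Ioi]
    refine lintegral_congr fun x ↦ ?_
    by_cases hx : a < x <;> simp [indicator, hx]
  -- The averaged absolute drift on `(a, ∞)` is increasing and predictable, hence bounded up to a
  -- stopping time; the disintegration turns this bound into one for `|α^L|` on `{L > a}`.
  obtain ⟨Γ, hΓ, hΓi⟩ := hC.exists_integral h𝓕 hΦ hint
  obtain ⟨S, hS, hSP, k, hk⟩ := hΓ.exists_bounded (P := P) h𝓕.rightCont hε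
  refine ⟨S, hS, hSP, ?_⟩
  have hE := measurableSet_le_stoppingTime hS
  have hLa : MeasurableSet {ω | a < L ω} := hL measurableSet_Ioi
  have h1 := lintegral_leftLaw_stieltjes hL hQ hC (measurable_indicator_Ioi_comp (measurable_enorm.comp hα) hE a)
  have hIoc : ∀ ω (f : Time T → ℝ≥0∞), ∫⁻ s in Ioc ⊥ (stopAt S ⊤ ω), f s ∂(stieltjes fun u ↦ C u ω)
      = ∫⁻ s, {s : Time T | (s : WithTop (Time T)) ≤ S ω}.indicator f s
        ∂(stieltjes fun u ↦ C u ω) := fun ω f ↦ by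
    have : {s : Time T | (s : WithTop (Time T)) ≤ S ω} = Iic (stopAt S ⊤ ω) := by
      ext s
      exact le_stopAt_top_iff.symm
    rw [this, lintegral_indicator measurableSet_Iic, ← restrict_stieltjes_Ioc_bot_top,
      Measure.restrict_restrict measurableSet_Ioc, Measure.restrict_restrict measurableSet_Iic]
    congr 2
    ext s
    simp [and_comm]
  calc ∫⁻ ω in {ω | a < L ω}, ∫⁻ s in Ioc ⊥ (stopAt S ⊤ ω), ‖α s (L ω) ω‖ₑ
        ∂(stieltjes fun u ↦ C u ω) ∂P
      = ∫⁻ ω, ∫⁻ s, ({p : Time T × Ω | (p.1 : WithTop (Time T)) ≤ S p.2} ×ˢ Ioi a).indicator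
          (fun p ↦ ‖α p.1.1 p.2 p.1.2‖ₑ) ((s, ω), L ω) ∂(stieltjes fun t ↦ C t ω) ∂P := by
        rw [← lintegral_indicator hLa]
        refine lintegral_congr fun ω ↦ ?_
        by_cases hω : a < L ω
        · rw [indicator_of_mem (show ω ∈ {ω | a < L ω} from hω), hIoc]
          refine lintegral_congr fun s ↦ ?_
          by_cases hs : (s : WithTop (Time T)) ≤ S ω <;> simp [indicator, hs, hω]
        · rw [indicator_of_notMem (show ω ∉ {ω | a < L ω} from hω)]
          simp [indicator, hω]
    _ = ∫⁻ ω, ∫⁻ s in Ioc ⊥ (stopAt S ⊤ ω), ∫⁻ x in Ioi a, ‖α s x ω‖ₑ ∂(leftLaw Q s ω)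
          ∂(stieltjes fun u ↦ C u ω) ∂P := by
        refine h1.symm.trans (lintegral_congr fun ω ↦ ?_)
        rw [hIoc]
        refine lintegral_congr fun s ↦ ?_
        by_cases hs : (s : WithTop (Time T)) ≤ S ω
        · rw [indicator_of_mem (show s ∈ {s : Time T | (s : WithTop (Time T)) ≤ S ω} from hs),
            ← lintegral_indicator measurableSet_Ioi]
          refine lintegral_congr fun x ↦ ?_
          by_cases hx : a < x <;> simp [indicator, hx, hs]
        · rw [indicator_of_notMem (show s ∉ {s : Time T | (s : WithTop (Time T)) ≤ S ω} from hs)]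
          simp [indicator, hs]
    _ ≤ ∫⁻ ω, ENNReal.ofReal k ∂P := by
        refine lintegral_mono_ae ?_
        filter_upwards [hk, hΓi] with ω h1 h2
        rw [← h2]
        exact ENNReal.ofReal_le_ofReal (h1 ⊤)
    _ < ∞ := by simpa using ENNReal.mul_lt_top ENNReal.ofReal_lt_top (measure_lt_top P _)

/-- On `{L > a}` the drift can only fail to be integrable where the stopping time is finite, an
event of arbitrarily small probability. The events `{L > -n}` cover the whole space. -/
theorem ae_integrable_drift (h𝓕 : UsualConditions 𝓕 P) (hL : Measurable L)
    (hQ : IsCadlagLaw 𝓕 P L Q) (hC : IsIncreasing 𝓕 C)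
    (hα : Measurable[𝓕.predictable.prod (borel ℝ)] fun p : (Time T × Ω) × ℝ ↦ α p.1.1 p.2 p.1.2)
    (hint : ∀ a : ℝ, ∀ᵐ ω ∂P, ∫⁻ s, ∫⁻ x in Ioi a, ‖α s x ω‖ₑ ∂(leftLaw Q s ω)
      ∂(stieltjes fun u ↦ C u ω) < ∞) :
    ∀ᵐ ω ∂P, Integrable (fun s ↦ α s (L ω) ω) (stieltjes fun u ↦ C u ω) := by
  have hα' := measurable_prod_of_predictable hα
  have hαL : Measurable fun p : Time T × Ω ↦ α p.1 (L p.2) p.2 :=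
    hα'.comp (measurable_id.prodMk (hL.comp measurable_snd))
  have key : ∀ a : ℝ, ∀ᵐ ω ∂P, a < L ω →
      ∫⁻ s, ‖α s (L ω) ω‖ₑ ∂(stieltjes fun u ↦ C u ω) < ∞ := by
    intro a
    rw [ae_iff]
    refine le_antisymm (le_of_forall_pos_le_add fun ε hε ↦ ?_) zero_le
    rw [zero_add]
    obtain ⟨S, hS, hSP, hfin⟩ := exists_stoppingTime_lintegral_lt_top h𝓕 hL hQ hC hα (hint a) hε.ne'
    have hm : Measurable fun ω ↦ ∫⁻ s in Ioc ⊥ (stopAt S ⊤ ω), ‖α s (L ω) ω‖ₑ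
        ∂(stieltjes fun u ↦ C u ω) := by
      have hE := predictable_le 𝓕 _ (measurableSet_le_stoppingTime hS)
      refine measurable_of_eq (hC.measurable_lintegral ((hαL.enorm.indicator hE).indicator
        ((measurableSet_singleton ⊥).compl.prod MeasurableSet.univ))) ?_
      ext ω
      rw [← lintegral_indicator measurableSet_Ioc]
      refine lintegral_congr fun s ↦ ?_
      simp only [indicator, mem_prod, mem_compl_iff, mem_singleton_iff, mem_univ, and_true,
        mem_ofPred_eq, mem_Ioc, bot_lt_iff_ne_bot, le_stopAt_top_iff]
      split_ifs <;> tauto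
    have h1 := ae_lt_top hm hfin.ne
    rw [ae_restrict_iff' (show MeasurableSet {ω | a < L ω} from hL measurableSet_Ioi)] at h1
    refine (measure_mono_ae ?_).trans hSP
    filter_upwards [h1] with ω hω hbad
    by_contra hS'
    refine hbad fun hLa ↦ ?_
    have h2 := hω hLa
    have h3 : S ω = ⊤ := top_le_iff.1 (not_lt.1 hS')
    rwa [stopAt_of_le (h3 ▸ le_top), restrict_stieltjes_Ioc_bot_top] at h2
  have hall : ∀ᵐ ω ∂P, ∀ n : ℕ, (-n : ℝ) < L ω →
      ∫⁻ s, ‖α s (L ω) ω‖ₑ ∂(stieltjes fun u ↦ C u ω) < ∞ := ae_all_iff.2 fun n ↦ key _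
  filter_upwards [hall] with ω hω
  obtain ⟨n, hn⟩ := exists_nat_gt (-L ω)
  exact ⟨(hαL.comp measurable_prodMk_right).aestronglyMeasurable, hω n (by linarith)⟩

end

/-! ### Increments of the martingale part on `{L > a}` -/

lemma IsIncreasing.stronglyMeasurable_integral {𝓕 : Filtration (Time T) m} {C : Time T → Ω → ℝ}
    (hC : IsIncreasing 𝓕 C) {G : Time T × Ω → ℝ} (hG : Measurable G) :
    StronglyMeasurable fun ω ↦ ∫ s, G (s, ω) ∂(stieltjes fun t ↦ C t ω) := by
  have h1 : Measurable fun p : Ω × ℝ ↦ (Ioc 0 (C ⊤ p.1)).indicator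
      (fun c ↦ G (debut (fun t ↦ C t p.1) c, p.1)) p.2 := by
    have h : Measurable fun p : Ω × ℝ ↦ G (debut (fun t ↦ C t p.1) p.2, p.1) :=
      hG.comp ((hC.measurable_debut.comp measurable_swap).prodMk measurable_fst)
    exact h.indicator ((measurableSet_lt measurable_const measurable_snd).inter
      (measurableSet_le measurable_snd ((hC.measurable ⊤).comp measurable_fst)))
  convert h1.stronglyMeasurable.integral_prod_right' (ν := volume) using 1
  ext ω
  have hm : Measurable (debut fun t ↦ C t ω) := hC.measurable_debut.comp measurable_prodMk_right
  have hG' : Measurable fun s ↦ G (s, ω) := hG.comp measurable_prodMk_right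
  rw [← hC.map_debut ω, integral_map hm.aemeasurable hG'.aestronglyMeasurable, ← integral_indicator measurableSet_Ioc]

lemma measurable_stopAt {𝓕 : Filtration (Time T) m} {τ : Ω → WithTop (Time T)}
    (hτ : IsStoppingTime 𝓕 τ) (t : Time T) : Measurable (stopAt τ t) :=
  (measurable_stoppingTime (isStoppingTime_stopAt hτ t) fun ω ↦ stopAt_le τ t ω).mono (𝓕.le t) le_rfl

lemma le_stopAt_iff {τ : Ω → WithTop (Time T)} {u t : Time T} {ω : Ω} :
    u ≤ stopAt τ t ω ↔ u ≤ t ∧ (u : WithTop (Time T)) ≤ τ ω := by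
  rw [← WithTop.coe_le_coe, coe_stopAt, le_min_iff, WithTop.coe_le_coe]

lemma stopAt_congr {τ τ' : Ω → WithTop (Time T)} {ω : Ω} (h : τ ω = τ' ω) (t : Time T) :
    stopAt τ t ω = stopAt τ' t ω := by simp [stopAt, h]

lemma stopAt_mono_left {τ τ' : Ω → WithTop (Time T)} {ω : Ω} (h : τ ω ≤ τ' ω) (t : Time T) :
    stopAt τ t ω ≤ stopAt τ' t ω := by
  rw [← WithTop.coe_le_coe, coe_stopAt, coe_stopAt]
  exact min_le_min le_rfl h

lemma stopped_stopAt (τ : Ω → WithTop (Time T)) (X : Time T → Ω → ℝ) (t : Time T) (ω : Ω) :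
    stopped τ X (stopAt τ t ω) ω = stopped τ X t ω := by
  simp only [stopped, indicator, stopAt_of_le (coe_stopAt_le τ t ω)]

section

variable {𝓕 : Filtration (Time T) m} {P : Measure Ω} [IsFiniteMeasure P] {L : Ω → ℝ}
  {Q : Time T → Ω → ProbabilityMeasure ℝ} {C : Time T → Ω → ℝ} {α : Time T → ℝ → Ω → ℝ}

lemma measurable_drift (hL : Measurable L) (hC : IsIncreasing 𝓕 C)
    (hα : Measurable[𝓕.predictable.prod (borel ℝ)] fun p : (Time T × Ω) × ℝ ↦ α p.1.1 p.2 p.1.2)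
    {r r' : Ω → Time T} (hr : Measurable r) (hr' : Measurable r') :
    StronglyMeasurable fun ω ↦ ∫ u in Ioc (r ω) (r' ω), α u (L ω) ω ∂(stieltjes fun t ↦ C t ω) := by
  have hαL : Measurable fun p : Time T × Ω ↦ α p.1 (L p.2) p.2 :=
    (measurable_prod_of_predictable hα).comp (measurable_id.prodMk (hL.comp measurable_snd))
  have h := hC.stronglyMeasurable_integral (hαL.indicator
    ((measurableSet_lt (hr.comp measurable_snd) measurable_fst).inter
      (measurableSet_le measurable_fst (hr'.comp measurable_snd))))
  convert h using 1
  ext ω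
  rw [← integral_indicator measurableSet_Ioc]
  rfl

lemma measurable_lintegral_drift (hL : Measurable L) (hC : IsIncreasing 𝓕 C)
    (hα : Measurable[𝓕.predictable.prod (borel ℝ)] fun p : (Time T × Ω) × ℝ ↦ α p.1.1 p.2 p.1.2)
    {r r' : Ω → Time T} (hr : Measurable r) (hr' : Measurable r') :
    Measurable fun ω ↦ ∫⁻ u in Ioc (r ω) (r' ω), ‖α u (L ω) ω‖ₑ ∂(stieltjes fun t ↦ C t ω) := by
  have hαL : Measurable fun p : Time T × Ω ↦ ‖α p.1 (L p.2) p.2‖ₑ :=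
    ((measurable_prod_of_predictable hα).comp
      (measurable_id.prodMk (hL.comp measurable_snd))).enorm
  refine measurable_of_eq (hC.measurable_lintegral (hαL.indicator
    ((measurableSet_lt (hr.comp measurable_snd) measurable_fst).inter
      (measurableSet_le measurable_fst (hr'.comp measurable_snd))))) ?_
  ext ω
  rw [← lintegral_indicator measurableSet_Ioc]
  rfl

/-- A dominating variable for the drift up to `σ`. -/
lemma exists_bound_drift (hL : Measurable L) (hC : IsIncreasing 𝓕 C)
    (hα : Measurable[𝓕.predictable.prod (borel ℝ)] fun p : (Time T × Ω) × ℝ ↦ α p.1.1 p.2 p.1.2)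
    {σ : Ω → WithTop (Time T)} (hσ : IsStoppingTime 𝓕 σ) {R : Set Ω}
    (hfin : ∫⁻ ω in R, ∫⁻ s in Ioc ⊥ (stopAt σ ⊤ ω), ‖α s (L ω) ω‖ₑ
      ∂(stieltjes fun u ↦ C u ω) ∂P < ∞) :
    ∃ F : Ω → ℝ, IntegrableOn F R P ∧ ∀ᵐ ω ∂(P.restrict R),
      IntegrableOn (fun u ↦ α u (L ω) ω) (Ioc ⊥ (stopAt σ ⊤ ω)) (stieltjes fun t ↦ C t ω) ∧
      ∀ u v, v ≤ stopAt σ ⊤ ω →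
        ‖∫ u in Ioc u v, α u (L ω) ω ∂(stieltjes fun t ↦ C t ω)‖ ≤ F ω := by
  have hαL : Measurable fun p : Time T × Ω ↦ α p.1 (L p.2) p.2 :=
    (measurable_prod_of_predictable hα).comp (measurable_id.prodMk (hL.comp measurable_snd))
  have hm := measurable_lintegral_drift hL hC hα measurable_const (measurable_stopAt hσ ⊤)
    (r := fun _ ↦ ⊥)
  refine ⟨_, integrable_toReal_of_lintegral_ne_top hm.aemeasurable hfin.ne, ?_⟩
  filter_upwards [ae_lt_top hm hfin.ne] with ω hω
  refine ⟨⟨(hαL.comp measurable_prodMk_right).aestronglyMeasurable, hω⟩, fun u v hv ↦ ?_⟩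
  have h : ‖∫ u in Ioc u v, α u (L ω) ω ∂(stieltjes fun t ↦ C t ω)‖ₑ
      ≤ ∫⁻ u in Ioc ⊥ (stopAt σ ⊤ ω), ‖α u (L ω) ω‖ₑ ∂(stieltjes fun t ↦ C t ω) :=
    (enorm_integral_le_lintegral_enorm _).trans (lintegral_mono_set (Ioc_subset_Ioc bot_le hv))
  simpa using ENNReal.toReal_mono hω.ne h

/-- Conditioning at the stopping time `r` replaces the indicator of `{L > a}` by the tail of `Q_r`,
as `N_r` and `S` are known at `r`. -/
lemma setIntegral_tail (h𝓕 : UsualConditions 𝓕 P) (hL : Measurable L)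
    (hQ : IsCadlagLaw 𝓕 P L Q) {N : Time T → Ω → ℝ} (hN : Martingale N 𝓕 P)
    (hc : ∀ᵐ ω ∂P, ∀ t, ContinuousWithinAt (fun t ↦ N t ω) (Ici t) t) {r : Ω → Time T}
    (hr : IsStoppingTime 𝓕 fun ω ↦ (r ω : WithTop (Time T))) {S : Set Ω}
    (hS : MeasurableSet[hr.measurableSpace] S) (a : ℝ) :
    Integrable (fun ω ↦ N (r ω) ω) P ∧ Integrable (fun ω ↦ tail Q a (r ω) ω * N (r ω) ω) P ∧
    ∫ ω in S ∩ {ω | a < L ω}, N (r ω) ω ∂P = ∫ ω in S, tail Q a (r ω) ω * N (r ω) ω ∂P := by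
  have hS' := hr.measurableSpace_le _ hS
  have hNi : Integrable (fun ω ↦ N (r ω) ω) P := integrable_condExp.congr
    (martingale_stopped_ae_eq_condExp h𝓕 hN hc hr (t := ⊤) fun ω ↦ le_top).symm
  obtain ⟨Y, hY, hNY⟩ := measurable_stopped h𝓕 hN.1 hc hr
  have hQr := hQ.measurable_stopped hr
  have htail : Measurable fun ω ↦ tail Q a (r ω) ω :=
    ((Measure.measurable_coe measurableSet_Ioi).comp
      (hQr.mono hr.measurableSpace_le le_rfl)).ennreal_toReal
  have h := (hQ.law_stopped h𝓕 hL hr).integral_mul hr.measurableSpace_le hL hQr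
    (measurableSet_Ioi (a := a)) (X := S.indicator fun ω ↦ N (r ω) ω)
    ⟨S.indicator Y, (hY.indicator hS).stronglyMeasurable, ?_⟩ (hNi.indicator hS')
  · refine ⟨hNi, ?_, ?_⟩
    · refine hNi.bdd_mul (c := 1) htail.aestronglyMeasurable (ae_of_all _ fun ω ↦ ?_)
      rw [tail, Real.norm_of_nonneg measureReal_nonneg]
      exact measureReal_le_one
    · rw [← integral_indicator hS', ← integral_indicator
        (hS'.inter (show MeasurableSet {ω | a < L ω} from hL measurableSet_Ioi))]
      refine Eq.trans (integral_congr_ae (ae_of_all _ fun ω ↦ ?_))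
        (h.trans (integral_congr_ae (ae_of_all _ fun ω ↦ ?_)))
      · by_cases h1 : ω ∈ S <;> by_cases h2 : a < L ω <;> simp [indicator, h1, h2]
      · by_cases h1 : ω ∈ S
        · simp [indicator, h1, tail, mul_comm]
        · simp [indicator, h1]
  · filter_upwards [hNY] with ω hω
    simp only [indicator, hω]

/-- The central computation: `setIntegral_tail` introduces the tails, the martingale `W` exchanges
the increments of `tail · N` for those of the tail integral, and the disintegration turns the latter
into the drift along `L`. -/
lemma setIntegral_stopped_eq_drift (h𝓕 : UsualConditions 𝓕 P) (hL : Measurable L)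
    (hQ : IsCadlagLaw 𝓕 P L Q) (hC : IsIncreasing 𝓕 C)
    (hα : Measurable[𝓕.predictable.prod (borel ℝ)] fun p : (Time T × Ω) × ℝ ↦ α p.1.1 p.2 p.1.2)
    {a : ℝ} (hint : ∀ᵐ ω ∂P, ∫⁻ s, ∫⁻ x in Ioi a, ‖α s x ω‖ₑ ∂(leftLaw Q s ω)
      ∂(stieltjes fun u ↦ C u ω) < ∞) {N W : Time T → Ω → ℝ} (hN : Martingale N 𝓕 P)
    (hNc : ∀ᵐ ω ∂P, ∀ t, ContinuousWithinAt (fun t ↦ N t ω) (Ici t) t) (hW : Martingale W 𝓕 P)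
    (hWc : ∀ᵐ ω ∂P, ∀ t, ContinuousWithinAt (fun t ↦ W t ω) (Ici t) t)
    {ρ : Ω → WithTop (Time T)} (hρ : IsStoppingTime 𝓕 ρ)
    (hWN : ∀ᵐ ω ∂P, ∀ u : Time T, ⊥ < ρ ω → (u : WithTop (Time T)) ≤ ρ ω →
      W u ω = tail Q a u ω * N u ω - tailIntegral Q C α a u ω)
    (hfin : ∫⁻ ω in {ω | a < L ω}, ∫⁻ u in Ioc ⊥ (stopAt ρ ⊤ ω), ‖α u (L ω) ω‖ₑ
      ∂(stieltjes fun t ↦ C t ω) ∂P < ∞) {s t : Time T} (hst : s ≤ t) {B : Set Ω}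
    (hB : MeasurableSet[𝓕 s] B) :
    ∫ ω in B ∩ {ω | a < L ω}, (N (stopAt ρ t ω) ω - N (stopAt ρ s ω) ω) ∂P
      = ∫ ω in B ∩ {ω | a < L ω}, ∫ u in Ioc (stopAt ρ s ω) (stopAt ρ t ω), α u (L ω) ω
        ∂(stieltjes fun t ↦ C t ω) ∂P := by
  have hLa : MeasurableSet {ω | a < L ω} := hL measurableSet_Ioi
  -- Both increments vanish on `{ρ ≤ s}`. On the remaining event `ρ > 0`, as required by `hWN`:
  -- localized processes are set to zero where the stopping time is `0`.
  set S : Set Ω := B ∩ {ω | (s : WithTop (Time T)) < ρ ω} with hSdef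
  have hSs : MeasurableSet[𝓕 s] S := hB.inter (measurableSet_lt_stoppingTime hρ s)
  have hSm : MeasurableSet S := 𝓕.le _ _ hSs
  have hBm : MeasurableSet B := 𝓕.le _ _ hB
  have hred : ∀ f : Ω → ℝ, (∀ ω, ρ ω ≤ s → f ω = 0) →
      ∫ ω in B ∩ {ω | a < L ω}, f ω ∂P = ∫ ω in S ∩ {ω | a < L ω}, f ω ∂P := fun f hf ↦ by
    refine setIntegral_eq_of_subset_of_forall_sdiff_eq_zero (hBm.inter hLa)
      (fun ω hω ↦ ⟨hω.1.1, hω.2⟩) fun ω hω ↦ hf ω ?_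
    by_contra h
    exact hω.2 ⟨⟨hω.1.1, not_le.1 h⟩, hω.1.2⟩
  rw [hred _ fun ω hω ↦ by rw [stopAt_eq_of_le hst hω, sub_self],
    hred _ fun ω hω ↦ by rw [stopAt_eq_of_le hst hω, Ioc_self, setIntegral_empty]]
  obtain ⟨it, jt, et⟩ := setIntegral_tail h𝓕 hL hQ hN hNc (isStoppingTime_stopAt hρ t)
    (measurableSet_inter_lt_stopAt hρ hst hB) a
  obtain ⟨is, js, es⟩ := setIntegral_tail h𝓕 hL hQ hN hNc (isStoppingTime_stopAt hρ s)
    (measurableSet_inter_lt_stopAt hρ le_rfl hB) a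
  have wt := integrable_stopAt h𝓕 hW hWc hρ t
  have ws := integrable_stopAt h𝓕 hW hWc hρ s
  have ew : ∫ ω in S, (W (stopAt ρ t ω) ω - W (stopAt ρ s ω) ω) ∂P = 0 := by
    rw [integral_sub wt.integrableOn ws.integrableOn, setIntegral_stopAt h𝓕 hW hWc hρ hst hB,
      setIntegral_stopAt h𝓕 hW hWc hρ le_rfl hB, sub_self]
  rw [integral_sub it.integrableOn is.integrableOn, et, es,
    ← integral_sub jt.integrableOn js.integrableOn, ← sub_zero (∫ ω in S, _ ∂P), ← ew,
    ← integral_sub (f := fun ω ↦ tail Q a (stopAt ρ t ω) ω * N (stopAt ρ t ω) ω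
        - tail Q a (stopAt ρ s ω) ω * N (stopAt ρ s ω) ω)
      (g := fun ω ↦ W (stopAt ρ t ω) ω - W (stopAt ρ s ω) ω)
      (jt.sub js).integrableOn (wt.sub ws).integrableOn]
  -- the predictable set on which the integrands are considered
  let E : Set (Time T × Ω) := Ioc s t ×ˢ S ∩ {p | (p.1 : WithTop (Time T)) ≤ ρ p.2}
  have hE : MeasurableSet[𝓕.predictable] E := (measurableSet_predictable_prod measurableSet_Ioc
    Ioc_subset_Ioi_self hSs).inter (measurableSet_le_stoppingTime hρ)
  have hEsec : ∀ ω ∈ S, ∀ u, (u, ω) ∈ E ↔ u ∈ Ioc (stopAt ρ s ω) (stopAt ρ t ω) := by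
    intro ω hω u
    have hω' : (s : WithTop (Time T)) < ρ ω := hω.2
    rw [stopAt_of_le hω'.le]
    simp only [E, mem_inter_iff, mem_prod, hω, and_true, mem_ofPred_eq, mem_Ioc, and_assoc]
    rw [le_stopAt_iff]
  have hEsec' : ∀ ω ∉ S, ∀ u, (u, ω) ∉ E := fun ω hω u h ↦ hω h.1.2
  have hsm : ∀ ω, MeasurableSet {u : Time T | (u, ω) ∈ E} := fun ω ↦
    measurable_prodMk_right (predictable_le 𝓕 _ hE)
  let h : (Time T × Ω) × ℝ → ℝ := (E ×ˢ Ioi a).indicator fun p ↦ α p.1.1 p.2 p.1.2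
  have hh : Measurable[𝓕.predictable.prod (borel ℝ)] h := measurable_indicator_Ioi_comp hα hE a
  have hhL : ∀ ω u, h ((u, ω), L ω) = {ω | a < L ω}.indicator (fun _ ↦
      {u : Time T | (u, ω) ∈ E}.indicator (fun u ↦ α u (L ω) ω) u) ω := fun ω u ↦ by
    by_cases h1 : (u, ω) ∈ E <;> by_cases h2 : a < L ω <;> simp [h, indicator, h1, h2]
  have hhx : ∀ ω u, ∫ x, h ((u, ω), x) ∂(leftLaw Q u ω) = {u : Time T | (u, ω) ∈ E}.indicator
      (fun u ↦ ∫ x in Ioi a, α u x ω ∂(leftLaw Q u ω)) u := fun ω u ↦ by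
    by_cases h1 : (u, ω) ∈ E
    · rw [indicator_of_mem (show u ∈ {u : Time T | (u, ω) ∈ E} from h1),
        ← integral_indicator measurableSet_Ioi]
      refine integral_congr_ae (ae_of_all _ fun x ↦ ?_)
      by_cases h2 : a < x <;> simp [h, indicator, h1, h2]
    · rw [indicator_of_notMem (show u ∉ {u : Time T | (u, ω) ∈ E} from h1)]
      simp [h, h1]
  have hsub : ∀ ω, {u : Time T | (u, ω) ∈ E} ⊆ Ioc ⊥ (stopAt ρ ⊤ ω) := fun ω u hu ↦
    ⟨bot_le.trans_lt hu.1.1.1, le_stopAt_top_iff.2 hu.2⟩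
  have hhfin : ∫⁻ ω, ∫⁻ u, ‖h ((u, ω), L ω)‖ₑ ∂(stieltjes fun t ↦ C t ω) ∂P < ∞ := by
    refine lt_of_le_of_lt ?_ hfin
    rw [← lintegral_indicator hLa]
    refine lintegral_mono fun ω ↦ ?_
    by_cases hω : a < L ω
    · rw [indicator_of_mem (show ω ∈ {ω | a < L ω} from hω), ← lintegral_indicator measurableSet_Ioc]
      refine lintegral_mono fun u ↦ ?_
      rw [hhL, indicator_of_mem (show ω ∈ {ω | a < L ω} from hω), enorm_indicator_eq_indicator_enorm]
      exact indicator_le_indicator_of_subset (hsub ω) (fun _ ↦ zero_le) u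
    · simp [hhL, hω]
  obtain ⟨-, heq⟩ := integral_leftLaw_stieltjes hL hQ hC hh hhfin
  have hleft : ∀ ω, ∫ u, ∫ x, h ((u, ω), x) ∂(leftLaw Q u ω) ∂(stieltjes fun t ↦ C t ω)
      = S.indicator (fun ω ↦ ∫ u in Ioc (stopAt ρ s ω) (stopAt ρ t ω),
        ∫ x in Ioi a, α u x ω ∂(leftLaw Q u ω) ∂(stieltjes fun t ↦ C t ω)) ω := fun ω ↦ by
    simp_rw [hhx]
    rw [integral_indicator (hsm ω)]
    by_cases hω : ω ∈ S
    · rw [indicator_of_mem hω]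
      congr 2
      ext u
      exact hEsec ω hω u
    · rw [indicator_of_notMem hω]
      have : {u : Time T | (u, ω) ∈ E} = ∅ := by
        ext u
        simpa using hEsec' ω hω u
      rw [this, setIntegral_empty]
  have hright : ∀ ω, ∫ u, h ((u, ω), L ω) ∂(stieltjes fun t ↦ C t ω)
      = (S ∩ {ω | a < L ω}).indicator (fun ω ↦ ∫ u in Ioc (stopAt ρ s ω) (stopAt ρ t ω),
        α u (L ω) ω ∂(stieltjes fun t ↦ C t ω)) ω := fun ω ↦ by
    simp_rw [hhL]
    by_cases h1 : ω ∈ S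
    · by_cases h2 : a < L ω
      · rw [indicator_of_mem (show ω ∈ S ∩ {ω | a < L ω} from ⟨h1, h2⟩)]
        simp only [indicator_of_mem (show ω ∈ {ω | a < L ω} from h2)]
        rw [integral_indicator (hsm ω)]
        congr 2
        ext u
        exact hEsec ω h1 u
      · simp [indicator, h2]
    · simp [indicator, h1, hEsec' ω h1]
  simp_rw [hleft, hright] at heq
  rw [integral_indicator hSm, integral_indicator (hSm.inter hLa)] at heq
  rw [← heq]
  refine setIntegral_congr_ae hSm ?_
  filter_upwards [hWN, hint] with ω h1 h2 hω
  have hpos : ⊥ < ρ ω := bot_le.trans_lt hω.2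
  have hle : stopAt ρ s ω ≤ stopAt ρ t ω := monotone_stopAt ρ ω hst
  have hi : Integrable (fun u ↦ ∫ x in Ioi a, α u x ω ∂(leftLaw Q u ω))
      (stieltjes fun t ↦ C t ω) := by
    refine ⟨?_, (lintegral_mono fun u ↦ enorm_integral_le_lintegral_enorm _).trans_lt h2⟩
    let K : Kernel (Time T) ℝ := ⟨fun u ↦ leftLaw Q u ω,
      (hQ.measurable_leftLaw.mono (predictable_le 𝓕) le_rfl).comp measurable_prodMk_right⟩
    have : IsMarkovKernel K := ⟨fun u ↦ inferInstanceAs (IsProbabilityMeasure (leftLaw Q u ω))⟩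
    have hm : Measurable fun p : Time T × ℝ ↦ (Ioi a).indicator (fun x ↦ α p.1 x ω) p.2 := by
      have h3 : Measurable fun p : Time T × ℝ ↦ α p.1 p.2 ω :=
        (measurable_prod_of_predictable hα).comp
          ((measurable_fst.prodMk measurable_const).prodMk measurable_snd)
      exact h3.indicator (measurable_snd measurableSet_Ioi)
    convert! (hm.stronglyMeasurable.integral_kernel_prod_right' (κ := K)).aestronglyMeasurable
      using 2 with u
    exact (integral_indicator measurableSet_Ioi).symm
  rw [h1 _ hpos (coe_stopAt_le ρ t ω), h1 _ hpos (coe_stopAt_le ρ s ω), tailIntegral, tailIntegral,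
    ← Ioc_union_Ioc_eq_Ioc bot_le hle, setIntegral_union (Ioc_disjoint_Ioc_of_le le_rfl)
    measurableSet_Ioc hi.integrableOn hi.integrableOn]
  ring

end

section

variable {𝓕 : Filtration (Time T) m} {P : Measure Ω} [IsFiniteMeasure P] {L : Ω → ℝ}
  {Q : Time T → Ω → ProbabilityMeasure ℝ} {C : Time T → Ω → ℝ} {α : Time T → ℝ → Ω → ℝ}

lemma IsCadlag.rightContinuous {f : Time T → ℝ} (h : IsCadlag f) (t : Time T) :
    ContinuousWithinAt f (Ici t) t := (h t).1

/-- The value `⊤` is isolated above the final time `T`, so localizing times are eventually equal to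
it. -/
lemma eventually_eq_top {τ : ℕ → WithTop (Time T)} (h : Tendsto τ atTop (𝓝 ⊤)) :
    ∀ᶠ n in atTop, τ n = ⊤ := by
  filter_upwards [h.eventually_const_lt (WithTop.coe_lt_top (⊤ : Time T))] with n hn
  induction h' : τ n using WithTop.recTopCoe with
  | top => rfl
  | coe u =>
    rw [h', WithTop.coe_lt_coe] at hn
    exact absurd hn not_top_lt

/-- The increments of the stopped martingale, averaged over sets of `𝓕 s` intersected with
`{L > a}`, are those of the drift. -/
theorem setIntegral_stopped_sub (h𝓕 : UsualConditions 𝓕 P) (hL : Measurable L)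
    (hQ : IsCadlagLaw 𝓕 P L Q) (hC : IsIncreasing 𝓕 C)
    (hα : Measurable[𝓕.predictable.prod (borel ℝ)] fun p : (Time T × Ω) × ℝ ↦ α p.1.1 p.2 p.1.2)
    {a : ℝ} (hint : ∀ᵐ ω ∂P, ∫⁻ s, ∫⁻ x in Ioi a, ‖α s x ω‖ₑ ∂(leftLaw Q s ω)
      ∂(stieltjes fun u ↦ C u ω) < ∞) {M A : Time T → Ω → ℝ}
    (hMc : ∀ᵐ ω ∂P, IsCadlag fun t ↦ M t ω)
    (hA : IsLocalMartingale 𝓕 P fun t ω ↦ tail Q a t ω * M t ω - A t ω)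
    (hAt : ∀ᵐ ω ∂P, ∀ t, A t ω = tailIntegral Q C α a t ω)
    {σ : Ω → WithTop (Time T)} (hσ : IsStoppingTime 𝓕 σ) (hM : Martingale (stopped σ M) 𝓕 P)
    (hfin : ∫⁻ ω in {ω | a < L ω}, ∫⁻ u in Ioc ⊥ (stopAt σ ⊤ ω), ‖α u (L ω) ω‖ₑ
      ∂(stieltjes fun t ↦ C t ω) ∂P < ∞) {s t : Time T} (hst : s ≤ t) {B : Set Ω}
    (hB : MeasurableSet[𝓕 s] B) :
    ∫ ω in B ∩ {ω | a < L ω}, (stopped σ M t ω - stopped σ M s ω) ∂P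
      = ∫ ω in B ∩ {ω | a < L ω}, ∫ u in Ioc (stopAt σ s ω) (stopAt σ t ω), α u (L ω) ω
        ∂(stieltjes fun t ↦ C t ω) ∂P := by
  obtain ⟨hYc, τ, hτ, hY⟩ := hA
  simp_rw [stoppedProcess_indicator] at hY
  have hNc : ∀ᵐ ω ∂P, ∀ t, ContinuousWithinAt (fun t ↦ stopped σ M t ω) (Ici t) t :=
    hMc.mono fun ω hω ↦ rightContinuous_stopped' hω.rightContinuous
  -- The bracket process needs its own localizing sequence `τ`, unrelated to `σ`: the identity is
  -- proved up to `σ ∧ τ n`, which eventually equals `σ`.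
  have hρ : ∀ n, IsStoppingTime 𝓕 fun ω ↦ min (σ ω) (τ n ω) := fun n ↦ hσ.min (hτ.isStoppingTime n)
  have heq : ∀ᵐ ω ∂P, ∀ᶠ n in atTop, ∀ t, stopAt (fun ω ↦ min (σ ω) (τ n ω)) t ω = stopAt σ t ω := by
    filter_upwards [hτ.tendsto_top] with ω hω
    filter_upwards [eventually_eq_top hω] with n hn t
    exact stopAt_congr (by simp [hn]) t
  have hle : ∀ n t ω, stopAt (fun ω ↦ min (σ ω) (τ n ω)) t ω ≤ stopAt σ t ω := fun n t ω ↦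
    stopAt_mono_left (τ := fun ω ↦ min (σ ω) (τ n ω)) (min_le_left _ _) t
  have key : ∀ n, ∫ ω in B ∩ {ω | a < L ω}, (stopped σ M (stopAt (fun ω ↦ min (σ ω) (τ n ω)) t ω) ω
        - stopped σ M (stopAt (fun ω ↦ min (σ ω) (τ n ω)) s ω) ω) ∂P
      = ∫ ω in B ∩ {ω | a < L ω}, ∫ u in Ioc (stopAt (fun ω ↦ min (σ ω) (τ n ω)) s ω)
        (stopAt (fun ω ↦ min (σ ω) (τ n ω)) t ω), α u (L ω) ω ∂(stieltjes fun t ↦ C t ω) ∂P := by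
    intro n
    refine setIntegral_stopped_eq_drift h𝓕 hL hQ hC hα hint hM hNc (hY n)
      (hYc.mono fun ω hω ↦ rightContinuous_stopped' hω.rightContinuous) (hρ n) ?_ ?_ hst hB
    · filter_upwards [hAt] with ω hω u hu hule
      have h1 := lt_min_iff.1 hu
      have h2 := le_min_iff.1 hule
      rw [stopped_of_lt h1.2, stopped_of_lt h1.1, stopAt_of_le h2.1, stopAt_of_le h2.2, hω]
    · refine (lintegral_mono fun ω ↦ lintegral_mono_set ?_).trans_lt hfin
      exact Ioc_subset_Ioc_right (hle n ⊤ ω)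
  -- The stopped values are conditional expectations of one variable, so uniform integrability gives
  -- the limit on the martingale side; the drift side is dominated by `F`.
  have hlim : ∀ s', ∀ R : Set Ω, Tendsto (fun n ↦ ∫ ω in R,
      stopped σ M (stopAt (fun ω ↦ min (σ ω) (τ n ω)) s' ω) ω ∂P) atTop
      (𝓝 (∫ ω in R, stopped σ M s' ω ∂P)) := by
    intro s' R
    refine (tendsto_of_condExp (hM.integrable s')
      (fun n ↦ (isStoppingTime_stopAt (hρ n) s').measurableSpace_le) (fun n ↦
      martingale_stopped_ae_eq_condExp h𝓕 hM hNc (isStoppingTime_stopAt (hρ n) s')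
        fun ω ↦ stopAt_le _ s' ω) ?_).2 R
    filter_upwards [heq] with ω hω
    refine tendsto_const_nhds.congr' ?_
    filter_upwards [hω] with n hn
    rw [hn, stopped_stopAt]
  have hl := ((hlim t (B ∩ {ω | a < L ω})).sub (hlim s (B ∩ {ω | a < L ω}))).congr
    fun n ↦ (integral_sub
    (integrable_stopAt h𝓕 hM hNc (hρ n) t).integrableOn
    (integrable_stopAt h𝓕 hM hNc (hρ n) s).integrableOn).symm
  rw [← integral_sub (hM.integrable t).integrableOn (hM.integrable s).integrableOn] at hl
  refine tendsto_nhds_unique (hl.congr key) ?_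
  obtain ⟨F, hF, hFb⟩ := exists_bound_drift hL hC hα hσ hfin
  refine tendsto_integral_of_dominated_convergence F (fun n ↦ ?_)
    (hF.mono_set inter_subset_right) (fun n ↦ ?_) (ae_restrict_of_ae ?_)
  · exact (measurable_drift hL hC hα (measurable_stopAt (hρ n) s)
      (measurable_stopAt (hρ n) t)).aestronglyMeasurable
  · filter_upwards [ae_restrict_of_ae_restrict_of_subset inter_subset_right hFb] with ω hω
    exact hω.2 _ _ ((hle n t ω).trans (monotone_stopAt σ ω le_top))
  · filter_upwards [heq] with ω hω
    refine tendsto_const_nhds.congr' ?_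
    filter_upwards [hω] with n hn
    rw [hn, hn]

end

/-! ### The enlarged filtration -/

section

variable {𝓕 : Filtration (Time T) m} {P : Measure Ω} {L : Ω → ℝ}

lemma le_enlarge (hL : Measurable L) : 𝓕 ≤ enlarge 𝓕 L hL :=
  le_sup_left.trans (Filtration.le_rightCont _)

lemma measurable_enlarge (hL : Measurable L) (t : Time T) : Measurable[enlarge 𝓕 L hL t] L := by
  have h : MeasurableSpace.comap L inferInstance ≤ enlarge 𝓕 L hL t :=
    (le_sup_right (a := 𝓕 t)).trans (Filtration.le_rightCont
      (𝓕 ⊔ Filtration.const (Time T) (MeasurableSpace.comap L inferInstance) hL.comap_le) t)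
  exact fun s hs ↦ h _ ⟨s, hs, rfl⟩

lemma UsualConditions.enlarge (h𝓕 : UsualConditions 𝓕 P) (hL : Measurable L) :
    UsualConditions (enlarge 𝓕 L hL) P where
  rightCont := by
    unfold Enlargement.enlarge
    infer_instance
  null s hs := le_enlarge hL ⊥ s (h𝓕.null s hs)

lemma measurableSet_of_enlarge (hL : Measurable L) {s t : Time T} (hst : s < t) {A : Set Ω}
    (hA : MeasurableSet[enlarge 𝓕 L hL s] A) :
    MeasurableSet[𝓕 t ⊔ MeasurableSpace.comap L inferInstance] A := by
  rw [enlarge, Filtration.rightCont_eq_of_not_isMax _ (not_isMax_of_lt hst)] at hA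
  exact (iInf₂_le (f := fun j (_ : j > s) ↦
    (𝓕 ⊔ Filtration.const (Time T) (MeasurableSpace.comap L inferInstance) hL.comap_le) j) t hst)
    A hA

lemma IsStoppingTime.mono_filtration {𝓖 : Filtration (Time T) m} (h : 𝓕 ≤ 𝓖)
    {τ : Ω → WithTop (Time T)} (hτ : IsStoppingTime 𝓕 τ) : IsStoppingTime 𝓖 τ :=
  fun i ↦ h i _ (hτ i)

lemma IsIncreasing.mono_filtration {𝓖 : Filtration (Time T) m} (h : 𝓕 ≤ 𝓖) {C : Time T → Ω → ℝ}
    (hC : IsIncreasing 𝓕 C) : IsIncreasing 𝓖 C :=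
  ⟨hC.predictable.mono (predictable_mono h) le_rfl, hC.zero, hC.mono, hC.rightCont⟩

lemma isPiSystem_inter_Ioi (𝓐 : MeasurableSpace Ω) (L : Ω → ℝ) :
    IsPiSystem {A | ∃ B a, MeasurableSet[𝓐] B ∧ A = B ∩ {ω | a < L ω}} := by
  rintro _ ⟨B, a, hB, rfl⟩ _ ⟨B', a', hB', rfl⟩ -
  refine ⟨B ∩ B', max a a', hB.inter hB', ?_⟩
  ext ω
  simp only [mem_inter_iff, mem_ofPred_eq, max_lt_iff]
  tauto

lemma iUnion_neg_nat_lt (L : Ω → ℝ) : ⋃ n : ℕ, {ω | -(n : ℝ) < L ω} = univ := by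
  refine eq_univ_of_forall fun ω ↦ ?_
  obtain ⟨n, hn⟩ := exists_nat_gt (-L ω)
  exact mem_iUnion.2 ⟨n, by simpa [neg_lt] using hn⟩

/-- The set `B` itself is recovered from the half-lines by letting `a = -n` decrease. -/
lemma generateFrom_inter_Ioi (𝓐 : MeasurableSpace Ω) (L : Ω → ℝ) :
    𝓐 ⊔ MeasurableSpace.comap L inferInstance
      = .generateFrom {A | ∃ B a, MeasurableSet[𝓐] B ∧ A = B ∩ {ω | a < L ω}} := by
  refine le_antisymm (sup_le (fun B hB ↦ ?_) ?_) (MeasurableSpace.generateFrom_le ?_)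
  · have : B = ⋃ n : ℕ, B ∩ {ω | -(n : ℝ) < L ω} := by
      rw [← inter_iUnion, iUnion_neg_nat_lt, inter_univ]
    rw [this]
    exact MeasurableSet.iUnion fun n ↦ MeasurableSpace.measurableSet_generateFrom ⟨B, _, hB, rfl⟩
  · refine Measurable.comap_le (measurable_of_Ioi fun a ↦ ?_)
    refine MeasurableSpace.measurableSet_generateFrom ⟨univ, a, MeasurableSet.univ, ?_⟩
    rw [univ_inter]
    rfl
  · rintro _ ⟨B, a, hB, rfl⟩
    exact (le_sup_left (a := 𝓐) _ hB).inter (le_sup_right (a := 𝓐) _ ⟨Ioi a, measurableSet_Ioi, rfl⟩)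

/-- A function with zero integral over the sets `B ∩ {L > a}`. -/
lemma setIntegral_eq_zero_of_inter_Ioi {Ω : Type*} {𝓐 m : MeasurableSpace Ω} {P : Measure Ω}
    {L : Ω → ℝ} (h𝓐 : 𝓐 ≤ m) (hL : Measurable L)
    {f : Ω → ℝ} (hf : Integrable f P)
    (h : ∀ B, MeasurableSet[𝓐] B → ∀ a : ℝ, ∫ ω in B ∩ {ω | a < L ω}, f ω ∂P = 0) {A : Set Ω}
    (hA : MeasurableSet[𝓐 ⊔ MeasurableSpace.comap L inferInstance] A) : ∫ ω in A, f ω ∂P = 0 := by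
  have hle : 𝓐 ⊔ MeasurableSpace.comap L inferInstance ≤ m := sup_le h𝓐 hL.comap_le
  -- The π-system need not contain the whole space; its integral, needed for complements, is
  -- obtained by letting `a` tend to `-∞`.
  have huniv : ∫ ω, f ω ∂P = 0 := by
    have hmono : Monotone fun n : ℕ ↦ {ω | -(n : ℝ) < L ω} := by
      intro n k hnk ω hω
      have : (n : ℝ) ≤ k := by exact_mod_cast hnk
      have hω' : -(n : ℝ) < L ω := hω
      change -(k : ℝ) < L ω
      linarith
    have hlim := tendsto_setIntegral_of_monotone (μ := P) (f := f)
      (fun n : ℕ ↦ show MeasurableSet {ω | -(n : ℝ) < L ω} from hL measurableSet_Ioi) hmono hf.integrableOn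
    have h0 : ∀ n : ℕ, ∫ ω in {ω | -(n : ℝ) < L ω}, f ω ∂P = 0 := fun n ↦ by
      simpa using h univ MeasurableSet.univ (-(n : ℝ))
    rw [iUnion_neg_nat_lt, setIntegral_univ] at hlim
    exact tendsto_nhds_unique hlim (tendsto_const_nhds.congr fun n ↦ (h0 n).symm)
  induction A, hA using MeasurableSpace.induction_on_inter (generateFrom_inter_Ioi 𝓐 L)
    (isPiSystem_inter_Ioi 𝓐 L) with
  | empty => simp
  | basic A hA =>
    obtain ⟨B, a, hB, rfl⟩ := hA
    exact h B hB a
  | compl A hA ih =>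
    have := integral_add_compl (hle _ hA) hf
    rwa [ih, zero_add, huniv] at this
  | iUnion A hd hA ih =>
    rw [integral_iUnion (fun n ↦ hle _ (hA n)) hd hf.integrableOn]
    simp [ih]

end

/-! ### Martingales for the enlarged filtration -/

section

variable {𝓕 : Filtration (Time T) m} {P : Measure Ω} [IsFiniteMeasure P] {L : Ω → ℝ}
  {Q : Time T → Ω → ProbabilityMeasure ℝ} {C : Time T → Ω → ℝ} {α : Time T → ℝ → Ω → ℝ}

lemma stopped_compensated (M C : Time T → Ω → ℝ) (α : Time T → ℝ → Ω → ℝ) (L : Ω → ℝ)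
    (σ : Ω → WithTop (Time T)) (t : Time T) (ω : Ω) :
    stopped σ (compensated M C α L) t ω = stopped σ M t ω
      - ∫ u in Ioc ⊥ (stopAt σ t ω), α u (L ω) ω ∂(stieltjes fun t ↦ C t ω) := by
  by_cases h : ω ∈ {ω | ⊥ < σ ω}
  · simp only [stopped, indicator_of_mem h, compensated]
  · have hσ : σ ω = ⊥ := by simpa using h
    simp only [stopped, indicator_of_notMem h]
    rw [stopAt_of_ge (u := ⊥) hσ bot_le, Ioc_self, setIntegral_empty, sub_zero]

/-- Since `L` is known at time `0` in the enlarged filtration, `α^L` is predictable for it, and so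
is its integral. -/
lemma measurable_drift_enlarge (hL : Measurable L) (hC : IsIncreasing 𝓕 C)
    (hα : Measurable[𝓕.predictable.prod (borel ℝ)] fun p : (Time T × Ω) × ℝ ↦ α p.1.1 p.2 p.1.2)
    {σ : Ω → WithTop (Time T)} (hσ : IsStoppingTime 𝓕 σ) (t : Time T) :
    Measurable[enlarge 𝓕 L hL t] fun ω ↦ ∫ u in Ioc ⊥ (stopAt σ t ω), α u (L ω) ω
      ∂(stieltjes fun t ↦ C t ω) := by
  have h1 : Measurable[(enlarge 𝓕 L hL).predictable]
      fun p : Time T × Ω ↦ α p.1 (L p.2) p.2 := by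
    refine hα.comp (g := fun p : (Time T × Ω) × ℝ ↦ α p.1.1 p.2 p.1.2) (f := fun p ↦ (p, L p.2)) ?_
    refine @Measurable.prodMk _ (enlarge 𝓕 L hL).predictable _ _ 𝓕.predictable (borel ℝ) _ _ ?_ ?_
    · exact measurable_id.mono (predictable_mono (le_enlarge hL)) le_rfl
    · rw [← BorelSpace.measurable_eq (α := ℝ)]
      exact measurable_snd_predictable (measurable_enlarge hL ⊥)
  have h2 := (hC.mono_filtration (le_enlarge hL)).measurable_setIntegral h1
  have h3 : IsStronglyPredictable (enlarge 𝓕 L hL) fun t ω ↦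
      ∫ u in Ioc ⊥ t, α u (L ω) ω ∂(stieltjes fun t ↦ C t ω) := h2.stronglyMeasurable
  have hr := isStoppingTime_stopAt (IsStoppingTime.mono_filtration (le_enlarge hL) hσ) t
  exact (measurable_stoppedValue h3.isStronglyProgressive hr).mono
    (hr.measurableSpace_le_of_le_const fun ω ↦ WithTop.coe_le_coe.2 (stopAt_le σ t ω)) le_rfl

/-- The condition `hVI` says that cutting `V` by a half-line leaves a half-line. It covers both `V =
(-n, ∞)`, used for localization, and `V = ℝ`, used for the true martingale. -/
theorem martingale_indicator_stopped (h𝓕 : UsualConditions 𝓕 P) (hL : Measurable L)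
    (hQ : IsCadlagLaw 𝓕 P L Q) (hC : IsIncreasing 𝓕 C)
    (hα : Measurable[𝓕.predictable.prod (borel ℝ)] fun p : (Time T × Ω) × ℝ ↦ α p.1.1 p.2 p.1.2)
    (hint : ∀ a : ℝ, ∀ᵐ ω ∂P, ∫⁻ s, ∫⁻ x in Ioi a, ‖α s x ω‖ₑ ∂(leftLaw Q s ω)
      ∂(stieltjes fun u ↦ C u ω) < ∞) {M : Time T → Ω → ℝ}
    (hMc : ∀ᵐ ω ∂P, IsCadlag fun t ↦ M t ω)
    (hbr : ∀ a : ℝ, ∃ A : Time T → Ω → ℝ,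
      (IsLocalMartingale 𝓕 P fun t ω ↦ tail Q a t ω * M t ω - A t ω) ∧
      ∀ᵐ ω ∂P, ∀ t, A t ω = tailIntegral Q C α a t ω)
    {σ : Ω → WithTop (Time T)} (hσ : IsStoppingTime 𝓕 σ) (hM : Martingale (stopped σ M) 𝓕 P)
    {V : Set ℝ} (hV : MeasurableSet V) (hVI : ∀ a, ∃ a', V ∩ Ioi a = Ioi a')
    (hfin : ∫⁻ ω in L ⁻¹' V, ∫⁻ u in Ioc ⊥ (stopAt σ ⊤ ω), ‖α u (L ω) ω‖ₑ
      ∂(stieltjes fun t ↦ C t ω) ∂P < ∞) :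
    Martingale (fun t ↦ (L ⁻¹' V).indicator (stopped σ (compensated M C α L) t))
      (enlarge 𝓕 L hL) P := by
  have hNc : ∀ᵐ ω ∂P, ∀ t, ContinuousWithinAt (fun t ↦ stopped σ M t ω) (Ici t) t :=
    hMc.mono fun ω hω ↦ rightContinuous_stopped' hω.rightContinuous
  set D : Time T → Ω → ℝ := fun t ω ↦ ∫ u in Ioc ⊥ (stopAt σ t ω), α u (L ω) ω
    ∂(stieltjes fun t ↦ C t ω) with hD
  have hZ : ∀ t, stopped σ (compensated M C α L) t = fun ω ↦ stopped σ M t ω - D t ω := fun t ↦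
    funext fun ω ↦ stopped_compensated M C α L σ t ω
  simp_rw [hZ]
  have hVm : MeasurableSet (L ⁻¹' V) := hL hV
  obtain ⟨F, hF, hFb⟩ := exists_bound_drift hL hC hα hσ hfin
  have hDm : ∀ t, StronglyMeasurable[enlarge 𝓕 L hL t] (D t) := fun t ↦
    (measurable_drift_enlarge hL hC hα hσ t).stronglyMeasurable
  have hDi : ∀ t, IntegrableOn (D t) (L ⁻¹' V) P := fun t ↦ by
    refine Integrable.mono' hF ((hDm t).mono ((enlarge 𝓕 L hL).le t)).aestronglyMeasurable ?_
    filter_upwards [hFb] with ω hω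
    exact hω.2 _ _ (monotone_stopAt σ ω le_top)
  have hi : ∀ t, Integrable ((L ⁻¹' V).indicator fun ω ↦ stopped σ M t ω - D t ω) P := fun t ↦ by
    rw [integrable_indicator_iff hVm]
    exact (hM.integrable t).integrableOn.sub (hDi t)
  have hset : ∀ t (R : Set Ω), MeasurableSet R →
      ∫ ω in R, (L ⁻¹' V).indicator (fun ω ↦ stopped σ M t ω - D t ω) ω ∂P
        = ∫ ω in R ∩ L ⁻¹' V, stopped σ M t ω ∂P - ∫ ω in R ∩ L ⁻¹' V, D t ω ∂P := fun t R hR ↦ by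
    rw [setIntegral_indicator hVm, integral_sub (hM.integrable t).integrableOn
      ((hDi t).mono_set inter_subset_right)]
  -- This settles `𝓕 s ∨ σ(L)`: on the generating sets the indicator of `V` merely raises the
  -- threshold from `a` to `a'`.
  have step : ∀ s t, s ≤ t → ∀ A, MeasurableSet[𝓕 s ⊔ MeasurableSpace.comap L inferInstance] A →
      ∫ ω in A, ((L ⁻¹' V).indicator (fun ω ↦ stopped σ M t ω - D t ω) ω
        - (L ⁻¹' V).indicator (fun ω ↦ stopped σ M s ω - D s ω) ω) ∂P = 0 := by
    intro s t hst A hA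
    refine setIntegral_eq_zero_of_inter_Ioi (𝓕.le s) hL ((hi t).sub (hi s)) (fun B hB a ↦ ?_) hA
    obtain ⟨a', ha'⟩ := hVI a
    obtain ⟨A', hA', hAt⟩ := hbr a'
    have hsub : {ω | a' < L ω} ⊆ L ⁻¹' V := fun ω hω ↦
      (show L ω ∈ V ∩ Ioi a from ha' ▸ hω).1
    have hRm : MeasurableSet (B ∩ {ω | a < L ω}) := (𝓕.le _ _ hB).inter (hL measurableSet_Ioi)
    have hR : B ∩ {ω | a < L ω} ∩ L ⁻¹' V = B ∩ {ω | a' < L ω} := by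
      ext ω
      have : L ω ∈ V ∩ Ioi a ↔ L ω ∈ Ioi a' := by rw [ha']
      simp only [mem_inter_iff, mem_Ioi] at this
      simp only [mem_inter_iff, mem_ofPred_eq, mem_preimage, ← this]
      tauto
    have h := setIntegral_stopped_sub h𝓕 hL hQ hC hα (hint a') hMc hA' hAt hσ hM
      ((lintegral_mono_set hsub).trans_lt hfin) hst hB
    have hsub' : B ∩ {ω | a' < L ω} ⊆ L ⁻¹' V := inter_subset_right.trans hsub
    rw [integral_sub' (hi t).integrableOn (hi s).integrableOn, hset t _ hRm, hset s _ hRm, hR]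
    rw [integral_sub (hM.integrable t).integrableOn (hM.integrable s).integrableOn] at h
    have h2 : ∫ ω in B ∩ {ω | a' < L ω}, ∫ u in Ioc (stopAt σ s ω) (stopAt σ t ω), α u (L ω) ω
        ∂(stieltjes fun t ↦ C t ω) ∂P
        = ∫ ω in B ∩ {ω | a' < L ω}, D t ω ∂P - ∫ ω in B ∩ {ω | a' < L ω}, D s ω ∂P := by
      rw [← integral_sub ((hDi t).mono_set hsub') ((hDi s).mono_set hsub')]
      refine integral_congr_ae ?_
      filter_upwards [ae_restrict_of_ae_restrict_of_subset hsub' hFb] with ω hω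
      have hle : stopAt σ s ω ≤ stopAt σ t ω := monotone_stopAt σ ω hst
      have hiω : ∀ u v, v ≤ stopAt σ ⊤ ω → IntegrableOn (fun u ↦ α u (L ω) ω) (Ioc u v)
          (stieltjes fun t ↦ C t ω) := fun u v hv ↦ hω.1.mono_set (Ioc_subset_Ioc bot_le hv)
      simp only [hD]
      rw [← Ioc_union_Ioc_eq_Ioc bot_le hle, setIntegral_union (Ioc_disjoint_Ioc_of_le le_rfl)
        measurableSet_Ioc (hiω _ _ (monotone_stopAt σ ω le_top))
        (hiω _ _ (monotone_stopAt σ ω le_top))]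
      ring
    rw [h2] at h
    linarith
  refine martingale_of_setIntegral (fun t ↦ ?_) hi fun s t hst A hA ↦ ?_
  · exact (((hM.1 t).mono (le_enlarge hL t)).sub (hDm t)).indicator (measurable_enlarge hL t hV)
  -- An event of the enlarged σ-algebra at `s` belongs to `𝓕 u ∨ σ(L)` for each `u > s`. The
  -- identity is applied from `u n` on, and right-continuity lets `u n` decrease to `s`.
  · obtain ⟨u, -, hu, hus⟩ := exists_seq_strictAnti_tendsto' hst
    have hAm : MeasurableSet A := (enlarge 𝓕 L hL).le s _ hA
    have hus' : Tendsto u atTop (𝓝[≥] s) :=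
      tendsto_nhdsWithin_iff.2 ⟨hus, Eventually.of_forall fun n ↦ (hu n).1.le⟩
    have h1 := fun n ↦ step (u n) t (hu n).2.le A (measurableSet_of_enlarge hL (hu n).1 hA)
    rw [integral_sub (hi t).integrableOn (hi s).integrableOn]
    have hl1 : Tendsto (fun n ↦ ∫ ω in A ∩ L ⁻¹' V, stopped σ M (u n) ω ∂P) atTop
        (𝓝 (∫ ω in A ∩ L ⁻¹' V, stopped σ M s ω ∂P)) := by
      refine (tendsto_of_condExp (hM.integrable t) (fun n ↦ 𝓕.le (u n))
        (fun n ↦ (hM.2 (u n) t (hu n).2.le).symm) ?_).2 _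
      filter_upwards [hNc] with ω hω using (hω s).tendsto.comp hus'
    have hl2 : Tendsto (fun n ↦ ∫ ω in A ∩ L ⁻¹' V, D (u n) ω ∂P) atTop
        (𝓝 (∫ ω in A ∩ L ⁻¹' V, D s ω ∂P)) := by
      refine tendsto_integral_of_dominated_convergence F (fun n ↦ ?_)
        (hF.mono_set inter_subset_right) (fun n ↦ ?_) ?_
      · exact ((hDm (u n)).mono ((enlarge 𝓕 L hL).le _)).aestronglyMeasurable
      · filter_upwards [ae_restrict_of_ae_restrict_of_subset inter_subset_right hFb] with ω hω
        exact hω.2 _ _ (monotone_stopAt σ ω le_top)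
      · filter_upwards [ae_restrict_of_ae_restrict_of_subset inter_subset_right hFb] with ω hω
        have hc := isCadlag_setIntegral hω.1
        have he : ∀ v, ∫ u in Ioc ⊥ (stopAt σ v ω), α u (L ω) ω
            ∂((stieltjes fun t ↦ C t ω).restrict (Ioc ⊥ (stopAt σ ⊤ ω))) = D v ω := fun v ↦ by
          rw [Measure.restrict_restrict measurableSet_Ioc, inter_eq_left.2
            (Ioc_subset_Ioc_right (monotone_stopAt σ ω le_top))]
        have hcs : ContinuousWithinAt (fun v ↦ D v ω) (Ici s) s := by
          simp_rw [← he]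
          exact rightContinuous_stopped (fun t ↦ (hc t).1) σ ω s
        exact hcs.tendsto.comp hus'
    have hl := (hl1.sub hl2).congr fun n ↦ (hset (u n) A hAm).symm
    rw [← hset s A hAm] at hl
    refine sub_eq_zero.2 (tendsto_nhds_unique (tendsto_const_nhds.congr fun n ↦ ?_) hl)
    have := h1 n
    rw [integral_sub (hi t).integrableOn (hi _).integrableOn] at this
    exact sub_eq_zero.1 this

end

/-! ### The compensated process is a local martingale for the enlarged filtration -/

lemma stopped_stopped_of_le {σ τ : Ω → WithTop (Time T)} (h : σ ≤ τ) (X : Time T → Ω → ℝ) :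
    stopped σ (stopped τ X) = stopped σ X := by
  ext t ω
  by_cases hσ : ω ∈ {ω | ⊥ < σ ω}
  · have hτ : ω ∈ {ω | ⊥ < τ ω} := lt_of_lt_of_le (show ⊥ < σ ω from hσ) (h ω)
    simp only [stopped, indicator_of_mem hσ, indicator_of_mem hτ]
    rw [stopAt_of_le ((coe_stopAt_le σ t ω).trans (h ω))]
  · simp only [stopped, indicator_of_notMem hσ]

lemma IsStoppingTime.piecewise_bot {𝓕 : Filtration (Time T) m} {σ : Ω → WithTop (Time T)}
    (hσ : IsStoppingTime 𝓕 σ) {R : Set Ω} (hR : MeasurableSet[𝓕 ⊥] R) [DecidablePred (· ∈ R)] :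
    IsStoppingTime 𝓕 (R.piecewise σ fun _ ↦ ((⊥ : Time T) : WithTop (Time T))) := by
  intro t
  have h := 𝓕.mono (bot_le (a := t)) _ hR
  have : {ω | R.piecewise σ (fun _ ↦ ((⊥ : Time T) : WithTop (Time T))) ω ≤ t}
      = R ∩ {ω | σ ω ≤ t} ∪ Rᶜ := by
    ext ω
    by_cases hω : ω ∈ R
    · simp [hω]
    · simp [hω]
  rw [this]
  exact (h.inter (hσ t)).union h.compl

/-- Stopping at `0` off `R` kills the process there, by the convention `1_{τ > 0}`. This is how an
event known at time `0` enters a localizing sequence. -/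
lemma stopped_piecewise_bot (σ : Ω → WithTop (Time T)) (R : Set Ω) [DecidablePred (· ∈ R)]
    (X : Time T → Ω → ℝ) (t : Time T) :
    stopped (R.piecewise σ fun _ ↦ ((⊥ : Time T) : WithTop (Time T))) X t
      = R.indicator (stopped σ X t) := by
  ext ω
  by_cases hω : ω ∈ R
  · have h : R.piecewise σ (fun _ ↦ ((⊥ : Time T) : WithTop (Time T))) ω = σ ω := by simp [hω]
    rw [indicator_of_mem hω]
    simp only [stopped, indicator, mem_ofPred_eq, h, stopAt_congr h]
  · rw [indicator_of_notMem hω, stopped, indicator_of_notMem]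
    simp [hω]

lemma IsCadlag.sub {f g : Time T → ℝ} (hf : IsCadlag f) (hg : IsCadlag g) :
    IsCadlag fun t ↦ f t - g t := fun t ↦ by
  obtain ⟨l, hl⟩ := (hf t).2
  obtain ⟨l', hl'⟩ := (hg t).2
  exact ⟨(hf t).1.sub (hg t).1, _, hl.sub hl'⟩

/-- Stopping times which are eventually `⊤` can be replaced by nondecreasing ones. -/
lemma exists_monotone_stoppingTime {𝓕 : Filtration (Time T) m} {P : Measure Ω}
    (h𝓕 : 𝓕.IsRightContinuous) {S : ℕ → Ω → WithTop (Time T)}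
    (hS : ∀ n, IsStoppingTime 𝓕 (S n)) (htop : ∀ᵐ ω ∂P, ∀ᶠ n in atTop, S n ω = ⊤) :
    ∃ I : ℕ → Ω → WithTop (Time T), IsLocalizingSequence 𝓕 I P ∧ ∀ n ω, I n ω ≤ S n ω := by
  choose I hI hglb using fun n ↦ exists_isStoppingTime_isGLB h𝓕 fun j ↦ hS (n + j)
  refine ⟨I, ⟨⟨hI, ?_⟩, ae_of_all _ fun ω n k hnk ↦ ?_⟩, fun n ω ↦ (hglb n ω).1 ⟨0, rfl⟩⟩
  · filter_upwards [htop] with ω hω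
    obtain ⟨N, hN⟩ := eventually_atTop.1 hω
    refine tendsto_const_nhds.congr' ((eventually_ge_atTop N).mono fun n hn ↦ ?_)
    refine (top_le_iff.1 ((hglb n ω).2 ?_)).symm
    rintro _ ⟨j, rfl⟩
    exact (hN _ (hn.trans (Nat.le_add_right _ _))).ge
  · refine (hglb k ω).2 ?_
    rintro _ ⟨j, rfl⟩
    refine (hglb n ω).1 ⟨k - n + j, ?_⟩
    simp only [← add_assoc, Nat.add_sub_cancel' hnk]

section

variable {𝓕 : Filtration (Time T) m} {P : Measure Ω} [IsFiniteMeasure P] {L : Ω → ℝ}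
  {Q : Time T → Ω → ProbabilityMeasure ℝ} {C : Time T → Ω → ℝ} {α : Time T → ℝ → Ω → ℝ}

theorem isLocalMartingale_compensated (h𝓕 : UsualConditions 𝓕 P) (hL : Measurable L)
    (hQ : IsCadlagLaw 𝓕 P L Q) (hC : IsIncreasing 𝓕 C)
    (hα : Measurable[𝓕.predictable.prod (borel ℝ)] fun p : (Time T × Ω) × ℝ ↦ α p.1.1 p.2 p.1.2)
    (hint : ∀ a : ℝ, ∀ᵐ ω ∂P, ∫⁻ s, ∫⁻ x in Ioi a, ‖α s x ω‖ₑ ∂(leftLaw Q s ω)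
      ∂(stieltjes fun u ↦ C u ω) < ∞) {M : Time T → Ω → ℝ} (hM : IsLocalMartingale 𝓕 P M)
    (hbr : ∀ a : ℝ, ∃ A : Time T → Ω → ℝ,
      (IsLocalMartingale 𝓕 P fun t ω ↦ tail Q a t ω * M t ω - A t ω) ∧
      ∀ᵐ ω ∂P, ∀ t, A t ω = tailIntegral Q C α a t ω) :
    IsLocalMartingale (enlarge 𝓕 L hL) P (compensated M C α L) := by
  classical
  obtain ⟨hMc, τ, hτ, hMτ⟩ := hM
  simp_rw [stoppedProcess_indicator] at hMτ
  refine ⟨?_, ?_⟩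
  · filter_upwards [hMc, ae_integrable_drift h𝓕 hL hQ hC hα hint] with ω h1 h2
    exact h1.sub (isCadlag_setIntegral h2)
  -- The summable bounds `2⁻ⁿ` allow the Borel–Cantelli lemma: almost surely `S n = ⊤` for all large
  -- `n`.
  choose S hS hSP hSfin using fun n : ℕ ↦ exists_stoppingTime_lintegral_lt_top h𝓕 hL hQ hC hα
    (hint (-(n : ℝ))) (ε := (2⁻¹ : ℝ≥0∞) ^ n) (by simp)
  have hStop : ∀ᵐ ω ∂P, ∀ᶠ n in atTop, S n ω = ⊤ := by
    have hsum : ∑' n, P {ω | S n ω < ⊤} ≠ ∞ := by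
      refine ((ENNReal.tsum_le_tsum hSP).trans_lt ?_).ne
      rw [ENNReal.tsum_geometric, ENNReal.one_sub_inv_two, inv_inv]
      exact ENNReal.ofNat_lt_top
    filter_upwards [ae_eventually_notMem hsum] with ω hω
    filter_upwards [hω] with n hn
    exact not_lt_top_iff.1 hn
  obtain ⟨I, hI, hIS⟩ := exists_monotone_stoppingTime h𝓕.rightCont hS hStop
  have hσ := hτ.min hI
  -- The times localize `M` and the drift, and stop at `0` unless `L > -n`, since integrability is
  -- only available on upper half-lines. They are stopping times for the enlarged filtration only.
  refine ⟨fun n ↦ (L ⁻¹' Ioi (-(n : ℝ))).piecewise ((min τ I) n)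
    fun _ ↦ ((⊥ : Time T) : WithTop (Time T)), ⟨⟨fun n ↦ ?_, ?_⟩, ?_⟩, fun n ↦ ?_⟩
  · exact IsStoppingTime.piecewise_bot
      (IsStoppingTime.mono_filtration (le_enlarge hL) (hσ.isStoppingTime n))
      (measurable_enlarge hL ⊥ measurableSet_Ioi)
  · filter_upwards [hσ.tendsto_top] with ω hω
    obtain ⟨N, hN⟩ := exists_nat_gt (-L ω)
    refine hω.congr' ((eventually_ge_atTop N).mono fun n hn ↦ ?_)
    have : (N : ℝ) ≤ n := by exact_mod_cast hn
    refine (piecewise_eq_of_mem _ _ _ ?_).symm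
    change -(n : ℝ) < L ω
    linarith
  · filter_upwards [hσ.mono] with ω hω n k hnk
    have hnk' : (n : ℝ) ≤ k := by exact_mod_cast hnk
    by_cases h : -(n : ℝ) < L ω
    · have h' : -(k : ℝ) < L ω := by linarith
      simpa [h, h', piecewise] using hω hnk
    · simp [h, piecewise]
  · rw [stoppedProcess_indicator]
    have hmart : Martingale (stopped ((min τ I) n) M) 𝓕 P := by
      rw [← stopped_stopped_of_le (show (min τ I) n ≤ τ n from fun ω ↦ min_le_left _ _)]
      exact martingale_stopped h𝓕 (hMτ n)
        (hMc.mono fun ω hω ↦ rightContinuous_stopped' hω.rightContinuous) (hσ.isStoppingTime n)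
    have h := martingale_indicator_stopped h𝓕 hL hQ hC hα hint hMc hbr (hσ.isStoppingTime n) hmart
      (measurableSet_Ioi (a := -(n : ℝ))) (fun a ↦ ⟨max (-(n : ℝ)) a, Ioi_inter_Ioi⟩) ?_
    · convert h using 1
      ext t ω
      rw [stopped_piecewise_bot]
    · refine (lintegral_mono fun ω ↦ lintegral_mono_set (Ioc_subset_Ioc_right ?_)).trans_lt (hSfin n)
      exact stopAt_mono_left (τ := (min τ I) n) ((min_le_right (τ n ω) (I n ω)).trans (hIS n ω)) ⊤

/-- Global integrability makes localization unnecessary: the stopping time is `⊤` and `V` is the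
whole line. -/
theorem martingale_compensated (h𝓕 : UsualConditions 𝓕 P) (hL : Measurable L)
    (hQ : IsCadlagLaw 𝓕 P L Q) (hC : IsIncreasing 𝓕 C)
    (hα : Measurable[𝓕.predictable.prod (borel ℝ)] fun p : (Time T × Ω) × ℝ ↦ α p.1.1 p.2 p.1.2)
    (hint : ∀ a : ℝ, ∀ᵐ ω ∂P, ∫⁻ s, ∫⁻ x in Ioi a, ‖α s x ω‖ₑ ∂(leftLaw Q s ω)
      ∂(stieltjes fun u ↦ C u ω) < ∞) {M : Time T → Ω → ℝ}
    (hMc : ∀ᵐ ω ∂P, IsCadlag fun t ↦ M t ω)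
    (hbr : ∀ a : ℝ, ∃ A : Time T → Ω → ℝ,
      (IsLocalMartingale 𝓕 P fun t ω ↦ tail Q a t ω * M t ω - A t ω) ∧
      ∀ᵐ ω ∂P, ∀ t, A t ω = tailIntegral Q C α a t ω) (hM : Martingale M 𝓕 P)
    (hfin : ∫⁻ ω, ∫⁻ s, ‖α s (L ω) ω‖ₑ ∂(stieltjes fun u ↦ C u ω) ∂P < ∞) :
    Martingale (compensated M C α L) (enlarge 𝓕 L hL) P := by
  have htop : ∀ X : Time T → Ω → ℝ, stopped (fun _ ↦ ⊤) X = X := fun X ↦ by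
    ext t ω
    rw [stopped_of_lt (τ := fun _ ↦ ⊤) (s := ⊥) (WithTop.coe_lt_top _), stopAt_of_le (τ := fun _ ↦ ⊤) le_top]
  have h := martingale_indicator_stopped h𝓕 hL hQ hC hα hint hMc hbr (σ := fun _ ↦ ⊤)
    (fun i ↦ by simp) (by rwa [htop]) MeasurableSet.univ (fun a ↦ ⟨a, univ_inter _⟩) ?_
  · simpa only [htop, preimage_univ, indicator_univ] using h
  · simp only [preimage_univ, Measure.restrict_univ]
    exact (lintegral_mono fun ω ↦ setLIntegral_le_lintegral _ _).trans_lt hfin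

end

/-! ### Reduction to versions with good paths -/

section

variable {𝓕 : Filtration (Time T) m} {P : Measure Ω}

lemma IsLocalMartingale.congr (h𝓕 : UsualConditions 𝓕 P) {X Y : Time T → Ω → ℝ}
    (hX : IsLocalMartingale 𝓕 P X) (hXY : ∀ᵐ ω ∂P, ∀ t, X t ω = Y t ω) :
    IsLocalMartingale 𝓕 P Y := by
  obtain ⟨hc, τ, hτ, h⟩ := hX
  refine ⟨?_, τ, hτ, fun n ↦ ?_⟩
  · filter_upwards [hc, hXY] with ω h1 h2
    simpa only [h2] using h1
  · have hn := h n
    rw [stoppedProcess_indicator] at hn ⊢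
    refine martingale_congr h𝓕 hn fun t ↦ ?_
    filter_upwards [hXY] with ω hω
    simp only [stopped, indicator, hω]

lemma IsPredictableQuadraticVariation.exists_isIncreasing (h𝓕 : UsualConditions 𝓕 P)
    {X C : Time T → Ω → ℝ} (hC : IsPredictableQuadraticVariation 𝓕 P X C) :
    ∃ C', IsIncreasing 𝓕 C' ∧ ∀ᵐ ω ∂P, ∀ t, C t ω = C' t ω := by
  let G : Set Ω := {ω | C ⊥ ω = 0 ∧ Monotone (fun t ↦ C t ω) ∧
    ∀ t, ContinuousWithinAt (fun t ↦ C t ω) (Ici t) t}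
  have hG : ∀ᵐ ω ∂P, ω ∈ G := by
    filter_upwards [hC.zero, hC.mono, hC.cadlag] with ω h0 h1 h2
    exact ⟨h0, h1, h2.rightContinuous⟩
  have hGm : MeasurableSet[𝓕 ⊥] G := by
    have := (h𝓕.null Gᶜ (ae_iff.1 hG)).compl
    rwa [compl_compl] at this
  refine ⟨fun t ↦ G.indicator (C t), ⟨?_, fun ω ↦ ?_, fun ω ↦ ?_, fun ω ↦ ?_⟩, ?_⟩
  · exact hC.predictable.measurable.indicator (measurableSet_snd_predictable hGm)
  · by_cases h : ω ∈ G
    · rw [indicator_of_mem h, h.1]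
    · rw [indicator_of_notMem h]
  · by_cases h : ω ∈ G
    · simpa only [indicator_of_mem h] using h.2.1
    · simpa only [indicator_of_notMem h] using monotone_const
  · by_cases h : ω ∈ G
    · simpa only [indicator_of_mem h] using h.2.2
    · simpa only [indicator_of_notMem h] using fun t ↦ continuousWithinAt_const
  · filter_upwards [hG] with ω hω t
    rw [indicator_of_mem hω]

lemma leftLaw_congr {Q Q' : Time T → Ω → ProbabilityMeasure ℝ} {ω : Ω}
    (h : ∀ t, Q t ω = Q' t ω) (t : Time T) : leftLaw Q t ω = leftLaw Q' t ω := by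
  simp only [leftLaw, h]

end

end Enlargement

end

/-! ### The main theorem. -/

theorem mainTheorem3 {Ω : Type*} {m : MeasurableSpace Ω} (P : Measure Ω) [IsProbabilityMeasure P]
    (T : ℝ≥0) (hT : 0 < T)
    (𝓕 : Filtration (Enlargement.Time T) m) (h𝓕 : Enlargement.UsualConditions 𝓕 P)
    (L : Ω → ℝ) (hL : Measurable L)
    (Q : Enlargement.Time T → Ω → ProbabilityMeasure ℝ)
    (hQ : Enlargement.IsRegularConditionalLaw 𝓕 P L Q)
    (M C : Enlargement.Time T → Ω → ℝ)
    (hM : Enlargement.IsLocalMartingale 𝓕 P M)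
    (hC : Enlargement.IsPredictableQuadraticVariation 𝓕 P M C)
    (α : Enlargement.Time T → ℝ → Ω → ℝ)
    -- `α` is measurable for the product of the predictable and the Borel σ-algebras
    (hα : Measurable[𝓕.predictable.prod (borel ℝ)]
      fun p : (Enlargement.Time T × Ω) × ℝ ↦ α p.1.1 p.2 p.1.2)
    -- the integrals `∫_0^t ∫_a^∞ α_s^x Q_{s-}(dx) d⟨M, M⟩_s` converge absolutely
    (hint : ∀ a : ℝ, ∀ᵐ ω ∂P,
      ∫⁻ s, ∫⁻ x in Ioi a, ‖α s x ω‖ₑ ∂(Enlargement.leftLaw Q s ω)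
        ∂(Enlargement.stieltjes fun u ↦ C u ω) < ∞)
    -- and they represent `⟨∫_a^∞ Q(·, dx), M⟩`
    (hbracket : ∀ a : ℝ, ∃ A : Enlargement.Time T → Ω → ℝ,
      Enlargement.IsPredictableCovariation 𝓕 P (Enlargement.tail Q a) M A ∧
      ∀ᵐ ω ∂P, ∀ t, A t ω = Enlargement.tailIntegral Q C α a t ω) :
    (∀ᵐ ω ∂P, Integrable (fun s ↦ α s (L ω) ω) (Enlargement.stieltjes fun u ↦ C u ω)) ∧
    Enlargement.IsLocalMartingale (Enlargement.enlarge 𝓕 L hL) P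
      (Enlargement.compensated M C α L) ∧
    (Martingale M 𝓕 P →
      ∫⁻ ω, ∫⁻ s, ‖α s (L ω) ω‖ₑ ∂(Enlargement.stieltjes fun u ↦ C u ω) ∂P < ∞ →
      Martingale (Enlargement.compensated M C α L) (Enlargement.enlarge 𝓕 L hL) P) := by
  -- The processes `Q` and `C` are replaced by indistinguishable versions all of whose paths are
  -- regular. The hypotheses transfer almost surely, and the conclusions return because the enlarged
  -- filtration is complete too.
  obtain ⟨Q', hQ', hQQ⟩ := hQ.exists_isCadlagLaw h𝓕 hL
  obtain ⟨C', hC', hCC⟩ := hC.exists_isIncreasing h𝓕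
  have hint' : ∀ a : ℝ, ∀ᵐ ω ∂P, ∫⁻ s, ∫⁻ x in Ioi a, ‖α s x ω‖ₑ ∂(Enlargement.leftLaw Q' s ω)
      ∂(Enlargement.stieltjes fun u ↦ C' u ω) < ∞ := fun a ↦ by
    filter_upwards [hint a, hQQ, hCC] with ω h1 h2 h3
    simpa only [← Enlargement.leftLaw_congr h2, ← h3] using h1
  have hbr : ∀ a : ℝ, ∃ A : Enlargement.Time T → Ω → ℝ,
      (Enlargement.IsLocalMartingale 𝓕 P fun t ω ↦ Enlargement.tail Q' a t ω * M t ω - A t ω) ∧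
      ∀ᵐ ω ∂P, ∀ t, A t ω = Enlargement.tailIntegral Q' C' α a t ω := fun a ↦ by
    obtain ⟨A, hA, hAt⟩ := hbracket a
    refine ⟨A, hA.localMartingale.congr h𝓕 ?_, ?_⟩
    · filter_upwards [hQQ] with ω h t
      simp only [Enlargement.tail, h]
    · filter_upwards [hAt, hQQ, hCC] with ω h1 h2 h3 t
      rw [h1]
      simp only [Enlargement.tailIntegral, Enlargement.leftLaw_congr h2, h3]
  have hcomp : ∀ᵐ ω ∂P, ∀ t, Enlargement.compensated M C' α L t ω
      = Enlargement.compensated M C α L t ω := by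
    filter_upwards [hCC] with ω h t
    simp only [Enlargement.compensated, h]
  have h𝓖 := h𝓕.enlarge hL
  refine ⟨?_, ?_, fun hMm hfin ↦ ?_⟩
  · filter_upwards [Enlargement.ae_integrable_drift h𝓕 hL hQ' hC' hα hint', hCC] with ω h1 h2
    simpa only [h2] using h1
  · exact (Enlargement.isLocalMartingale_compensated h𝓕 hL hQ' hC' hα hint' hM hbr).congr h𝓖 hcomp
  · refine Enlargement.martingale_congr h𝓖 (Enlargement.martingale_compensated h𝓕 hL hQ' hC' hα
      hint' hM.1 hbr hMm ?_) fun t ↦ hcomp.mono fun ω h ↦ h t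
    refine lt_of_eq_of_lt (lintegral_congr_ae ?_) hfin
    filter_upwards [hCC] with ω h
    simp only [h]
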